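/- Let $c>0$ and let $\lambda\in C^2((0,\infty),[0,\infty))$. Consider the reflecting orthogonal planar random motion $(X(t),Y(t))_{t\ge 0}$: a particle starts at the origin with a direction chosen uniformly among $d_k=(\cos(k\pi/2),\sin(k\pi/2))$, $k=0,1,2,3$, moves with speed $c$, and at each event of a non-homogeneous Poisson process on $(0,\infty)$ with rate function $\lambda(t)$ it switches, independently of the past and of the Poisson process, to one of the three other directions, each with probability $1/3$. (If $\int_0^t\lambda(s)\,ds=\infty$, events accumulate at time $0$; the successive directions are then indexed by $\mathbb Z$ and each is uniformly distributed.) Let $S_{ct}=\{(x,y)\in\mathbb R^2:|x|+|y|\le ct\}$ and, for $t>0$, let $p(\cdot,\cdot,t)$ be a version of the density of the absolutely continuous component of the law of $(X(t),Y(t))$ in its Lebesgue decomposition. (i) On every open set $O\subseteq\mathbb R^2\times(0,\infty)$ on which $p$ is of class $C^4$, one has $p\ge 0$ and $$\frac{\partial^4p}{\partial t^4} + 4\lambda \frac{\partial^3p}{\partial t^3}+\Bigl(\frac{16}{3}\lambda^2+4\lambda'\Bigr)\frac{\partial^2p}{\partial t^2}+ \Bigl(\frac{64}{27}\lambda^3+\frac{16}{3}\lambda\lambda'+\frac{4}{3}\lambda''\Bigr)\frac{\partial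 p}{\partial t} + c^4\frac{\partial^4 p}{\partial x^2\partial y^2} =c^2\Bigl(\frac{\partial^2}{\partial x^2}+\frac{\partial^2}{\partial y^2}\Bigr)\Bigl(\frac{\partial^2p}{\partial t^2}+2\lambda\frac{\partial p}{\partial t} + \bigl(\tfrac{8}{9}\lambda^2+\tfrac{2}{3}\lambda'\bigr)p\Bigr).$$ (ii) Without any regularity assumption on $p$, the same equation holds tested in space: for every $t_0>0$ and every $\varphi\in C_c^\infty(\mathbb R^2)$ supported in $\{|x|+|y|<ct_0,\ x\ne0,\ y\ne0\}$, the function $t\mapsto \langle p,\varphi\rangle(t)=\int_{\mathbb R^2}p(x,y,t)\varphi(x,y)\,dx\,dy$ is of class $C^4$ near $t_0$ and, at $t=t_0$, with $\Delta=\partial_x^2+\partial_y^2$, $$\Bigl[\tfrac{d^4}{dt^4}+4\lambda\tfrac{d^3}{dt^3}+\bigl(\tfrac{16}{3}\lambda^2+4\lambda'\bigr)\tfrac{d^2}{dt^2}+\bigl(\tfrac{64}{27}\lambda^3+\tfrac{16}{3}\lambda\lambda'+\tfrac43\lambda''\bigr)\tfrac{d}{dt}\Bigr]\langle p,\varphi\rangle+c^4\langle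 p,\partial_x^2\partial_y^2\varphi\rangle=c^2\Bigl[\tfrac{d^2}{dt^2}+2\lambda\tfrac{d}{dt}+\tfrac89\lambda^2+\tfrac23\lambda'\Bigr]\langle p,\Delta\varphi\rangle .$$ (iii) For every $t>0$, $p(\cdot,\cdot,t)\ge0$ almost everywhere, $p(\cdot,\cdot,t)$ is integrable on $S_{ct}$, and $$\int_{S_{ct}}p(x,y,t)\,dx\,dy=1-3e^{-\frac23\Lambda(t)}+2e^{-\Lambda(t)},\qquad \Lambda(t)=\int_0^t\lambda(s)\,ds\in[0,\infty],$$ with $e^{-\infty}=0$. -/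

import Mathlib

open MeasureTheory ProbabilityTheory Set

namespace OrthogonalMotion

/-- First coordinate `cos (k π / 2)` of the direction `d_k`, `k = 0, 1, 2, 3`. -/
noncomputable def dirX (k : Fin 4) : ℝ := Real.cos ((k : ℕ) * Real.pi / 2)

/-- Second coordinate `sin (k π / 2)` of the direction `d_k`, `k = 0, 1, 2, 3`. -/
noncomputable def dirY (k : Fin 4) : ℝ := Real.sin ((k : ℕ) * Real.pi / 2)

/-- `N` is a counting process on `(0, ∞)` for a non-homogeneous Poisson process of rate `lam`:
`N t - N s` is the number of events in `(s, t]` for `0 < s ≤ t`. Events are labelled by integers and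
only increments of `N` matter: if `lam` is integrable at `0` one may take `N t` to be the number of
events in `(0, t]`; if it is not, infinitely many events accumulate at time `0`, and one may take
`N 1 = 0`. -/
structure IsPoissonCounting {Ω : Type*} [MeasurableSpace Ω] (P : Measure Ω) (lam : ℝ → ℝ)
    (N : ℝ → Ω → ℤ) : Prop where
  measurable : ∀ t, 0 < t → Measurable (N t)
  monotone : ∀ ω, MonotoneOn (fun t => N t ω) (Ioi 0)
  right_continuous : ∀ ω t, 0 < t → ContinuousWithinAt (fun s => N s ω) (Ici t) t
  indep_increments : HasIndepIncrements (fun (t : Ioi (0 : ℝ)) ω => N t ω) P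
  law_increments : ∀ s t, 0 < s → s ≤ t →
    P.map (fun ω => N t ω - N s ω) =
      (poissonMeasure (Real.toNNReal (∫ u in s..t, lam u))).map (fun n : ℕ => (n : ℤ))

/-- `K` is the sequence of successive directions of the reflecting motion: each direction is
uniformly distributed, and at every event the new direction is chosen uniformly among the three
directions different from the current one, independently of the past. -/
structure IsReflectingDirectionSequence {Ω : Type*} [MeasurableSpace Ω] (P : Measure Ω)
    (K : ℤ → Ω → Fin 4) : Prop where
  measurable : ∀ n, Measurable (K n)
  law : ∀ (m : ℤ) (n : ℕ) (k : Fin (n + 1) → Fin 4),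
    P.real {ω | ∀ i : Fin (n + 1), K (m + ((i : ℕ) : ℤ)) ω = k i} =
      1 / 4 * ∏ i : Fin n, (if k i.succ = k i.castSucc then 0 else 1 / 3 : ℝ)

/-- `(X, Y)` is the position of the reflecting orthogonal planar random motion with speed `c` and
rate function `lam`: it starts at the origin and moves with velocity `c • d_k`, where `k` is the
current direction `K (N t)`; the direction changes exactly at the events of the Poisson process `N`,
which is independent of the sequence `K` of directions. -/
structure IsReflectingMotion {Ω : Type*} [MeasurableSpace Ω] (P : Measure Ω) (c : ℝ) (lam : ℝ → ℝ)
    (N : ℝ → Ω → ℤ) (K : ℤ → Ω → Fin 4) (X Y : ℝ → Ω → ℝ) : Prop where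
  poisson : IsPoissonCounting P lam N
  directions : IsReflectingDirectionSequence P K
  indep : IndepFun (fun ω (t : Ioi (0 : ℝ)) => N t ω) (fun ω (n : ℤ) => K n ω) P
  measurable_X : ∀ t, Measurable (X t)
  measurable_Y : ∀ t, Measurable (Y t)
  position_X : ∀ t, 0 ≤ t → ∀ ω, X t ω = ∫ s in (0 : ℝ)..t, c * dirX (K (N s ω) ω)
  position_Y : ∀ t, 0 ≤ t → ∀ ω, Y t ω = ∫ s in (0 : ℝ)..t, c * dirY (K (N s ω) ω)

/-- `f` is (a version of) the density, with respect to Lebesgue measure on the plane, of the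
absolutely continuous component of `μ` in its Lebesgue decomposition. -/
def IsAbsContDensity (μ : Measure (ℝ × ℝ)) (f : ℝ → ℝ → ℝ) : Prop :=
  (fun z : ℝ × ℝ => f z.1 z.2) =ᵐ[volume] fun z => (μ.rnDeriv volume z).toReal

/-- The closed square `|x| + |y| ≤ r`. -/
def square (r : ℝ) : Set (ℝ × ℝ) := {z | |z.1| + |z.2| ≤ r}

/-- The open square `|x| + |y| < r` with its two diagonals removed. -/
def openSquareOffDiagonals (r : ℝ) : Set (ℝ × ℝ) := {z | |z.1| + |z.2| < r ∧ z.1 ≠ 0 ∧ z.2 ≠ 0}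

/-- `∂⁴f/∂x²∂y²`. -/
noncomputable def dxxyy (f : ℝ → ℝ → ℝ) (x y : ℝ) : ℝ :=
  iteratedDeriv 2 (fun x' => iteratedDeriv 2 (fun y' => f x' y') y) x

/-- `∂²f/∂x² + ∂²f/∂y²`. -/
noncomputable def laplacian (f : ℝ → ℝ → ℝ) (x y : ℝ) : ℝ :=
  iteratedDeriv 2 (fun x' => f x' y) x + iteratedDeriv 2 (fun y' => f x y') y

/-- `u'''' + 4λ u''' + (16/3 λ² + 4λ') u'' + (64/27 λ³ + 16/3 λλ' + 4/3 λ'') u'`. -/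
noncomputable def timeOpFour (lam u : ℝ → ℝ) (t : ℝ) : ℝ :=
  iteratedDeriv 4 u t + 4 * lam t * iteratedDeriv 3 u t
    + (16 / 3 * lam t ^ 2 + 4 * deriv lam t) * iteratedDeriv 2 u t
    + (64 / 27 * lam t ^ 3 + 16 / 3 * lam t * deriv lam t + 4 / 3 * iteratedDeriv 2 lam t)
      * deriv u t

/-- `u'' + 2λ u' + (8/9 λ² + 2/3 λ') u`. -/
noncomputable def timeOpTwo (lam u : ℝ → ℝ) (t : ℝ) : ℝ :=
  iteratedDeriv 2 u t + 2 * lam t * deriv u t + (8 / 9 * lam t ^ 2 + 2 / 3 * deriv lam t) * u t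

/-- The fourth-order equation for `p` at the point `(x, y, t)`, with classical derivatives. -/
def SatisfiesEquationAt (c : ℝ) (lam : ℝ → ℝ) (p : ℝ → ℝ → ℝ → ℝ) (x y t : ℝ) : Prop :=
  timeOpFour lam (fun s => p x y s) t + c ^ 4 * dxxyy (fun x' y' => p x' y' t) x y
    = c ^ 2 * laplacian (fun x' y' => timeOpTwo lam (fun s => p x' y' s) t) x y

/-- The function `t ↦ ∫∫ p(x, y, t) φ(x, y) dx dy`. -/
noncomputable def pairing (p : ℝ → ℝ → ℝ → ℝ) (φ : ℝ → ℝ → ℝ) (t : ℝ) : ℝ :=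
  ∫ z : ℝ × ℝ, p z.1 z.2 t * φ z.1 z.2

/-- The fourth-order equation for `p` at time `t`, tested in space against `φ`. -/
def SatisfiesTestedEquationAt (c : ℝ) (lam : ℝ → ℝ) (p : ℝ → ℝ → ℝ → ℝ) (φ : ℝ → ℝ → ℝ)
    (t : ℝ) : Prop :=
  timeOpFour lam (pairing p φ) t + c ^ 4 * pairing p (dxxyy φ) t
    = c ^ 2 * timeOpTwo lam (pairing p (laplacian φ)) t

end OrthogonalMotion

/-! The equation is first proved for the whole law of the position, singular part included, against
smooth test functions. Let `m_k(ψ)` be the expectation of `ψ(X(t), Y(t))` on the event that the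
current direction is `k`. Over a short interval either no event occurs and the particle moves
straight, or exactly one occurs and the direction is redrawn, or several occur, with probability
quadratic in the expected number of events. Hence the kinetic equation `m_k(ψ)' = c m_k(∂_{d_k} ψ) -
λ m_k(ψ) + (λ/3) ∑_{i ≠ k} m_i(ψ)` (`IsReflectingMotion.hasDerivAt_dirMean`).

The Markov property behind this must survive an accumulation of events at time `0`. It is obtained
at each `a > 0` by numbering the directions from the current one (`shiftDir`). The renumbered
sequence has the same law and is independent of the counting process, and increments off `[a, b]`
are independent of those over `[a, b]` (`indep_dirAlgebra_sup_incrementAlgebra`).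

Sums `A`, `E` and differences `B`, `G` over the horizontal and vertical pairs of directions turn the
four equations into a system in which `B` and `G` decay at rate `4λ/3` while `A` and `E` are coupled
only through `A - E`. Differentiating `A + E` four times and eliminating gives the fourth-order
equation (`KineticSystem.equation`). All space operators in it have even order, so passing to the
adjoint changes no sign.

The law has no singular part off the axes and the boundary of the square. A path using at most two
directions ends in that set (`IsReflectingMotion.mem_singularSet`). A path using three has three
distinct consecutive directions, and its position is then an affine function, with linearly
independent coefficients, of two switching times with absolutely continuous laws
(`measure_switchEvent_inter_eq_zero`). So pairing `p` with a test function supported off this closed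
null set is taking an expectation, which gives (ii). For (i), integration by parts and the
fundamental lemma of the calculus of variations give the equation almost everywhere, and continuity
gives it everywhere (`satisfiesEquationAt_of_tested`).

The mass of `p` is the probability of having used three directions. Among `n + 1` successive
directions at most two values occur with probability `3 · 3⁻ⁿ`, or `1` when `n = 0`. Mixing over a
Poisson number of events in `[s, t]` gives `3 e^{-2Λ/3} - 2 e^{-Λ}` for the complement
(`IsReflectingMotion.measureReal_compl_visitsThree`), and `s → 0` concludes. -/

namespace OrthogonalMotion

/-! ### Independence of increments and directions; the Markov property at a positive time. -/

section Independence

variable {Ω : Type*} {mΩ : MeasurableSpace Ω} {P : Measure Ω}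

/-- The intersections of a set of `m₁` with a set of `m₂`. -/
def interSets (m₁ m₂ : MeasurableSpace Ω) : Set (Set Ω) :=
  {s | ∃ u v, MeasurableSet[m₁] u ∧ MeasurableSet[m₂] v ∧ s = u ∩ v}

lemma isPiSystem_interSets (m₁ m₂ : MeasurableSpace Ω) : IsPiSystem (interSets m₁ m₂) := by
  rintro _ ⟨u, v, hu, hv, rfl⟩ _ ⟨u', v', hu', hv', rfl⟩ -
  refine ⟨u ∩ u', v ∩ v', hu.inter hu', hv.inter hv', ?_⟩
  ext; simp only [mem_inter_iff]; tauto

lemma generateFrom_interSets (m₁ m₂ : MeasurableSpace Ω) :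
    m₁ ⊔ m₂ = MeasurableSpace.generateFrom (interSets m₁ m₂) := by
  refine le_antisymm (sup_le ?_ ?_) (MeasurableSpace.generateFrom_le ?_)
  · intro s hs
    exact MeasurableSpace.measurableSet_generateFrom ⟨s, univ, hs, MeasurableSet.univ, by simp⟩
  · intro s hs
    exact MeasurableSpace.measurableSet_generateFrom ⟨univ, s, MeasurableSet.univ, hs, by simp⟩
  · rintro _ ⟨u, v, hu, hv, rfl⟩
    exact MeasurableSet.inter (le_sup_left (a := m₁) (b := m₂) _ hu)
      (le_sup_right (a := m₁) (b := m₂) _ hv)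

/-- If `m₁` is independent of `m₂ ⊔ m₃` and `m₂` is independent of `m₃`, then `m₁ ⊔ m₂` is
independent of `m₃`. -/
lemma indep_sup_left_of_indep_sup_right [IsProbabilityMeasure P] {m₁ m₂ m₃ : MeasurableSpace Ω}
    (h₁ : m₁ ≤ mΩ) (h₂ : m₂ ≤ mΩ) (h₃ : m₃ ≤ mΩ) (h : Indep m₁ (m₂ ⊔ m₃) P)
    (h' : Indep m₂ m₃ P) : Indep (m₁ ⊔ m₂) m₃ P := by
  refine IndepSets.indep (p2 := {s | MeasurableSet[m₃] s}) (sup_le h₁ h₂) h₃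
    (isPiSystem_interSets m₁ m₂) (fun s hs t ht _ => MeasurableSet.inter hs ht)
    (generateFrom_interSets m₁ m₂) (@MeasurableSpace.generateFrom_measurableSet _ m₃).symm ?_
  rw [IndepSets_iff]
  rintro _ t ⟨u, v, hu, hv, rfl⟩ ht
  rw [Indep_iff] at h h'
  rw [inter_assoc, h u (v ∩ t) hu, h' v t hv ht, h u v hu, mul_assoc]
  · exact le_sup_left (a := m₂) (b := m₃) _ hv
  · exact MeasurableSet.inter (le_sup_left (a := m₂) (b := m₃) _ hv)
      (le_sup_right (a := m₂) (b := m₃) _ ht)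

/-- The `σ`-algebra generated by the increments of `N` between times of `T`. -/
@[reducible] def incrementAlgebra (N : ℝ → Ω → ℤ) (T : Set ℝ) : MeasurableSpace Ω :=
  ⨆ s ∈ T, ⨆ r ∈ T, MeasurableSpace.comap (fun ω => N r ω - N s ω) ⊤

lemma incrementAlgebra_mono (N : ℝ → Ω → ℤ) {S T : Set ℝ} (h : S ⊆ T) :
    incrementAlgebra N S ≤ incrementAlgebra N T :=
  iSup₂_le fun s hs => iSup₂_le fun r hr =>
    le_iSup₂_of_le s (h hs) (le_iSup₂_of_le r (h hr) le_rfl)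

lemma measurable_sub_incrementAlgebra (N : ℝ → Ω → ℤ) {T : Set ℝ} {r s : ℝ} (hr : r ∈ T)
    (hs : s ∈ T) : Measurable[incrementAlgebra N T] (fun ω => N r ω - N s ω) := by
  refine measurable_iff_comap_le.2 ?_
  exact le_iSup₂_of_le s hs (le_iSup₂_of_le r hr le_rfl)

lemma incrementAlgebra_le_of_measurable {N : ℝ → Ω → ℤ} {T : Set ℝ} {m : MeasurableSpace Ω}
    (h : ∀ r ∈ T, ∀ s ∈ T, Measurable[m] (fun ω => N r ω - N s ω)) :
    incrementAlgebra N T ≤ m :=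
  iSup₂_le fun s hs => iSup₂_le fun r hr => measurable_iff_comap_le.1 (h r hr s hs)

/-- The `σ`-algebra generated by the values of `N` at positive times. -/
@[reducible] def countingAlgebra (N : ℝ → Ω → ℤ) : MeasurableSpace Ω :=
  MeasurableSpace.comap (fun ω (t : Ioi (0 : ℝ)) => N t ω) MeasurableSpace.pi

lemma measurable_countingAlgebra (N : ℝ → Ω → ℤ) {t : ℝ} (ht : 0 < t) :
    Measurable[countingAlgebra N] (N t) :=
  (measurable_pi_apply (X := fun _ : Ioi (0 : ℝ) => ℤ) ⟨t, ht⟩).comp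
    (comap_measurable (fun ω (t : Ioi (0 : ℝ)) => N t ω))

lemma incrementAlgebra_le_countingAlgebra (N : ℝ → Ω → ℤ) {T : Set ℝ} (hT : T ⊆ Ioi 0) :
    incrementAlgebra N T ≤ countingAlgebra N :=
  incrementAlgebra_le_of_measurable fun r hr s hs => by
    have h1 := measurable_countingAlgebra N (hT hr)
    have h2 := measurable_countingAlgebra N (hT hs)
    exact h1.sub h2

/-- A finite set of positive times is contained in the range of a monotone sequence of positive
times. -/
lemma exists_monotone_seq_of_finset (G : Finset (Ioi (0 : ℝ))) (hG : G.Nonempty) :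
    ∃ t : ℕ → Ioi (0 : ℝ), Monotone t ∧ ∀ s ∈ G, ∃ i, t i = s := by
  have hc : 0 < G.card := hG.card_pos
  refine ⟨fun i => G.orderEmbOfFin rfl ⟨min i (G.card - 1), by omega⟩, ?_, ?_⟩
  · intro i j hij
    refine (G.orderEmbOfFin rfl).monotone ?_
    simp only [Fin.mk_le_mk]; omega
  · intro s hs
    have : s ∈ Set.range (G.orderEmbOfFin rfl) := by simpa using hs
    obtain ⟨i, hi⟩ := this
    refine ⟨i, ?_⟩
    rw [← hi]
    exact congrArg _ (Fin.ext (min_eq_left (by omega)))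

lemma measurable_sub_of_measurable_steps {m : MeasurableSpace Ω} {N : ℝ → Ω → ℤ}
    {t : ℕ → Ioi (0 : ℝ)} {i j : ℕ} (hij : i ≤ j)
    (h : ∀ k, i ≤ k → k < j → Measurable[m] (fun ω => N (t (k + 1)) ω - N (t k) ω)) :
    Measurable[m] (fun ω => N (t j) ω - N (t i) ω) := by
  induction j, hij using Nat.le_induction with
  | base => simp
  | succ j hij ih =>
    have h1 := ih fun k hk hk' => h k hk (by omega)
    have h2 := h j hij (by omega)
    have : (fun ω => N (t (j + 1)) ω - N (t i) ω) =
        fun ω => (N (t j) ω - N (t i) ω) + (N (t (j + 1)) ω - N (t j) ω) := by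
      ext; ring
    rw [this]
    exact h1.add h2

variable {lam : ℝ → ℝ} {N : ℝ → Ω → ℤ} {K : ℤ → Ω → Fin 4}

lemma countingAlgebra_le (hN : IsPoissonCounting P lam N) : countingAlgebra N ≤ mΩ :=
  measurable_iff_comap_le.1 (measurable_pi_lambda _ fun t => hN.measurable t t.2)

/-- Increments over `(0, a]` and `[b, ∞)` are independent of increments over `[a, b]`. -/
lemma indep_incrementAlgebra [IsProbabilityMeasure P] (hN : IsPoissonCounting P lam N) {a b : ℝ}
    (ha : 0 < a) (hab : a ≤ b) :
    Indep (incrementAlgebra N (Ioc 0 a) ⊔ incrementAlgebra N (Ici b))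
      (incrementAlgebra N (Icc a b)) P := by
  have hb : 0 < b := ha.trans_le hab
  -- Outer increments are measured from the nearer endpoint, inner ones from `a`. Any increment
  -- between two times of one zone is a difference of two of these variables, so independence of the
  -- families `O` and `M` suffices.
  let O : {s : ℝ // (0 < s ∧ s ≤ a) ∨ b ≤ s} → Ω → ℤ :=
    fun s ω => if s.1 ≤ a then N a ω - N s ω else N s ω - N b ω
  let M : {s : ℝ // a ≤ s ∧ s ≤ b} → Ω → ℤ := fun s ω => N s ω - N a ω
  have hOpos : ∀ s : {s : ℝ // (0 < s ∧ s ≤ a) ∨ b ≤ s}, 0 < s.1 := by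
    rintro ⟨s, hs | hs⟩
    · exact hs.1
    · exact hb.trans_le hs
  have hMpos : ∀ s : {s : ℝ // a ≤ s ∧ s ≤ b}, 0 < s.1 := fun s => ha.trans_le s.2.1
  have hOm : ∀ s, Measurable (O s) := by
    intro s
    simp only [O]
    split_ifs
    · exact (hN.measurable a ha).sub (hN.measurable s (hOpos s))
    · exact (hN.measurable s (hOpos s)).sub (hN.measurable b hb)
  have hMm : ∀ s, Measurable (M s) := fun s =>
    (hN.measurable s (hMpos s)).sub (hN.measurable a ha)
  have key : IndepFun (fun ω i => O i ω) (fun ω j => M j ω) P := by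
    refine IndepFun.process_indepFun_process hOm hMm fun I J => ?_
    let G : Finset (Ioi (0 : ℝ)) := insert ⟨a, ha⟩ (insert ⟨b, hb⟩
      (I.image (fun s => ⟨s.1, hOpos s⟩) ∪ J.image (fun s => ⟨s.1, hMpos s⟩)))
    obtain ⟨t, ht, hGt⟩ := exists_monotone_seq_of_finset G ⟨_, Finset.mem_insert_self _ _⟩
    obtain ⟨ia, hia⟩ := hGt ⟨a, ha⟩ (by simp [G])
    obtain ⟨ib, hib⟩ := hGt ⟨b, hb⟩ (by simp [G])
    have hta : (t ia : ℝ) = a := by rw [hia]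
    have htb : (t ib : ℝ) = b := by rw [hib]
    have hind := hN.indep_increments.nat ht
    -- Steps of the sorted times lying outside `[a, b]`. Disjoint sets of steps generate independent
    -- σ-algebras, and `O` uses only steps in `S`, `M` only steps in its complement, up to steps of
    -- length zero.
    let S : Set ℕ := {k | (t (k + 1) : ℝ) ≤ a ∨ b ≤ (t k : ℝ)}
    let m : ℕ → MeasurableSpace Ω :=
      fun k => MeasurableSpace.comap (fun ω => N (t (k + 1)) ω - N (t k) ω) ⊤
    have hm : ∀ k, m k ≤ mΩ := fun k => measurable_iff_comap_le.1
      ((hN.measurable _ (t (k + 1)).2).sub (hN.measurable _ (t k).2))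
    have hI := indep_iSup_of_disjoint hm hind (disjoint_compl_right (a := S))
    have hstep : ∀ (U : Set ℕ) (k : ℕ), k ∈ U →
        Measurable[⨆ i ∈ U, m i] (fun ω => N (t (k + 1)) ω - N (t k) ω) := fun U k hk =>
      measurable_iff_comap_le.2 (le_iSup₂_of_le (f := fun i (_ : i ∈ U) => m i) k hk le_rfl)
    -- The sequence `t` is monotone but not injective, so the order of times need not be the order
    -- of indices; an equal time with a smaller index repairs this.
    have hle : ∀ {i j : ℕ}, (t i : ℝ) ≤ t j → ∃ i' ≤ j, t i' = t i := by
      intro i j hij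
      rcases le_total i j with h | h
      · exact ⟨i, h, rfl⟩
      · exact ⟨j, le_rfl, le_antisymm (ht h) hij⟩
    refine indep_of_indep_of_le_left (indep_of_indep_of_le_right hI ?_) ?_
    · refine measurable_iff_comap_le.1 ?_
      refine @measurable_pi_lambda _ _ _ (_) _ _ fun j => ?_
      obtain ⟨k, hk⟩ := hGt ⟨j.1, hMpos j.1⟩
        (by simp only [G, Finset.mem_insert, Finset.mem_union, Finset.mem_image]
            exact Or.inr (Or.inr (Or.inr ⟨j.1, j.2, rfl⟩)))
      have htk : (t k : ℝ) = j.1 := by rw [hk]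
      have h1 := j.1.2
      obtain ⟨i', hi', hti'⟩ := hle (i := ia) (j := k) (by rw [hta, htk]; exact h1.1)
      simp only [M]
      rw [← htk, ← hta, ← hti']
      refine measurable_sub_of_measurable_steps hi' fun l hl hl' => ?_
      have e1 : (t i' : ℝ) ≤ t l := ht hl
      have e2 : (t (l + 1) : ℝ) ≤ t k := ht hl'
      rw [hti', hta] at e1
      rw [htk] at e2
      -- A step between `a` and `b` that also counts as outer has length zero, hence a zero
      -- increment.
      by_cases hlS : l ∈ S
      · have : t (l + 1) = t l := by
          refine le_antisymm ?_ (ht (Nat.le_succ l))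
          rcases hlS with h | h
          · exact Subtype.coe_le_coe.1 (h.trans e1)
          · exact Subtype.coe_le_coe.1 ((e2.trans h1.2).trans h)
        simp only [this, sub_self]
        exact measurable_const
      · exact hstep _ _ hlS
    · refine measurable_iff_comap_le.1 ?_
      refine @measurable_pi_lambda _ _ _ (_) _ _ fun j => ?_
      obtain ⟨k, hk⟩ := hGt ⟨j.1, hOpos j.1⟩
        (by simp only [G, Finset.mem_insert, Finset.mem_union, Finset.mem_image]
            exact Or.inr (Or.inr (Or.inl ⟨j.1, j.2, rfl⟩)))
      have htk : (t k : ℝ) = j.1 := by rw [hk]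
      simp only [O]
      split_ifs with hj
      · obtain ⟨i', hi', hti'⟩ := hle (i := k) (j := ia) (by rw [hta, htk]; exact hj)
        rw [← htk, ← hta, ← hti']
        refine measurable_sub_of_measurable_steps hi' fun l hl hl' => hstep _ _ (Or.inl ?_)
        exact hta ▸ ht hl'
      · have hbj : b ≤ j.1 := j.1.2.resolve_left fun h => hj h.2
        obtain ⟨i', hi', hti'⟩ := hle (i := ib) (j := k) (by rw [htb, htk]; exact hbj)
        rw [← htk, ← htb, ← hti']
        refine measurable_sub_of_measurable_steps hi' fun l hl hl' => hstep _ _ (Or.inr ?_)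
        rw [← htb, ← hti']
        exact ht hl
  have hOc : ∀ s, Measurable[MeasurableSpace.comap (fun ω i => O i ω) MeasurableSpace.pi] (O s) :=
    fun s => (measurable_pi_apply s).comp (comap_measurable (fun ω i => O i ω))
  have hMc : ∀ s, Measurable[MeasurableSpace.comap (fun ω i => M i ω) MeasurableSpace.pi] (M s) :=
    fun s => (measurable_pi_apply s).comp (comap_measurable (fun ω i => M i ω))
  refine indep_of_indep_of_le_left (indep_of_indep_of_le_right key ?_) (sup_le ?_ ?_)
  · refine incrementAlgebra_le_of_measurable fun r hr s hs => ?_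
    convert (hMc ⟨r, hr⟩).sub (hMc ⟨s, hs⟩) using 1
    ext ω; simp [M]
  · refine incrementAlgebra_le_of_measurable fun r hr s hs => ?_
    convert (hOc ⟨s, Or.inl hs⟩).sub (hOc ⟨r, Or.inl hr⟩) using 1
    ext ω; simp [O, hr.2, hs.2]
  · refine incrementAlgebra_le_of_measurable fun r hr s hs => ?_
    -- The two branches of `O` overlap only when `r = a = b`, where both vanish.
    have h : ∀ r : ℝ, b ≤ r → ∀ ω, (if r ≤ a then N a ω - N r ω else N r ω - N b ω) =
        N r ω - N b ω := by
      intro r hr ω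
      split_ifs with h
      · have h1 : r = a := le_antisymm h (hab.trans hr)
        have h2 : b = a := le_antisymm (hr.trans h) hab
        simp [h1, h2]
      · rfl
    convert (hOc ⟨r, Or.inr hr⟩).sub (hOc ⟨s, Or.inr hs⟩) using 1
    ext ω
    simp only [O, Pi.sub_apply]
    rw [h r hr, h s hs]
    ring

/-- Finite measures on a product of countable discrete spaces agree if they agree on cylinders over
a cofinal family of windows. -/
lemma measure_ext_of_windows {ι J α : Type*} [Countable α] [MeasurableSpace α]
    [MeasurableSingletonClass α] {n : J → ℕ} (w : ∀ j, Fin (n j) → ι)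
    (hw : ∀ I : Finset ι, ∃ j, ∀ i ∈ I, ∃ l, w j l = i) (μ ν : Measure (ι → α))
    [IsFiniteMeasure ν]
    (h : ∀ j (k : Fin (n j) → α), μ {x | ∀ l, x (w j l) = k l} = ν {x | ∀ l, x (w j l) = k l}) :
    μ = ν := by
  -- Every finite set of coordinates sits in a window, so all finite marginals agree; a finite
  -- projective limit is unique.
  have h1 : IsProjectiveLimit μ (fun I : Finset ι => ν.map I.restrict) := by
    intro I
    obtain ⟨j, hj⟩ := hw I
    choose g hg using fun i : I => hj i.1 i.2
    have hm : Measurable (fun (x : ι → α) (l : Fin (n j)) => x (w j l)) :=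
      measurable_pi_lambda _ fun l => measurable_pi_apply _
    have hm' : Measurable (fun (y : Fin (n j) → α) (i : I) => y (g i)) :=
      measurable_pi_lambda _ fun l => measurable_pi_apply _
    have hr : (I.restrict : (ι → α) → (I → α)) =
        (fun (y : Fin (n j) → α) (i : I) => y (g i)) ∘ fun x l => x (w j l) := by
      ext x i
      simp [hg]
    have e : μ.map (fun (x : ι → α) (l : Fin (n j)) => x (w j l)) =
        ν.map (fun (x : ι → α) (l : Fin (n j)) => x (w j l)) := by
      refine Measure.ext_of_singleton fun k => ?_
      rw [Measure.map_apply hm (measurableSet_singleton _),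
        Measure.map_apply hm (measurableSet_singleton _)]
      have : (fun (x : ι → α) (l : Fin (n j)) => x (w j l)) ⁻¹' {k} =
          {x | ∀ l, x (w j l) = k l} := by
        ext x
        simp [funext_iff]
      rw [this]
      exact h j k
    simp only [hr]
    rw [← Measure.map_map hm' hm, ← Measure.map_map hm' hm, e]
  exact h1.unique fun I => rfl

/-- The integer interval `m, m + 1, …, m + n`. -/
def window (j : ℤ × ℕ) (l : Fin (j.2 + 1)) : ℤ := j.1 + ((l : ℕ) : ℤ)

lemma exists_window (I : Finset ℤ) : ∃ j, ∀ i ∈ I, ∃ l, window j l = i := by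
  obtain ⟨a, ha⟩ := I.bddBelow
  obtain ⟨b, hb⟩ := I.bddAbove
  refine ⟨(a, (b - a).toNat), fun i hi => ?_⟩
  have h1 := ha hi
  have h2 := hb hi
  refine ⟨⟨(i - a).toNat, by simp only; omega⟩, ?_⟩
  simp only [window]
  omega

lemma measurable_directions (hK : IsReflectingDirectionSequence P K) :
    Measurable (fun ω n => K n ω) :=
  measurable_pi_lambda _ fun _ => hK.measurable _

lemma measurable_directions_comp (hK : IsReflectingDirectionSequence P K) (f : ℤ → ℤ) :
    Measurable (fun ω n => K (f n) ω) :=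
  measurable_pi_lambda _ fun _ => hK.measurable _

/-- Stationarity: the window probabilities do not depend on the starting index, and windows
determine the law. -/
lemma map_directions_shift [IsProbabilityMeasure P] (hK : IsReflectingDirectionSequence P K)
    (m : ℤ) : P.map (fun ω n => K (m + n) ω) = P.map (fun ω n => K n ω) := by
  have : IsProbabilityMeasure (P.map (fun ω n => K n ω)) :=
    Measure.isProbabilityMeasure_map (measurable_directions hK).aemeasurable
  refine measure_ext_of_windows window exists_window _ _ fun j k => ?_
  have hs : MeasurableSet {x : ℤ → Fin 4 | ∀ l, x (window j l) = k l} := by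
    have : {x : ℤ → Fin 4 | ∀ l, x (window j l) = k l} = ⋂ l, {x | x (window j l) = k l} := by
      ext; simp
    rw [this]
    exact MeasurableSet.iInter fun l => measurable_pi_apply _ (measurableSet_singleton _)
  rw [Measure.map_apply (measurable_directions_comp hK _) hs,
    Measure.map_apply (measurable_directions hK) hs]
  have h1 := hK.law (m + j.1) j.2 k
  have h2 := hK.law j.1 j.2 k
  rw [← h2] at h1
  have := (measureReal_eq_measureReal_iff).1 h1
  convert this using 2
  · simp [window, add_assoc]
  · simp [window]

/-- The directions, numbered from the current one at time `a`. -/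
def shiftDir (N : ℝ → Ω → ℤ) (K : ℤ → Ω → Fin 4) (a : ℝ) : ℤ → Ω → Fin 4 :=
  fun n ω => K (N a ω + n) ω

/-- The `σ`-algebra generated by a sequence of directions. -/
@[reducible] def dirAlgebra (K : ℤ → Ω → Fin 4) : MeasurableSpace Ω :=
  MeasurableSpace.comap (fun ω n => K n ω) MeasurableSpace.pi

lemma measurable_shiftDir (hN : IsPoissonCounting P lam N) (hK : IsReflectingDirectionSequence P K)
    {a : ℝ} (ha : 0 < a) (n : ℤ) : Measurable (shiftDir N K a n) := by
  have h : Measurable (fun q : ℤ × Ω => K (q.1 + n) q.2) :=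
    measurable_from_prod_countable_right fun m => hK.measurable (m + n)
  exact h.comp ((hN.measurable a ha).prodMk measurable_id)

/-- The shift depends on `N`, but on `N a = m` it is the deterministic shift by `m`, which preserves
the law of `K` and is independent of `N`. Summing over the countably many `m` gives the
factorization. -/
lemma measure_shiftDir_inter [IsProbabilityMeasure P] (hN : IsPoissonCounting P lam N)
    (hK : IsReflectingDirectionSequence P K)
    (hind : IndepFun (fun ω (t : Ioi (0 : ℝ)) => N t ω) (fun ω (n : ℤ) => K n ω) P)
    {a : ℝ} (ha : 0 < a) {A : Set (ℤ → Fin 4)} (hA : MeasurableSet A) {B : Set Ω}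
    (hB : MeasurableSet[countingAlgebra N] B) :
    P ((fun ω n => shiftDir N K a n ω) ⁻¹' A ∩ B) =
      P ((fun ω n => K n ω) ⁻¹' A) * P B := by
  have hB' : MeasurableSet B := countingAlgebra_le hN _ hB
  have hNa : ∀ m : ℤ, MeasurableSet[countingAlgebra N] (N a ⁻¹' {m}) := fun m =>
    measurable_countingAlgebra N ha (measurableSet_singleton m)
  have hdis : Pairwise (Function.onFun Disjoint fun m : ℤ => N a ⁻¹' {m}) := fun m m' hm =>
    Disjoint.preimage _ (by simpa using hm)
  have hU : (⋃ m : ℤ, N a ⁻¹' {m}) = univ := by ext; simp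
  have hsplit : ∀ S : Set Ω, MeasurableSet S → P S = ∑' m : ℤ, P (N a ⁻¹' {m} ∩ S) := by
    intro S hS
    rw [← measure_iUnion (fun m m' h => (hdis h).mono inter_subset_left inter_subset_left)
      (fun m => (countingAlgebra_le hN _ (hNa m)).inter hS), ← iUnion_inter, hU, univ_inter]
  have hSm : Measurable (fun ω n => shiftDir N K a n ω) :=
    measurable_pi_lambda _ fun n => measurable_shiftDir hN hK ha n
  rw [hsplit _ ((hSm hA).inter hB'), hsplit B hB', ← ENNReal.tsum_mul_left]
  refine tsum_congr fun m => ?_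
  have hset : N a ⁻¹' {m} ∩ ((fun ω n => shiftDir N K a n ω) ⁻¹' A ∩ B) =
      (N a ⁻¹' {m} ∩ B) ∩ (fun ω n => K n ω) ⁻¹' ((fun x n => x (m + n)) ⁻¹' A) := by
    ext ω
    simp only [mem_inter_iff, mem_preimage, mem_singleton_iff, shiftDir]
    constructor
    · rintro ⟨rfl, h1, h2⟩; exact ⟨⟨rfl, h2⟩, h1⟩
    · rintro ⟨⟨rfl, h2⟩, h1⟩; exact ⟨rfl, h1, h2⟩
  have hshift : Measurable (fun (x : ℤ → Fin 4) n => x (m + n)) :=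
    measurable_pi_lambda _ fun n => measurable_pi_apply _
  rw [hset, (Indep_iff _ _ _).1 hind _ _ ((hNa m).inter hB) ⟨_, hshift hA, rfl⟩, mul_comm]
  congr 1
  have := congrArg (fun μ => μ A) (map_directions_shift hK m)
  rw [Measure.map_apply (measurable_directions_comp hK _) hA,
    Measure.map_apply (measurable_directions hK) hA] at this
  exact this

lemma isReflectingDirectionSequence_shiftDir [IsProbabilityMeasure P]
    (hN : IsPoissonCounting P lam N) (hK : IsReflectingDirectionSequence P K)
    (hind : IndepFun (fun ω (t : Ioi (0 : ℝ)) => N t ω) (fun ω (n : ℤ) => K n ω) P)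
    {a : ℝ} (ha : 0 < a) : IsReflectingDirectionSequence P (shiftDir N K a) := by
  refine ⟨measurable_shiftDir hN hK ha, fun m n k => ?_⟩
  rw [← hK.law m n k]
  refine (measureReal_eq_measureReal_iff).2 ?_
  have hA : MeasurableSet {x : ℤ → Fin 4 | ∀ i : Fin (n + 1), x (m + ((i : ℕ) : ℤ)) = k i} := by
    simp only [ofPred_forall]
    exact MeasurableSet.iInter fun l => measurable_pi_apply _ (measurableSet_singleton _)
  have := measure_shiftDir_inter hN hK hind ha hA (MeasurableSet.univ (m := countingAlgebra N))
  simpa using this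

lemma indep_shiftDir [IsProbabilityMeasure P]
    (hN : IsPoissonCounting P lam N) (hK : IsReflectingDirectionSequence P K)
    (hind : IndepFun (fun ω (t : Ioi (0 : ℝ)) => N t ω) (fun ω (n : ℤ) => K n ω) P)
    {a : ℝ} (ha : 0 < a) : Indep (dirAlgebra (shiftDir N K a)) (countingAlgebra N) P := by
  rw [Indep_iff]
  rintro _ B ⟨A, hA, rfl⟩ hB
  rw [measure_shiftDir_inter hN hK hind ha hA hB]
  congr 1
  have := measure_shiftDir_inter hN hK hind ha hA (MeasurableSet.univ (m := countingAlgebra N))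
  simpa using this.symm

lemma dirAlgebra_le (hK : IsReflectingDirectionSequence P K) : dirAlgebra K ≤ mΩ :=
  measurable_iff_comap_le.1 (measurable_directions hK)

lemma measurable_dirAlgebra (K : ℤ → Ω → Fin 4) (n : ℤ) : Measurable[dirAlgebra K] (K n) :=
  (measurable_pi_apply (X := fun _ : ℤ => Fin 4) n).comp (comap_measurable (fun ω n => K n ω))

/-- The directions together with the increments off `[a, b]` are independent of the increments over
`[a, b]`. -/
lemma indep_dirAlgebra_sup_incrementAlgebra [IsProbabilityMeasure P]
    (hN : IsPoissonCounting P lam N) (hK : IsReflectingDirectionSequence P K)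
    (hind : Indep (dirAlgebra K) (countingAlgebra N) P) {a b : ℝ} (ha : 0 < a) (hab : a ≤ b) :
    Indep (dirAlgebra K ⊔ (incrementAlgebra N (Ioc 0 a) ⊔ incrementAlgebra N (Ici b)))
      (incrementAlgebra N (Icc a b)) P := by
  have h1 : incrementAlgebra N (Ioc 0 a) ⊔ incrementAlgebra N (Ici b) ≤ countingAlgebra N :=
    sup_le (incrementAlgebra_le_countingAlgebra N fun x hx => hx.1)
      (incrementAlgebra_le_countingAlgebra N fun x hx => (ha.trans_le hab).trans_le hx)
  have h2 : incrementAlgebra N (Icc a b) ≤ countingAlgebra N :=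
    incrementAlgebra_le_countingAlgebra N fun x hx => ha.trans_le hx.1
  exact indep_sup_left_of_indep_sup_right (dirAlgebra_le hK) (h1.trans (countingAlgebra_le hN))
    (h2.trans (countingAlgebra_le hN)) (indep_of_indep_of_le_right hind (sup_le h1 h2))
    (indep_incrementAlgebra hN ha hab)

/-- The `σ`-algebra generated by the directions up to the current one. -/
@[reducible] def pastDirAlgebra (K : ℤ → Ω → Fin 4) : MeasurableSpace Ω :=
  MeasurableSpace.comap (fun ω (n : ℕ) => K (-n) ω) MeasurableSpace.pi

lemma measurable_pastDirAlgebra (K : ℤ → Ω → Fin 4) {n : ℤ} (hn : n ≤ 0) :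
    Measurable[pastDirAlgebra K] (K n) := by
  have := (measurable_pi_apply (X := fun _ : ℕ => Fin 4) (-n).toNat).comp
    (comap_measurable (fun ω (n : ℕ) => K (-n) ω))
  convert this using 1
  ext ω
  have : n = -((-n).toNat : ℤ) := by omega
  exact congrArg (fun m => (K m ω : ℕ)) this

/-- Probability of a transition of the directions. -/
noncomputable def transition (i k : Fin 4) : ℝ := if k = i then 0 else 1 / 3

/-- The Markov property of the directions at index `0`. -/
lemma measure_past_transition [IsProbabilityMeasure P] (hK : IsReflectingDirectionSequence P K)
    (i k : Fin 4) {u : Set Ω} (hu : MeasurableSet[pastDirAlgebra K] u) :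
    P (u ∩ {ω | K 0 ω = i ∧ K 1 ω = k}) =
      ENNReal.ofReal (transition i k) * P (u ∩ {ω | K 0 ω = i}) := by
  have hm : Measurable (fun ω (n : ℕ) => K (-n) ω) := measurable_pi_lambda _ fun n => hK.measurable _
  obtain ⟨A, hA, rfl⟩ := hu
  -- Both sides are finite measures on past sequences, so comparing cylinders over the indices `0,
  -- -1, …, -j` is enough. If the cylinder prescribes a value other than `i` at index `0`, both
  -- sides vanish.
  have key : (P.restrict {ω | K 0 ω = i ∧ K 1 ω = k}).map (fun ω (n : ℕ) => K (-n) ω) =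
      (ENNReal.ofReal (transition i k) • P.restrict {ω | K 0 ω = i}).map
        (fun ω (n : ℕ) => K (-n) ω) := by
    have : IsFiniteMeasure (ENNReal.ofReal (transition i k) • P.restrict {ω | K 0 ω = i}) :=
      Measure.smul_finite _ ENNReal.ofReal_ne_top
    refine measure_ext_of_windows (n := fun j : ℕ => j + 1)
      (fun j l => (l : ℕ)) (fun I => ?_) _ _ fun j x => ?_
    · obtain ⟨b, hb⟩ := I.bddAbove
      exact ⟨b, fun i hi => ⟨⟨i, Nat.lt_succ_of_le (hb hi)⟩, rfl⟩⟩
    have hs : MeasurableSet {y : ℕ → Fin 4 | ∀ l : Fin (j + 1), y (l : ℕ) = x l} := by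
      simp only [ofPred_forall]
      exact MeasurableSet.iInter fun l => measurable_pi_apply _ (measurableSet_singleton _)
    rw [Measure.map_apply hm hs, Measure.map_apply hm hs, Measure.smul_apply,
      Measure.restrict_apply (hm hs), Measure.restrict_apply (hm hs), smul_eq_mul]
    by_cases hx : x 0 = i
    swap
    · have e1 : ∀ T : Set Ω, T ⊆ {ω | K 0 ω = i} → 
          (fun ω (n : ℕ) => K (-n) ω) ⁻¹' {y | ∀ l : Fin (j + 1), y (l : ℕ) = x l} ∩ T = ∅ := by
        intro T hT
        refine eq_empty_of_forall_notMem fun ω hω => hx ?_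
        have h1 := hω.1 0
        have h2 : K 0 ω = i := hT hω.2
        simpa [h2] using h1.symm
      rw [e1 _ (fun ω h => h.1), e1 _ subset_rfl]
      simp
    -- The past is recorded backwards while `law` runs forwards: `y` is the chronological list from
    -- index `-j` to `0`, and appending `k` reaches index `1` at the cost of one more transition
    -- factor.
    let y : Fin (j + 1) → Fin 4 := fun l => x l.rev
    have h1 := hK.law (-j) j y
    have h2 := hK.law (-j) (j + 1) (Fin.snoc (α := fun _ => Fin 4) y k)
    rw [Fin.prod_univ_castSucc] at h2
    have hlast : (Fin.snoc (α := fun _ => Fin 4) y k) (Fin.last j).castSucc = i := by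
      rw [Fin.snoc_castSucc]
      simp [y, hx]
    rw [hlast, Fin.succ_last, Fin.snoc_last] at h2
    have hprod : ∀ l : Fin j, (if Fin.snoc (α := fun _ => Fin 4) y k l.castSucc.succ =
        Fin.snoc (α := fun _ => Fin 4) y k l.castSucc.castSucc then 0 else 1 / 3 : ℝ) =
        if y l.succ = y l.castSucc then 0 else 1 / 3 := by
      intro l
      rw [Fin.snoc_castSucc, Fin.succ_castSucc, Fin.snoc_castSucc]
    rw [Finset.prod_congr rfl fun l _ => hprod l, ← mul_assoc, ← h1] at h2
    have hset1 : (fun ω (n : ℕ) => K (-n) ω) ⁻¹' {y | ∀ l : Fin (j + 1), y (l : ℕ) = x l} ∩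
        {ω | K 0 ω = i} = {ω | ∀ l : Fin (j + 1), K (-j + ((l : ℕ) : ℤ)) ω = y l} := by
      ext ω
      simp only [mem_inter_iff, mem_preimage, mem_ofPred_eq, y]
      constructor
      · rintro ⟨h, -⟩ l
        rw [← h l.rev]
        congr 1
        have := l.2
        simp only [Fin.val_rev]
        omega
      · intro h
        have h' : ∀ l : Fin (j + 1), K (-((l : ℕ) : ℤ)) ω = x l := by
          intro l
          have h3 := h l.rev
          rw [Fin.rev_rev] at h3
          rw [← h3]
          congr 1
          have := l.2
          simp only [Fin.val_rev]
          omega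
        refine ⟨h', ?_⟩
        have := h' 0
        simpa [hx] using this
    have hset2 : (fun ω (n : ℕ) => K (-n) ω) ⁻¹' {y | ∀ l : Fin (j + 1), y (l : ℕ) = x l} ∩
        {ω | K 0 ω = i ∧ K 1 ω = k} = {ω | ∀ l : Fin (j + 1 + 1), K (-j + ((l : ℕ) : ℤ)) ω =
          Fin.snoc (α := fun _ => Fin 4) y k l} := by
      have : {ω | K 0 ω = i ∧ K 1 ω = k} = {ω | K 0 ω = i} ∩ {ω | K 1 ω = k} := rfl
      rw [this, ← inter_assoc, hset1]
      ext ω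
      simp only [mem_inter_iff, mem_ofPred_eq, Fin.forall_fin_succ' (n := j + 1), Fin.snoc_castSucc,
        Fin.snoc_last, Fin.val_castSucc, Fin.val_last]
      simp
    rw [hset1, hset2, ← ofReal_measureReal, ← ofReal_measureReal, h2, mul_comm]
    exact ENNReal.ofReal_mul' measureReal_nonneg
  have := congrArg (fun μ => μ A) key
  rw [Measure.map_apply hm hA, Measure.map_apply hm hA, Measure.smul_apply,
      Measure.restrict_apply (hm hA), Measure.restrict_apply (hm hA), smul_eq_mul] at this
  exact this

/-- The Markov property of the directions at index `0`, jointly with an independent counting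
process. -/
lemma measure_past_sup_transition [IsProbabilityMeasure P] (hN : IsPoissonCounting P lam N)
    (hK : IsReflectingDirectionSequence P K)
    (hind : Indep (dirAlgebra K) (countingAlgebra N) P)
    (i k : Fin 4) {u : Set Ω} (hu : MeasurableSet[pastDirAlgebra K ⊔ countingAlgebra N] u) :
    P (u ∩ {ω | K 0 ω = i ∧ K 1 ω = k}) =
      ENNReal.ofReal (transition i k) * P (u ∩ {ω | K 0 ω = i}) := by
  have hp : pastDirAlgebra K ≤ mΩ :=
    measurable_iff_comap_le.1 (measurable_pi_lambda _ fun n => hK.measurable _)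
  have hpd : pastDirAlgebra K ≤ dirAlgebra K :=
    measurable_iff_comap_le.1 (@measurable_pi_lambda _ _ _ (_) _ _
      fun n => measurable_dirAlgebra K _)
  have hm : pastDirAlgebra K ⊔ countingAlgebra N ≤ mΩ := sup_le hp (countingAlgebra_le hN)
  have h0 : MeasurableSet[dirAlgebra K] {ω | K 0 ω = i} :=
    measurable_dirAlgebra K 0 (measurableSet_singleton i)
  have h1 : MeasurableSet[dirAlgebra K] {ω | K 1 ω = k} :=
    measurable_dirAlgebra K 1 (measurableSet_singleton k)
  have hfin : IsFiniteMeasure (ENNReal.ofReal (transition i k) • P.restrict {ω | K 0 ω = i}) :=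
    Measure.smul_finite _ ENNReal.ofReal_ne_top
  -- On `v ∩ w` the counting event `w` splits off by independence, leaving the Markov property of
  -- the directions alone. Such intersections form a generating π-system, and trimming turns both
  -- sides into measures on the joint σ-algebra.
  have key : ∀ u ∈ interSets (pastDirAlgebra K) (countingAlgebra N),
      (P.restrict {ω | K 0 ω = i ∧ K 1 ω = k}).trim hm u =
        (ENNReal.ofReal (transition i k) • P.restrict {ω | K 0 ω = i}).trim hm u := by
    rintro _ ⟨v, w, hv, hw, rfl⟩
    have hvw : MeasurableSet[pastDirAlgebra K ⊔ countingAlgebra N] (v ∩ w) :=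
      MeasurableSet.inter (le_sup_left (a := pastDirAlgebra K) (b := countingAlgebra N) _ hv)
        (le_sup_right (a := pastDirAlgebra K) (b := countingAlgebra N) _ hw)
    rw [trim_measurableSet_eq hm hvw, trim_measurableSet_eq hm hvw, Measure.smul_apply,
      Measure.restrict_apply (hm _ hvw), Measure.restrict_apply (hm _ hvw), smul_eq_mul,
      inter_right_comm, inter_right_comm v w]
    have hand : {ω | K 0 ω = i ∧ K 1 ω = k} = {ω | K 0 ω = i} ∩ {ω | K 1 ω = k} := rfl
    rw [Indep_iff] at hind
    rw [hand, hind _ w ((hpd _ hv).inter (h0.inter h1)) hw, hind _ w ((hpd _ hv).inter h0) hw,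
      ← hand, measure_past_transition hK i k hv, mul_assoc]
  have := congrArg (fun μ => @DFunLike.coe _ _ _ _ μ u) (ext_of_generate_finite
    (m0 := pastDirAlgebra K ⊔ countingAlgebra N)
    _ (generateFrom_interSets _ _) (isPiSystem_interSets _ _) key
    (key univ ⟨univ, univ, MeasurableSet.univ, MeasurableSet.univ, by simp⟩))
  rw [trim_measurableSet_eq hm hu, trim_measurableSet_eq hm hu, Measure.smul_apply,
      Measure.restrict_apply (hm _ hu), Measure.restrict_apply (hm _ hu), smul_eq_mul] at this
  exact this

end Independence
-- Measurability and elementary bounds for displacements.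
section Paths

open Filter Topology

/-- Integrals in time of right-continuous processes are measurable. -/
lemma measurable_intervalIntegral_of_rightContinuous {Ω : Type*} (m : MeasurableSpace Ω)
    {g : ℝ → Ω → ℝ} {α β : ℝ} (hαβ : α ≤ β) (hm : ∀ s ∈ Ioc α β, Measurable[m] (g s))
    (hr : ∀ ω, ∀ s ∈ Ioc α β, ContinuousWithinAt (fun u => g u ω) (Ici s) s) :
    Measurable[m] (fun ω => ∫ s in α..β, g s ω) := by
  -- Sampling at the grid point just above `s`, truncated at `β`, approximates the process from the
  -- right. The case distinction keeps the sampling times in `(α, β]`, the only times at which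
  -- measurability is assumed.
  let G : ℕ → ℤ × Ω → ℝ := fun n q =>
    if α < (q.1 : ℝ) / (n + 1) ∧ α < β then g (min ((q.1 : ℝ) / (n + 1)) β) q.2 else 0
  have hG : ∀ n, Measurable (G n) := by
    intro n
    refine measurable_from_prod_countable_right fun k => ?_
    by_cases h : α < (k : ℝ) / (n + 1) ∧ α < β
    · simp only [G, h]
      simpa using hm _ ⟨lt_min h.1 h.2, min_le_right _ _⟩
    · simp only [G, h, if_false]
      exact measurable_const
  let H : ℕ → ℝ × Ω → ℝ := fun n q => (Ioc α β).indicator 1 q.1 * G n (⌈(n + 1) * q.1⌉, q.2)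
  have hH : ∀ n, Measurable (H n) := by
    intro n
    refine Measurable.mul ?_ ?_
    · exact (measurable_one.indicator measurableSet_Ioc).comp measurable_fst
    · exact (hG n).comp ((Int.measurable_ceil.comp (measurable_fst.const_mul _)).prodMk
        measurable_snd)
  have hlim : Measurable (fun q : ℝ × Ω => (Ioc α β).indicator (fun s => g s q.2) q.1) := by
    refine measurable_of_tendsto_metrizable hH (tendsto_pi_nhds.2 ?_)
    rintro ⟨s, ω⟩
    by_cases hs : s ∈ Ioc α β
    swap
    · simp [H, hs]
    have hpos : ∀ n : ℕ, (0 : ℝ) < n + 1 := fun n => by positivity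
    have hge : ∀ n : ℕ, s ≤ (⌈((n : ℝ) + 1) * s⌉ : ℝ) / (n + 1) := fun n => by
      rw [le_div_iff₀ (hpos n), mul_comm]; exact Int.le_ceil _
    have hle : ∀ n : ℕ, (⌈((n : ℝ) + 1) * s⌉ : ℝ) / (n + 1) ≤ s + 1 / ((n : ℝ) + 1) := fun n => by
      rw [div_le_iff₀ (hpos n), add_mul s, one_div_mul_cancel (hpos n).ne', mul_comm s]
      exact (Int.ceil_lt_add_one _).le
    have hconv : Tendsto (fun n : ℕ => min ((⌈((n : ℝ) + 1) * s⌉ : ℝ) / (n + 1)) β) atTop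
        (𝓝[≥] s) := by
      refine tendsto_nhdsWithin_iff.2 ⟨?_, Eventually.of_forall fun n => le_min (hge n) hs.2⟩
      have h1 : Tendsto (fun n : ℕ => s + 1 / ((n : ℝ) + 1)) atTop (𝓝 (s + 0)) :=
        tendsto_const_nhds.add tendsto_one_div_add_atTop_nhds_zero_nat
      rw [add_zero] at h1
      exact tendsto_of_tendsto_of_tendsto_of_le_of_le tendsto_const_nhds h1
        (fun n => le_min (hge n) hs.2) (fun n => (min_le_left _ _).trans (hle n))
    have h2 := (hr ω s hs).tendsto.comp hconv
    refine Tendsto.congr (fun n => ?_) (by simpa [hs] using h2)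
    have h3 : α < (⌈((n : ℝ) + 1) * s⌉ : ℝ) / (n + 1) := hs.1.trans_le (hge n)
    simp [H, G, hs, h3, hs.1.trans_le hs.2]
  have h4 : (fun ω => ∫ s in α..β, g s ω) =
      fun ω => ∫ s, (Ioc α β).indicator (fun s => g s ω) s := by
    ext ω
    rw [intervalIntegral.integral_of_le hαβ, integral_indicator measurableSet_Ioc]
  rw [h4]
  exact (StronglyMeasurable.integral_prod_left' (f := fun q : ℝ × Ω =>
    (Ioc α β).indicator (fun s => g s q.2) q.1) hlim.stronglyMeasurable).measurable

variable {Ω : Type*} {mΩ : MeasurableSpace Ω} {P : Measure Ω}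
variable {lam : ℝ → ℝ} {N : ℝ → Ω → ℤ} {K : ℤ → Ω → Fin 4}

lemma eventually_eq_of_rightContinuous (hN : IsPoissonCounting P lam N) (ω : Ω) {t : ℝ}
    (ht : 0 < t) : ∀ᶠ s in 𝓝[≥] t, N s ω = N t ω := by
  have := hN.right_continuous ω t ht
  exact this (by simp : ({N t ω} : Set ℤ) ∈ 𝓝 (N t ω))

lemma continuousWithinAt_comp_counting (hN : IsPoissonCounting P lam N) (ω : Ω) {t : ℝ}
    (ht : 0 < t) (F : ℤ → ℝ) : ContinuousWithinAt (fun s => F (N s ω)) (Ici t) t := by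
  refine (continuousWithinAt_const (b := F (N t ω))).congr_of_eventuallyEq ?_ rfl
  filter_upwards [eventually_eq_of_rightContinuous hN ω ht] with s hs
  rw [hs]

lemma intervalIntegrable_comp_counting (hN : IsPoissonCounting P lam N) (ω : Ω) {a b : ℝ}
    (ha : 0 ≤ a) (hab : a ≤ b) {F : ℤ → ℝ} {C : ℝ} (hF : ∀ n, |F n| ≤ C) :
    IntervalIntegrable (fun s => F (N s ω)) volume a b := by
  rw [intervalIntegrable_iff_integrableOn_Ioc_of_le hab]
  have h1 : AEMeasurable (fun s => N s ω) (volume.restrict (Ioc a b)) :=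
    aemeasurable_restrict_of_monotoneOn measurableSet_Ioc
      ((hN.monotone ω).mono fun s hs => ha.trans_lt hs.1)
  have h2 : AEMeasurable (fun s => F (N s ω)) (volume.restrict (Ioc a b)) :=
    (measurable_of_countable F).comp_aemeasurable h1
  exact Integrable.of_bound h2.aestronglyMeasurable C (Eventually.of_forall fun s => hF _)

/-- Displacement over `[a, b]` for the velocity field `d`. -/
noncomputable def displacement (N : ℝ → Ω → ℤ) (K : ℤ → Ω → Fin 4) (d : Fin 4 → ℝ) (a b : ℝ)
    (ω : Ω) : ℝ := ∫ s in a..b, d (K (N s ω) ω)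

lemma abs_le_sum_abs (d : Fin 4 → ℝ) (k : Fin 4) : |d k| ≤ ∑ j, |d j| :=
  Finset.single_le_sum (f := fun j => |d j|) (fun _ _ => abs_nonneg _) (Finset.mem_univ k)

lemma intervalIntegrable_velocity (hN : IsPoissonCounting P lam N) (d : Fin 4 → ℝ) (ω : Ω)
    {a b : ℝ} (ha : 0 ≤ a) (hab : a ≤ b) :
    IntervalIntegrable (fun s => d (K (N s ω) ω)) volume a b :=
  intervalIntegrable_comp_counting hN ω ha hab (F := fun n => d (K n ω))
    fun _ => abs_le_sum_abs d _

lemma displacement_add (hN : IsPoissonCounting P lam N) (d : Fin 4 → ℝ) (ω : Ω)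
    {a b e : ℝ} (ha : 0 ≤ a) (hab : a ≤ b) (hbe : b ≤ e) :
    displacement N K d a b ω + displacement N K d b e ω = displacement N K d a e ω :=
  intervalIntegral.integral_add_adjacent_intervals (intervalIntegrable_velocity hN d ω ha hab)
    (intervalIntegrable_velocity hN d ω (ha.trans hab) hbe)

lemma abs_displacement_le {d : Fin 4 → ℝ} (hd : ∀ k, |d k| ≤ 1) (ω : Ω) {a b : ℝ} (hab : a ≤ b) :
    |displacement N K d a b ω| ≤ b - a := by
  have := intervalIntegral.norm_integral_le_of_norm_le_const (a := a) (b := b) (C := 1)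
    (f := fun s => d (K (N s ω) ω)) fun s _ => hd _
  rwa [one_mul, abs_of_nonneg (sub_nonneg.2 hab)] at this

/-- If no event occurs in `(a, b]`, the motion is uniform on `[a, b]`. -/
lemma displacement_of_eq (hN : IsPoissonCounting P lam N) (d : Fin 4 → ℝ) {ω : Ω}
    {a b : ℝ} (ha : 0 < a) (hab : a ≤ b) (h : N b ω = N a ω) :
    displacement N K d a b ω = (b - a) * d (K (N a ω) ω) := by
  have : ∀ s ∈ uIcc a b, d (K (N s ω) ω) = d (K (N a ω) ω) := by
    intro s hs
    rw [uIcc_of_le hab] at hs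
    have h1 := hN.monotone ω (mem_Ioi.2 ha) (mem_Ioi.2 (ha.trans_le hs.1)) hs.1
    have h2 := hN.monotone ω (mem_Ioi.2 (ha.trans_le hs.1)) (mem_Ioi.2 (ha.trans_le hab)) hs.2
    simp only at h1 h2
    rw [le_antisymm (h2.trans h.le) h1]
  rw [displacement, intervalIntegral.integral_congr this]
  simp

lemma measurable_comp_index {m : MeasurableSpace Ω} {α : Type*} [MeasurableSpace α]
    {L : ℤ → Ω → α} {M : Ω → ℤ}
    (hL : ∀ n, Measurable[m] (L n)) (hM : Measurable[m] M) :
    Measurable[m] (fun ω => L (M ω) ω) := by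
  have h : Measurable (fun q : ℤ × Ω => L q.1 q.2) := measurable_from_prod_countable_right hL
  exact h.comp (hM.prodMk measurable_id)

lemma dirX_zero : dirX 0 = 1 := by simp [dirX]
lemma dirX_one : dirX 1 = 0 := by simp [dirX]
lemma dirX_two : dirX 2 = -1 := by
  simp [dirX]
lemma dirX_three : dirX 3 = 0 := by
  have : ((3 : Fin 4) : ℕ) = 3 := rfl
  rw [dirX, this, show ((3 : ℕ) : ℝ) * Real.pi / 2 = Real.pi / 2 + Real.pi by push_cast; ring,
    Real.cos_add_pi, Real.cos_pi_div_two, neg_zero]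
lemma dirY_zero : dirY 0 = 0 := by simp [dirY]
lemma dirY_one : dirY 1 = 1 := by simp [dirY]
lemma dirY_two : dirY 2 = 0 := by
  simp [dirY]
lemma dirY_three : dirY 3 = -1 := by
  have : ((3 : Fin 4) : ℕ) = 3 := rfl
  rw [dirY, this, show ((3 : ℕ) : ℝ) * Real.pi / 2 = Real.pi / 2 + Real.pi by push_cast; ring,
    Real.sin_add_pi, Real.sin_pi_div_two]

lemma abs_dirX_le (k : Fin 4) : |dirX k| ≤ 1 := Real.abs_cos_le_one _
lemma abs_dirY_le (k : Fin 4) : |dirY k| ≤ 1 := Real.abs_sin_le_one _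

lemma abs_dirX_add_abs_dirY (k : Fin 4) : |dirX k| + |dirY k| = 1 := by
  fin_cases k <;> simp [dirX_zero, dirX_one, dirX_two, dirX_three, dirY_zero, dirY_one, dirY_two,
    dirY_three]

variable {c : ℝ} {X Y : ℝ → Ω → ℝ}

lemma IsReflectingMotion.X_eq (h : IsReflectingMotion P c lam N K X Y) {t : ℝ} (ht : 0 ≤ t)
    (ω : Ω) : X t ω = c * displacement N K dirX 0 t ω := by
  rw [h.position_X t ht ω, displacement, intervalIntegral.integral_const_mul]

lemma IsReflectingMotion.Y_eq (h : IsReflectingMotion P c lam N K X Y) {t : ℝ} (ht : 0 ≤ t)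
    (ω : Ω) : Y t ω = c * displacement N K dirY 0 t ω := by
  rw [h.position_Y t ht ω, displacement, intervalIntegral.integral_const_mul]

lemma IsReflectingMotion.abs_add_abs_le (h : IsReflectingMotion P c lam N K X Y) (hc : 0 < c)
    {t : ℝ} (ht : 0 ≤ t) (ω : Ω) : |X t ω| + |Y t ω| ≤ c * t := by
  rw [h.X_eq ht, h.Y_eq ht, abs_mul, abs_mul, abs_of_pos hc, ← mul_add]
  refine mul_le_mul_of_nonneg_left ?_ hc.le
  have hi : ∀ d : Fin 4 → ℝ, IntervalIntegrable (fun s => d (K (N s ω) ω)) volume 0 t :=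
    fun d => intervalIntegrable_velocity h.poisson d ω le_rfl ht
  calc |displacement N K dirX 0 t ω| + |displacement N K dirY 0 t ω|
      ≤ (∫ s in (0 : ℝ)..t, |dirX (K (N s ω) ω)|) + ∫ s in (0 : ℝ)..t, |dirY (K (N s ω) ω)| :=
        add_le_add (intervalIntegral.abs_integral_le_integral_abs ht)
          (intervalIntegral.abs_integral_le_integral_abs ht)
    _ = ∫ s in (0 : ℝ)..t, (|dirX (K (N s ω) ω)| + |dirY (K (N s ω) ω)|) :=
        (intervalIntegral.integral_add (hi fun k => |dirX k|) (hi fun k => |dirY k|)).symm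
    _ = t := by simp [abs_dirX_add_abs_dirY]

lemma IsReflectingMotion.dir_eq (a s : ℝ) (ω : Ω) :
    K (N s ω) ω = shiftDir N K a (N s ω - N a ω) ω := by
  simp [shiftDir]

/-- The displacement up to time `a` is a function of the past directions and of the past increments
of the counting process. -/
lemma measurable_displacement_past (hN : IsPoissonCounting P lam N) (d : Fin 4 → ℝ) {a : ℝ}
    (ha : 0 < a) :
    Measurable[pastDirAlgebra (shiftDir N K a) ⊔ incrementAlgebra N (Ioc 0 a)]
      (displacement N K d 0 a) := by
  refine measurable_intervalIntegral_of_rightContinuous _ ha.le (fun s hs => ?_)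
    fun ω s hs => continuousWithinAt_comp_counting hN ω hs.1 (fun n => d (K n ω))
  -- For `s ≤ a` the index `N s - N a` is nonpositive, so truncating it at `0` changes nothing, yet
  -- makes the integrand a function of past directions for every value of the index.
  have h1 : (fun ω => d (K (N s ω) ω)) =
      fun ω => (fun n ω => d (shiftDir N K a (min n 0) ω)) (N s ω - N a ω) ω := by
    ext ω
    have := hN.monotone ω (mem_Ioi.2 hs.1) (mem_Ioi.2 ha) hs.2
    simp only at this
    simp only
    rw [min_eq_left (by omega), ← IsReflectingMotion.dir_eq]
  rw [h1]
  refine measurable_comp_index (L := fun n ω => d (shiftDir N K a (min n 0) ω)) (fun n => ?_) ?_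
  · exact (measurable_of_countable d).comp
      ((measurable_pastDirAlgebra _ (min_le_right n 0)).mono le_sup_left le_rfl)
  · exact (measurable_sub_incrementAlgebra N hs ⟨ha, le_rfl⟩).mono le_sup_right le_rfl

end Paths
-- Poisson probabilities and integrals over independent events.
section Counting

open Filter Topology

variable {Ω : Type*} {mΩ : MeasurableSpace Ω} {P : Measure Ω}
variable {lam : ℝ → ℝ} {N : ℝ → Ω → ℤ} {K : ℤ → Ω → Fin 4}

lemma intervalIntegrable_rate (hlam : ContinuousOn lam (Ioi 0)) {s t : ℝ} (hs : 0 < s)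
    (ht : 0 < t) : IntervalIntegrable lam volume s t :=
  (hlam.mono fun x hx => by
    rcases le_total s t with h | h
    · rw [uIcc_of_le h] at hx; exact hs.trans_le hx.1
    · rw [uIcc_of_ge h] at hx; exact ht.trans_le hx.1).intervalIntegrable

lemma integral_rate_nonneg (hlam0 : ∀ t, 0 < t → 0 ≤ lam t) {s t : ℝ} (hs : 0 < s)
    (hst : s ≤ t) : 0 ≤ ∫ u in s..t, lam u :=
  intervalIntegral.integral_nonneg hst fun u hu => hlam0 u (hs.trans_le hu.1)

lemma counting_mono (hN : IsPoissonCounting P lam N) (ω : Ω) {s t : ℝ} (hs : 0 < s)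
    (hst : s ≤ t) : N s ω ≤ N t ω :=
  hN.monotone ω (mem_Ioi.2 hs) (mem_Ioi.2 (hs.trans_le hst)) hst

lemma measurable_increment (hN : IsPoissonCounting P lam N) {s t : ℝ} (hs : 0 < s)
    (hst : s ≤ t) : Measurable (fun ω => N t ω - N s ω) :=
  (hN.measurable t (hs.trans_le hst)).sub (hN.measurable s hs)

lemma measureReal_increment_eq (hN : IsPoissonCounting P lam N)
    (hlam0 : ∀ t, 0 < t → 0 ≤ lam t) {s t : ℝ} (hs : 0 < s) (hst : s ≤ t) (n : ℕ) :
    P.real {ω | N t ω - N s ω = n} =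
      Real.exp (-∫ u in s..t, lam u) * (∫ u in s..t, lam u) ^ n / (n.factorial : ℝ) := by
  have h1 := congrArg (fun μ => μ.real {(n : ℤ)}) (hN.law_increments s t hs hst)
  rw [map_measureReal_apply (measurable_increment hN hs hst) (measurableSet_singleton _),
    map_measureReal_apply (measurable_of_countable _) (measurableSet_singleton _)] at h1
  have h2 : (fun n : ℕ => (n : ℤ)) ⁻¹' {(n : ℤ)} = {n} := by ext; simp
  rw [h2, poissonMeasure_real_singleton,
    Real.coe_toNNReal _ (integral_rate_nonneg hlam0 hs hst)] at h1
  exact h1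

lemma measureReal_increment_eq_zero (hN : IsPoissonCounting P lam N)
    (hlam0 : ∀ t, 0 < t → 0 ≤ lam t) {s t : ℝ} (hs : 0 < s) (hst : s ≤ t) :
    P.real {ω | N t ω - N s ω = 0} = Real.exp (-∫ u in s..t, lam u) := by
  simpa using measureReal_increment_eq hN hlam0 hs hst 0

lemma measureReal_increment_eq_one (hN : IsPoissonCounting P lam N)
    (hlam0 : ∀ t, 0 < t → 0 ≤ lam t) {s t : ℝ} (hs : 0 < s) (hst : s ≤ t) :
    P.real {ω | N t ω - N s ω = 1} =
      Real.exp (-∫ u in s..t, lam u) * ∫ u in s..t, lam u := by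
  simpa using measureReal_increment_eq hN hlam0 hs hst 1

lemma measurableSet_increment (hN : IsPoissonCounting P lam N) {s t : ℝ} (hs : 0 < s)
    (hst : s ≤ t) (n : ℤ) : MeasurableSet {ω | N t ω - N s ω = n} :=
  measurable_increment hN hs hst (measurableSet_singleton n)

lemma measureReal_increment_ne_zero_le [IsProbabilityMeasure P] (hN : IsPoissonCounting P lam N)
    (hlam0 : ∀ t, 0 < t → 0 ≤ lam t) {s t : ℝ} (hs : 0 < s) (hst : s ≤ t) :
    P.real {ω | N t ω - N s ω ≠ 0} ≤ ∫ u in s..t, lam u := by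
  have h : {ω | N t ω - N s ω ≠ 0} = {ω | N t ω - N s ω = 0}ᶜ := rfl
  rw [h, probReal_compl_eq_one_sub (measurableSet_increment hN hs hst 0),
    measureReal_increment_eq_zero hN hlam0 hs hst]
  have := Real.add_one_le_exp (-∫ u in s..t, lam u)
  linarith

/-- From `e^{-Λ} ≥ 1 - Λ` one gets `1 - (1 + Λ) e^{-Λ} ≤ Λ²`. This quadratic order makes multiple
events negligible, both in the kinetic equation and in the separation of events by a grid. -/
lemma measureReal_two_le_increment_le [IsProbabilityMeasure P] (hN : IsPoissonCounting P lam N)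
    (hlam0 : ∀ t, 0 < t → 0 ≤ lam t) {s t : ℝ} (hs : 0 < s) (hst : s ≤ t) :
    P.real {ω | 2 ≤ N t ω - N s ω} ≤ (∫ u in s..t, lam u) ^ 2 := by
  have h : {ω | 2 ≤ N t ω - N s ω} = ({ω | N t ω - N s ω = 0} ∪ {ω | N t ω - N s ω = 1})ᶜ := by
    ext ω
    have := counting_mono hN ω hs hst
    simp only [mem_ofPred_eq, mem_compl_iff, mem_union]
    omega
  rw [h, probReal_compl_eq_one_sub ((measurableSet_increment hN hs hst 0).union
      (measurableSet_increment hN hs hst 1)),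
    measureReal_union _ (measurableSet_increment hN hs hst 1),
    measureReal_increment_eq_zero hN hlam0 hs hst, measureReal_increment_eq_one hN hlam0 hs hst]
  · have h1 := Real.add_one_le_exp (-∫ u in s..t, lam u)
    have h2 := integral_rate_nonneg hlam0 hs hst
    nlinarith
  · rw [Set.disjoint_left]
    intro ω h1 h2
    simp only [mem_ofPred_eq] at h1 h2
    omega

/-- Integrals of `m₁`-measurable functions over the intersection with an independent event. -/
lemma setIntegral_inter_of_indep [IsProbabilityMeasure P] {m₁ m₂ : MeasurableSpace Ω}
    (h₁ : m₁ ≤ mΩ) (h₂ : m₂ ≤ mΩ) (h : Indep m₁ m₂ P) {f : Ω → ℝ} (hf : Measurable[m₁] f)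
    {A e : Set Ω} (hA : MeasurableSet[m₁] A) (he : MeasurableSet[m₂] e) :
    ∫ ω in A ∩ e, f ω ∂P = P.real e * ∫ ω in A, f ω ∂P := by
  have hi : IndepFun (A.indicator f) (e.indicator (1 : Ω → ℝ)) P := by
    refine indep_of_indep_of_le_left (indep_of_indep_of_le_right h ?_) ?_
    · exact measurable_iff_comap_le.1 (measurable_one.indicator he)
    · exact measurable_iff_comap_le.1 (hf.indicator hA)
  have h3 := hi.integral_fun_mul_eq_mul_integral
    ((hf.indicator hA).mono h₁ le_rfl).aestronglyMeasurable
    ((measurable_one.indicator he).mono h₂ le_rfl).aestronglyMeasurable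
  rw [integral_indicator (h₁ _ hA), integral_indicator_one (h₂ _ he)] at h3
  rw [mul_comm, ← h3, ← integral_indicator ((h₁ _ hA).inter (h₂ _ he))]
  congr 1
  ext ω
  by_cases h4 : ω ∈ A <;> by_cases h5 : ω ∈ e <;> simp [h4, h5]

/-- Integrals of functions of the past over a transition of the directions. -/
lemma setIntegral_transition [IsProbabilityMeasure P] (hN : IsPoissonCounting P lam N)
    (hK : IsReflectingDirectionSequence P K)
    (hind : Indep (dirAlgebra K) (countingAlgebra N) P) (i k : Fin 4) {f : Ω → ℝ}
    (hf : Measurable[pastDirAlgebra K ⊔ countingAlgebra N] f) :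
    ∫ ω in {ω | K 0 ω = i ∧ K 1 ω = k}, f ω ∂P = transition i k * ∫ ω in {ω | K 0 ω = i}, f ω ∂P := by
  have hm : pastDirAlgebra K ⊔ countingAlgebra N ≤ mΩ :=
    sup_le (measurable_iff_comap_le.1 (measurable_pi_lambda _ fun n => hK.measurable _))
      (countingAlgebra_le hN)
  have key : (P.restrict {ω | K 0 ω = i ∧ K 1 ω = k}).trim hm =
      (ENNReal.ofReal (transition i k) • P.restrict {ω | K 0 ω = i}).trim hm := by
    refine @Measure.ext _ (_) _ _ fun u hu => ?_
    rw [trim_measurableSet_eq hm hu, trim_measurableSet_eq hm hu, Measure.smul_apply,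
      Measure.restrict_apply (hm _ hu), Measure.restrict_apply (hm _ hu), smul_eq_mul,
      measure_past_sup_transition hN hK hind i k hu]
  have hf' := hf.stronglyMeasurable
  rw [integral_trim hm hf', key, ← integral_trim hm hf', integral_smul_measure, smul_eq_mul,
    ENNReal.toReal_ofReal]
  unfold transition
  split_ifs <;> norm_num

end Counting

/-! ### The kinetic equations. -/

section Kinetic

open Filter Topology

/-- Smooth functions with compact support. -/
structure IsTest (ψ : ℝ × ℝ → ℝ) : Prop where
  smooth : ContDiff ℝ (⊤ : ℕ∞) ψ
  compact : HasCompactSupport ψ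

/-- Derivative in the direction `v`. -/
noncomputable def dirDeriv {E : Type*} [NormedAddCommGroup E] [NormedSpace ℝ E] (v : E) (ψ : E → ℝ)
    (z : E) : ℝ := fderiv ℝ ψ z v

lemma IsTest.dirDeriv {ψ : ℝ × ℝ → ℝ} (h : IsTest ψ) (v : ℝ × ℝ) : IsTest (dirDeriv v ψ) where
  smooth := (h.smooth.fderiv_right (m := (⊤ : ℕ∞)) (by simp)).clm_apply contDiff_const
  compact := by
    refine (h.compact.fderiv (𝕜 := ℝ)).comp_left (g := fun L : ℝ × ℝ →L[ℝ] ℝ => L v) ?_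
    simp

lemma IsTest.exists_bound {ψ : ℝ × ℝ → ℝ} (h : IsTest ψ) : ∃ M, 0 ≤ M ∧ ∀ z, |ψ z| ≤ M := by
  obtain ⟨M, hM⟩ := h.compact.exists_bound_of_continuous h.smooth.continuous
  exact ⟨M, (abs_nonneg _).trans (hM 0), hM⟩

lemma IsTest.exists_lipschitz {ψ : ℝ × ℝ → ℝ} (h : IsTest ψ) :
    ∃ L : ℝ, 0 ≤ L ∧ ∀ z w, |ψ z - ψ w| ≤ L * dist z w := by
  obtain ⟨L, hL⟩ := h.smooth.lipschitzWith_of_hasCompactSupport h.compact (by simp)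
  exact ⟨L, L.2, fun z w => hL.dist_le_mul z w⟩

variable {Ω : Type*} {mΩ : MeasurableSpace Ω} {P : Measure Ω}
variable {lam : ℝ → ℝ} {N : ℝ → Ω → ℤ} {K : ℤ → Ω → Fin 4} {c : ℝ} {X Y : ℝ → Ω → ℝ}

/-- Expectation of `ψ(X(t), Y(t))` on the event that the current direction is `k`. -/
noncomputable def dirMean (P : Measure Ω) (N : ℝ → Ω → ℤ) (K : ℤ → Ω → Fin 4) (X Y : ℝ → Ω → ℝ)
    (k : Fin 4) (ψ : ℝ × ℝ → ℝ) (t : ℝ) : ℝ :=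
  ∫ ω in {ω | K (N t ω) ω = k}, ψ (X t ω, Y t ω) ∂P

/-- The unit vector `d_k`. -/
noncomputable def dir (k : Fin 4) : ℝ × ℝ := (dirX k, dirY k)

lemma IsReflectingMotion.measurable_position (h : IsReflectingMotion P c lam N K X Y) (t : ℝ) :
    Measurable (fun ω => (X t ω, Y t ω)) := (h.measurable_X t).prodMk (h.measurable_Y t)

lemma IsReflectingMotion.measurableSet_dir (h : IsReflectingMotion P c lam N K X Y) {t : ℝ}
    (ht : 0 < t) (k : Fin 4) : MeasurableSet {ω | K (N t ω) ω = k} :=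
  measurable_comp_index h.directions.measurable (h.poisson.measurable t ht)
    (measurableSet_singleton k)

lemma IsReflectingMotion.integrable_comp [IsProbabilityMeasure P]
    (h : IsReflectingMotion P c lam N K X Y) {ψ : ℝ × ℝ → ℝ} (hψ : IsTest ψ) (t : ℝ) (v : ℝ × ℝ) :
    Integrable (fun ω => ψ ((X t ω, Y t ω) + v)) P := by
  obtain ⟨M, -, hM⟩ := hψ.exists_bound
  refine Integrable.of_bound ?_ M (Eventually.of_forall fun ω => hM _)
  exact (hψ.smooth.continuous.measurable.comp
    ((h.measurable_position t).add_const v)).aestronglyMeasurable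

lemma IsReflectingMotion.dist_position_le (h : IsReflectingMotion P c lam N K X Y) (hc : 0 < c)
    {s t : ℝ} (hs : 0 < s) (hst : s ≤ t) (ω : Ω) :
    dist (X t ω, Y t ω) (X s ω, Y s ω) ≤ c * (t - s) := by
  rw [Prod.dist_eq, Real.dist_eq, Real.dist_eq, h.X_eq hs.le, h.X_eq (hs.le.trans hst),
    h.Y_eq hs.le, h.Y_eq (hs.le.trans hst),
    ← displacement_add h.poisson dirX ω le_rfl hs.le hst,
    ← displacement_add h.poisson dirY ω le_rfl hs.le hst, ← mul_sub, ← mul_sub, add_sub_cancel_left,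
    add_sub_cancel_left, abs_mul, abs_mul, abs_of_pos hc]
  exact max_le (mul_le_mul_of_nonneg_left (abs_displacement_le abs_dirX_le ω hst) hc.le)
    (mul_le_mul_of_nonneg_left (abs_displacement_le abs_dirY_le ω hst) hc.le)

lemma IsReflectingMotion.position_of_eq (h : IsReflectingMotion P c lam N K X Y)
    {s t : ℝ} (hs : 0 < s) (hst : s ≤ t) {ω : Ω} (hω : N t ω = N s ω) :
    (X t ω, Y t ω) = (X s ω, Y s ω) + (c * (t - s)) • dir (K (N s ω) ω) := by
  rw [h.X_eq hs.le, h.X_eq (hs.le.trans hst),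
    h.Y_eq hs.le, h.Y_eq (hs.le.trans hst),
    ← displacement_add h.poisson dirX ω le_rfl hs.le hst,
    ← displacement_add h.poisson dirY ω le_rfl hs.le hst, 
    displacement_of_eq h.poisson dirX hs hst hω, displacement_of_eq h.poisson dirY hs hst hω]
  ext <;> simp [dir] <;> ring

/-- The change of `dirMean` over a time interval, up to an error quadratic in the expected number
of events. -/
lemma IsReflectingMotion.dirMean_sub_le [IsProbabilityMeasure P]
    (h : IsReflectingMotion P c lam N K X Y) (hc : 0 < c) (hlam0 : ∀ t, 0 < t → 0 ≤ lam t)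
    {ψ : ℝ × ℝ → ℝ} (hψ : IsTest ψ) (k : Fin 4) {M L : ℝ} (hM : ∀ z, |ψ z| ≤ M)
    (hL : ∀ z w, |ψ z - ψ w| ≤ L * dist z w) (hL0 : 0 ≤ L) {t s : ℝ} (ht : 0 < t) (hts : t ≤ s) :
    |dirMean P N K X Y k ψ s - (Real.exp (-∫ u in t..s, lam u) *
        (∫ ω in {ω | K (N t ω) ω = k}, ψ ((X t ω, Y t ω) + (c * (s - t)) • dir k) ∂P)
      + Real.exp (-∫ u in t..s, lam u) * (∫ u in t..s, lam u) *
        ∑ i, transition i k * dirMean P N K X Y i ψ t)| ≤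
      L * (c * (s - t)) * (∫ u in t..s, lam u) + M * (∫ u in t..s, lam u) ^ 2 := by
  have hN := h.poisson
  have hs : 0 < s := ht.trans_le hts
  set Λ := ∫ u in t..s, lam u with hΛ
  have hΛ0 : 0 ≤ Λ := integral_rate_nonneg hlam0 ht hts
  have hM0 : 0 ≤ M := (abs_nonneg _).trans (hM 0)
  let K' := shiftDir N K t
  have hK' : IsReflectingDirectionSequence P K' :=
    isReflectingDirectionSequence_shiftDir hN h.directions h.indep ht
  have hind : Indep (dirAlgebra K') (countingAlgebra N) P :=
    indep_shiftDir hN h.directions h.indep ht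
  -- `m₁` contains the position at time `t` and all directions numbered from time `t`; the number of
  -- events in `(t, s]` is independent of it.
  let m₁ := dirAlgebra K' ⊔ (incrementAlgebra N (Ioc 0 t) ⊔ incrementAlgebra N (Ici s))
  have hind2 : Indep m₁ (incrementAlgebra N (Icc t s)) P :=
    indep_dirAlgebra_sup_incrementAlgebra hN hK' hind ht hts
  have hle2 : incrementAlgebra N (Icc t s) ≤ mΩ :=
    (incrementAlgebra_le_countingAlgebra N fun x hx => ht.trans_le hx.1).trans (countingAlgebra_le hN)
  have hle1 : m₁ ≤ mΩ := sup_le (dirAlgebra_le hK') ((sup_le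
    (incrementAlgebra_le_countingAlgebra N fun x hx => hx.1)
    (incrementAlgebra_le_countingAlgebra N fun x hx => hs.trans_le hx)).trans (countingAlgebra_le hN))
  have hpd : pastDirAlgebra K' ≤ dirAlgebra K' :=
    measurable_iff_comap_le.1 (@measurable_pi_lambda _ _ _ (_) _ _
      fun n => measurable_dirAlgebra K' _)
  have hpos : Measurable[pastDirAlgebra K' ⊔ incrementAlgebra N (Ioc 0 t)]
      (fun ω => (X t ω, Y t ω)) := by
    have h1 := (measurable_displacement_past (K := K) hN dirX ht).const_mul c
    have h2 := (measurable_displacement_past (K := K) hN dirY ht).const_mul c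
    convert h1.prodMk h2 using 2 with ω
    rw [h.X_eq ht.le, h.Y_eq ht.le]
  have hposm : ∀ v : ℝ × ℝ, Measurable[pastDirAlgebra K' ⊔ incrementAlgebra N (Ioc 0 t)]
      (fun ω => ψ ((X t ω, Y t ω) + v)) := fun v =>
    hψ.smooth.continuous.measurable.comp (hpos.add_const v)
  have hle3 : pastDirAlgebra K' ⊔ incrementAlgebra N (Ioc 0 t) ≤ m₁ :=
    sup_le_sup hpd le_sup_left
  have hle4 : pastDirAlgebra K' ⊔ incrementAlgebra N (Ioc 0 t) ≤
      pastDirAlgebra K' ⊔ countingAlgebra N :=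
    sup_le_sup le_rfl (incrementAlgebra_le_countingAlgebra N fun x hx => hx.1)
  have hdir0 : ∀ ω, K' 0 ω = K (N t ω) ω := fun ω => by simp [K', shiftDir]
  let e₀ := {ω | N s ω - N t ω = 0}
  let e₁ := {ω | N s ω - N t ω = 1}
  have he : ∀ n : ℤ, MeasurableSet[incrementAlgebra N (Icc t s)] {ω | N s ω - N t ω = n} :=
    fun n => measurable_sub_incrementAlgebra N (T := Icc t s) ⟨hts, le_rfl⟩ ⟨le_rfl, hts⟩
      (measurableSet_singleton n)
  have hdm : ∀ (n : ℤ) (i : Fin 4), MeasurableSet[dirAlgebra K'] {ω | K' n ω = i} :=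
    fun n i => measurable_dirAlgebra K' n (measurableSet_singleton i)
  let S' := {ω | K (N s ω) ω = k}
  have hS' : MeasurableSet[mΩ] S' := h.measurableSet_dir hs k
  have hint : ∀ u, Integrable (fun ω => ψ (X u ω, Y u ω)) P := fun u => by
    simpa using h.integrable_comp hψ u 0
  -- Split into no event, exactly one event, and at least two events in `(t, s]`.
  have hsplit : dirMean P N K X Y k ψ s = ∫ ω in S' ∩ e₀, ψ (X s ω, Y s ω) ∂P +
      (∫ ω in (S' \ e₀) ∩ e₁, ψ (X s ω, Y s ω) ∂P +
        ∫ ω in (S' \ e₀) \ e₁, ψ (X s ω, Y s ω) ∂P) := by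
    rw [integral_inter_add_sdiff (hle2 _ (he 1)) (hint s).integrableOn,
      integral_inter_add_sdiff (hle2 _ (he 0)) (hint s).integrableOn]
    rfl
  have hT0 : ∫ ω in S' ∩ e₀, ψ (X s ω, Y s ω) ∂P = Real.exp (-Λ) *
      ∫ ω in {ω | K (N t ω) ω = k}, ψ ((X t ω, Y t ω) + (c * (s - t)) • dir k) ∂P := by
    have h1 : S' ∩ e₀ = {ω | K' 0 ω = k} ∩ e₀ := by
      ext ω
      simp only [S', e₀, mem_inter_iff, mem_ofPred_eq, hdir0, sub_eq_zero]
      constructor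
      · rintro ⟨h1, h2⟩; exact ⟨h2 ▸ h1, h2⟩
      · rintro ⟨h1, h2⟩; exact ⟨h2 ▸ h1, h2⟩
    have h2 : ∫ ω in {ω | K' 0 ω = k} ∩ e₀, ψ (X s ω, Y s ω) ∂P =
        ∫ ω in {ω | K' 0 ω = k} ∩ e₀, ψ ((X t ω, Y t ω) + (c * (s - t)) • dir k) ∂P := by
      refine setIntegral_congr_fun ((dirAlgebra_le hK' _ (hdm 0 k)).inter (hle2 _ (he 0))) ?_
      rintro ω ⟨hω1, hω2⟩
      have hω1 : K (N t ω) ω = k := by rw [← hdir0]; exact hω1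
      simp only
      rw [h.position_of_eq ht hts (sub_eq_zero.1 hω2), hω1]
    rw [h1, h2, setIntegral_inter_of_indep hle1 hle2 hind2 ((hposm _).mono hle3 le_rfl)
      (le_sup_left (a := dirAlgebra K') _ (hdm 0 k)) (he 0),
      measureReal_increment_eq_zero hN hlam0 ht hts]
    simp only [hdir0, hΛ]
  have hT1 : (S' \ e₀) ∩ e₁ = {ω | K' 1 ω = k} ∩ e₁ := by
    ext ω
    simp only [S', e₀, e₁, mem_inter_iff, Set.mem_sdiff, mem_ofPred_eq, K', shiftDir]
    constructor
    · rintro ⟨⟨h1, h2⟩, h3⟩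
      exact ⟨by rwa [← h3, add_sub_cancel], h3⟩
    · rintro ⟨h1, h3⟩
      rw [← h3, add_sub_cancel] at h1
      exact ⟨⟨h1, fun h4 => zero_ne_one (h4.symm.trans h3)⟩, h3⟩
  -- With the position frozen at time `t`, the single event factors out by independence, and the
  -- redrawn direction contributes a transition probability by the Markov property.
  have hT1' : ∫ ω in {ω | K' 1 ω = k} ∩ e₁, ψ (X t ω, Y t ω) ∂P =
      Real.exp (-Λ) * Λ * ∑ i, transition i k * dirMean P N K X Y i ψ t := by
    have hf0 := hposm 0
    simp only [add_zero] at hf0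
    rw [setIntegral_inter_of_indep hle1 hle2 hind2 (hf0.mono hle3 le_rfl)
      (le_sup_left (a := dirAlgebra K') _ (hdm 1 k)) (he 1)]
    have hU : {ω | K' 1 ω = k} = ⋃ i, {ω | K' 0 ω = i ∧ K' 1 ω = k} := by ext; simp
    have hmi : ∀ i, MeasurableSet[mΩ] {ω | K' 0 ω = i ∧ K' 1 ω = k} := fun i =>
      (dirAlgebra_le hK' _ (hdm 0 i)).inter (dirAlgebra_le hK' _ (hdm 1 k))
    rw [hU, integral_iUnion_fintype hmi ?_ fun i => (hint t).integrableOn]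
    swap
    · intro i j hij
      refine Set.disjoint_left.2 fun ω h1 h2 => hij ?_
      exact h1.1.symm.trans h2.1
    congr 1
    · exact measureReal_increment_eq_one hN hlam0 ht hts
    · refine Finset.sum_congr rfl fun i _ => ?_
      rw [setIntegral_transition hN hK' hind i k (hf0.mono hle4 le_rfl)]
      simp only [hdir0, dirMean]
  -- Freezing the position costs at most the Lipschitz constant times the distance travelled, on an
  -- event of probability at most `Λ`: again second order.
  have hT1d : |∫ ω in {ω | K' 1 ω = k} ∩ e₁, ψ (X s ω, Y s ω) ∂P -
      ∫ ω in {ω | K' 1 ω = k} ∩ e₁, ψ (X t ω, Y t ω) ∂P| ≤ L * (c * (s - t)) * Λ := by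
    rw [← integral_sub (hint s).integrableOn (hint t).integrableOn]
    have hb : ∀ ω, |ψ (X s ω, Y s ω) - ψ (X t ω, Y t ω)| ≤ L * (c * (s - t)) := fun ω =>
      (hL _ _).trans (mul_le_mul_of_nonneg_left (h.dist_position_le hc ht hts ω) hL0)
    refine (norm_setIntegral_le_of_norm_le_const (measure_lt_top _ _) fun ω _ =>
      (Real.norm_eq_abs _).trans_le (hb ω)).trans ?_
    refine mul_le_mul_of_nonneg_left ?_ ((abs_nonneg _).trans (hb (Classical.choice
      (nonempty_of_isProbabilityMeasure P))))
    refine (measureReal_mono ?_).trans (measureReal_increment_ne_zero_le hN hlam0 ht hts)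
    rintro ω ⟨-, h2⟩
    have h2 : N s ω - N t ω = 1 := h2
    simp [h2]
  have hT2 : |∫ ω in (S' \ e₀) \ e₁, ψ (X s ω, Y s ω) ∂P| ≤ M * Λ ^ 2 := by
    refine (norm_setIntegral_le_of_norm_le_const (measure_lt_top _ _) fun ω _ =>
      (Real.norm_eq_abs _).trans_le (hM _)).trans ?_
    refine mul_le_mul_of_nonneg_left ?_ hM0
    refine (measureReal_mono ?_).trans (measureReal_two_le_increment_le hN hlam0 ht hts)
    rintro ω ⟨⟨-, h1⟩, h2⟩
    have h3 := counting_mono hN ω ht hts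
    simp only [e₀, e₁, mem_ofPred_eq] at h1 h2 ⊢
    omega
  rw [hsplit, hT0, hT1, ← hT1']
  refine le_trans (le_of_eq_of_le ?_ (abs_add_le _ _)) (add_le_add hT1d hT2)
  congr 1
  ring

/-- Without an event the direction is kept and the position moves by at most `c (s - t)`; with an
event the integrand changes by at most `2 M`. The bound vanishes as `s - t → 0` from either side,
which yields continuity. -/
lemma IsReflectingMotion.abs_dirMean_sub_le [IsProbabilityMeasure P]
    (h : IsReflectingMotion P c lam N K X Y) (hc : 0 < c) (hlam0 : ∀ t, 0 < t → 0 ≤ lam t)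
    {ψ : ℝ × ℝ → ℝ} (hψ : IsTest ψ) (k : Fin 4) {M L : ℝ} (hM : ∀ z, |ψ z| ≤ M)
    (hL : ∀ z w, |ψ z - ψ w| ≤ L * dist z w) (hL0 : 0 ≤ L) {t s : ℝ} (ht : 0 < t) (hts : t ≤ s) :
    |dirMean P N K X Y k ψ s - dirMean P N K X Y k ψ t| ≤
      L * (c * (s - t)) + 2 * M * ∫ u in t..s, lam u := by
  have hN := h.poisson
  have hs : 0 < s := ht.trans_le hts
  have hM0 : 0 ≤ M := (abs_nonneg _).trans (hM 0)
  have hint : ∀ u, Integrable (fun ω => ψ (X u ω, Y u ω)) P := fun u => by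
    simpa using h.integrable_comp hψ u 0
  let f : ℝ → Ω → ℝ := fun u => {ω | K (N u ω) ω = k}.indicator fun ω => ψ (X u ω, Y u ω)
  have hf : ∀ u, 0 < u → Integrable (f u) P := fun u hu =>
    (hint u).indicator (h.measurableSet_dir hu k)
  have he : ∀ u, 0 < u → dirMean P N K X Y k ψ u = ∫ ω, f u ω ∂P := fun u hu =>
    (integral_indicator (h.measurableSet_dir hu k)).symm
  let e := {ω | N s ω - N t ω ≠ 0}
  have hem : MeasurableSet e := (measurableSet_increment hN ht hts 0).compl
  have hfM : ∀ u ω, |f u ω| ≤ M := fun u ω => by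
    simp only [f, indicator]
    split_ifs
    · exact hM _
    · simpa using hM0
  rw [he s hs, he t ht, ← integral_sub (hf s hs) (hf t ht)]
  have hb : ∀ ω, ‖f s ω - f t ω‖ ≤ L * (c * (s - t)) + e.indicator (fun _ => 2 * M) ω := by
    intro ω
    have hp : 0 ≤ L * (c * (s - t)) := mul_nonneg hL0 (mul_nonneg hc.le (sub_nonneg.2 hts))
    by_cases hω : ω ∈ e
    · rw [indicator_of_mem hω]
      have := abs_sub (f s ω) (f t ω)
      have h1 := hfM s ω
      have h2 := hfM t ω
      rw [Real.norm_eq_abs]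
      linarith
    · rw [indicator_of_notMem hω, add_zero]
      have hω' : N s ω = N t ω := by simpa [e, sub_eq_zero] using hω
      simp only [f, indicator, mem_ofPred_eq, hω']
      split_ifs
      · exact (hL _ _).trans (mul_le_mul_of_nonneg_left (h.dist_position_le hc ht hts ω) hL0)
      · simpa using hp
  refine (norm_integral_le_of_norm_le
    ((integrable_const _).add ((integrable_const (2 * M)).indicator hem))
    (Eventually.of_forall hb)).trans ?_
  rw [integral_add' (integrable_const _) ((integrable_const (2 * M)).indicator hem),
    integral_indicator hem]
  simp only [integral_const, probReal_univ, smul_eq_mul, one_mul, measureReal_restrict_apply_univ]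
  have := measureReal_increment_ne_zero_le hN hlam0 ht hts
  have h3 := mul_le_mul_of_nonneg_right this (by positivity : 0 ≤ 2 * M)
  linarith

lemma hasDerivAt_integral_rate (hlam : ContinuousOn lam (Ioi 0)) {a t : ℝ} (ha : 0 < a)
    (ht : 0 < t) : HasDerivAt (fun s => ∫ u in a..s, lam u) (lam t) t :=
  intervalIntegral.integral_hasDerivAt_right (intervalIntegrable_rate hlam ha ht)
    (hlam.stronglyMeasurableAtFilter isOpen_Ioi t ht) (hlam.continuousAt (Ioi_mem_nhds ht))

/-- The velocity term, the loss and the gain in the kinetic equation for the direction `k`. -/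
noncomputable def kineticRate (P : Measure Ω) (lam : ℝ → ℝ) (N : ℝ → Ω → ℤ) (K : ℤ → Ω → Fin 4)
    (c : ℝ) (X Y : ℝ → Ω → ℝ) (k : Fin 4) (ψ : ℝ × ℝ → ℝ) (t : ℝ) : ℝ :=
  c * dirMean P N K X Y k (dirDeriv (dir k) ψ) t - lam t * dirMean P N K X Y k ψ t
    + lam t * ∑ i, transition i k * dirMean P N K X Y i ψ t

lemma IsReflectingMotion.hasDerivAt_shifted_mean [IsProbabilityMeasure P]
    (h : IsReflectingMotion P c lam N K X Y) {ψ : ℝ × ℝ → ℝ} (hψ : IsTest ψ) (k : Fin 4) (t : ℝ)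
    (v : ℝ × ℝ) :
    HasDerivAt (fun r : ℝ => ∫ ω in {ω | K (N t ω) ω = k}, ψ ((X t ω, Y t ω) + r • v) ∂P)
      (dirMean P N K X Y k (dirDeriv v ψ) t) 0 := by
  obtain ⟨M, -, hM⟩ := (hψ.dirDeriv v).exists_bound
  have key := hasDerivAt_integral_of_dominated_loc_of_deriv_le
    (μ := P.restrict {ω | K (N t ω) ω = k}) (s := univ) (bound := fun _ => M) (x₀ := (0 : ℝ))
    (F := fun (r : ℝ) ω => ψ ((X t ω, Y t ω) + r • v))
    (F' := fun (r : ℝ) ω => dirDeriv v ψ ((X t ω, Y t ω) + r • v)) Filter.univ_mem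
    (Eventually.of_forall fun r => (h.integrable_comp hψ t (r • v)).integrableOn.aestronglyMeasurable)
    (h.integrable_comp hψ t _).integrableOn
    (h.integrable_comp (hψ.dirDeriv v) t _).integrableOn.aestronglyMeasurable
    (Eventually.of_forall fun ω r _ => hM _) (integrable_const _)
    (Eventually.of_forall fun ω r _ => ?_)
  · have := key.2
    simpa [dirMean] using this
  · have h1 : HasFDerivAt ψ (fderiv ℝ ψ ((X t ω, Y t ω) + r • v)) ((X t ω, Y t ω) + r • v) :=
      (hψ.smooth.differentiable (by simp) _).hasFDerivAt
    have h2 : HasDerivAt (fun r : ℝ => (X t ω, Y t ω) + r • v) v r := by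
      simpa using ((hasDerivAt_id r).smul_const v).const_add (X t ω, Y t ω)
    exact h1.comp_hasDerivAt r h2

lemma hasDerivWithinAt_zero_of_abs_le {f B : ℝ → ℝ} {t : ℝ} {S : Set ℝ}
    (hB : HasDerivWithinAt B 0 S t) (hB0 : B t = 0) (hf0 : f t = 0)
    (hf : ∀ s ∈ S, |f s| ≤ B s) : HasDerivWithinAt f 0 S t := by
  rw [hasDerivWithinAt_iff_isLittleO] at hB ⊢
  simp only [smul_zero, sub_zero, hB0, hf0] at hB ⊢
  refine Asymptotics.IsBigO.trans_isLittleO (Asymptotics.IsBigO.of_bound 1 ?_) hB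
  filter_upwards [self_mem_nhdsWithin] with s hs
  rw [one_mul]
  exact (hf s hs).trans (le_abs_self _)

/-- The expansion compares `t` with later times only, hence a one-sided derivative. The remainder is
dominated by `B`, which vanishes at `t` together with its derivative; the main part `H` is
differentiated explicitly. -/
lemma IsReflectingMotion.hasDerivWithinAt_dirMean [IsProbabilityMeasure P]
    (h : IsReflectingMotion P c lam N K X Y) (hc : 0 < c) (hlam : ContinuousOn lam (Ioi 0))
    (hlam0 : ∀ t, 0 < t → 0 ≤ lam t) {ψ : ℝ × ℝ → ℝ} (hψ : IsTest ψ) (k : Fin 4) {t : ℝ}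
    (ht : 0 < t) :
    HasDerivWithinAt (dirMean P N K X Y k ψ) (kineticRate P lam N K c X Y k ψ t) (Ici t) t := by
  obtain ⟨M, hM0, hM⟩ := hψ.exists_bound
  obtain ⟨L, hL0, hL⟩ := hψ.exists_lipschitz
  let Λ : ℝ → ℝ := fun s => ∫ u in t..s, lam u
  have hΛt : Λ t = 0 := intervalIntegral.integral_same
  have hΛ : HasDerivAt Λ (lam t) t := hasDerivAt_integral_rate hlam ht ht
  let G : ℝ → ℝ := fun s =>
    ∫ ω in {ω | K (N t ω) ω = k}, ψ ((X t ω, Y t ω) + (c * (s - t)) • dir k) ∂P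
  have hGt : G t = dirMean P N K X Y k ψ t := by simp [G, dirMean]
  have hG : HasDerivAt G (dirMean P N K X Y k (dirDeriv (dir k) ψ) t * c) t := by
    have h1 := h.hasDerivAt_shifted_mean hψ k t (dir k)
    have h2 : HasDerivAt (fun s => c * (s - t)) c t := by
      simpa using ((hasDerivAt_id t).sub_const t).const_mul c
    have h3 : c * (t - t) = 0 := by simp
    rw [← h3] at h1
    exact h1.comp t h2
  let T := ∑ i, transition i k * dirMean P N K X Y i ψ t
  let H : ℝ → ℝ := fun s => Real.exp (-Λ s) * G s + Real.exp (-Λ s) * Λ s * T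
  have hH : HasDerivAt H (kineticRate P lam N K c X Y k ψ t) t := by
    have h1 := (hΛ.neg.exp.mul hG).add ((hΛ.neg.exp.mul hΛ).mul_const T)
    refine h1.congr_deriv ?_
    simp only [Pi.neg_apply, hΛt, hGt, neg_zero, Real.exp_zero, kineticRate, T]
    ring
  let B : ℝ → ℝ := fun s => L * (c * (s - t)) * Λ s + M * Λ s ^ 2
  have hB : HasDerivAt B 0 t := by
    have h2 : HasDerivAt (fun s => L * (c * (s - t))) (L * c) t := by
      simpa using (((hasDerivAt_id t).sub_const t).const_mul c).const_mul L
    have h1 := (h2.mul hΛ).add ((hΛ.pow 2).const_mul M)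
    refine h1.congr_deriv ?_
    simp [hΛt]
  have hR := hasDerivWithinAt_zero_of_abs_le (f := fun s => dirMean P N K X Y k ψ s - H s)
    (S := Ici t) hB.hasDerivWithinAt (by simp [B, hΛt]) (by simp [H, hΛt, hGt]) fun s hs =>
      h.dirMean_sub_le hc hlam0 hψ k hM hL hL0 ht hs
  have := hR.add hH.hasDerivWithinAt
  rw [zero_add] at this
  exact this.congr_of_eventuallyEq (Eventually.of_forall fun s => by simp) (by simp)

lemma IsReflectingMotion.continuousOn_dirMean [IsProbabilityMeasure P]
    (h : IsReflectingMotion P c lam N K X Y) (hc : 0 < c) (hlam : ContinuousOn lam (Ioi 0))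
    (hlam0 : ∀ t, 0 < t → 0 ≤ lam t) {ψ : ℝ × ℝ → ℝ} (hψ : IsTest ψ) (k : Fin 4) :
    ContinuousOn (dirMean P N K X Y k ψ) (Ioi 0) := by
  obtain ⟨M, hM0, hM⟩ := hψ.exists_bound
  obtain ⟨L, hL0, hL⟩ := hψ.exists_lipschitz
  intro t ht
  have ht : 0 < t := ht
  let B : ℝ → ℝ := fun s => |L * (c * (s - t)) + 2 * M * ∫ u in t..s, lam u|
  have hB : ContinuousAt B t := by
    refine ContinuousAt.abs (ContinuousAt.add (by fun_prop) (continuousAt_const.mul ?_))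
    exact (hasDerivAt_integral_rate hlam ht ht).continuousAt
  have hBt : B t = 0 := by simp [B]
  refine ContinuousAt.continuousWithinAt ?_
  rw [ContinuousAt, tendsto_iff_norm_sub_tendsto_zero]
  rw [ContinuousAt, hBt] at hB
  refine squeeze_zero' (Eventually.of_forall fun s => norm_nonneg _) ?_ hB
  filter_upwards [Ioi_mem_nhds ht] with s hs
  rcases le_total t s with hts | hts
  · exact (h.abs_dirMean_sub_le hc hlam0 hψ k hM hL hL0 ht hts).trans (le_abs_self _)
  · rw [norm_sub_rev]
    refine (h.abs_dirMean_sub_le hc hlam0 hψ k hM hL hL0 hs hts).trans ?_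
    simp only [B]
    rw [intervalIntegral.integral_symm, ← abs_neg]
    refine le_trans (le_of_eq ?_) (le_abs_self _)
    ring

lemma IsReflectingMotion.continuousOn_kineticRate [IsProbabilityMeasure P]
    (h : IsReflectingMotion P c lam N K X Y) (hc : 0 < c) (hlam : ContinuousOn lam (Ioi 0))
    (hlam0 : ∀ t, 0 < t → 0 ≤ lam t) {ψ : ℝ × ℝ → ℝ} (hψ : IsTest ψ) (k : Fin 4) :
    ContinuousOn (kineticRate P lam N K c X Y k ψ) (Ioi 0) := by
  have h1 := fun i => h.continuousOn_dirMean hc hlam hlam0 hψ i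
  have h2 := h.continuousOn_dirMean hc hlam hlam0 (hψ.dirDeriv (dir k)) k
  exact ((continuousOn_const.mul h2).sub (hlam.mul (h1 k))).add
    (hlam.mul (continuousOn_finsetSum _ fun i _ => continuousOn_const.mul (h1 i)))

/-- The kinetic (forward Kolmogorov) equations. -/
theorem IsReflectingMotion.hasDerivAt_dirMean [IsProbabilityMeasure P]
    (h : IsReflectingMotion P c lam N K X Y) (hc : 0 < c) (hlam : ContinuousOn lam (Ioi 0))
    (hlam0 : ∀ t, 0 < t → 0 ≤ lam t) {ψ : ℝ × ℝ → ℝ} (hψ : IsTest ψ) (k : Fin 4) {t : ℝ}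
    (ht : 0 < t) :
    HasDerivAt (dirMean P N K X Y k ψ) (kineticRate P lam N K c X Y k ψ t) t := by
  have hr := h.continuousOn_kineticRate hc hlam hlam0 hψ k
  -- A continuous function with a continuous right derivative is a primitive of it, hence
  -- differentiable on both sides. The base point `t / 2` stays away from `0`, where `lam` may fail
  -- to be integrable.
  have ha : 0 < t / 2 := by positivity
  have hi : ∀ s, t / 2 ≤ s → IntervalIntegrable (kineticRate P lam N K c X Y k ψ) volume (t / 2) s :=
    fun s hs => (hr.mono fun x hx => by
      rw [uIcc_of_le hs] at hx; exact ha.trans_le hx.1).intervalIntegrable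
  have h1 : HasDerivAt (fun s => dirMean P N K X Y k ψ (t / 2) +
      ∫ u in (t / 2)..s, kineticRate P lam N K c X Y k ψ u) (kineticRate P lam N K c X Y k ψ t) t :=
    (intervalIntegral.integral_hasDerivAt_right (hi t (by linarith))
      (hr.stronglyMeasurableAtFilter isOpen_Ioi t ht)
      (hr.continuousAt (Ioi_mem_nhds ht))).const_add _
  refine h1.congr_of_eventuallyEq ?_
  filter_upwards [Ioi_mem_nhds (show t / 2 < t by linarith)] with s hs
  have hs : t / 2 < s := hs
  rw [intervalIntegral.integral_eq_sub_of_hasDeriv_right_of_le hs.le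
    ((h.continuousOn_dirMean hc hlam hlam0 hψ k).mono fun x hx => ha.trans_le hx.1)
    (fun x hx => (h.hasDerivWithinAt_dirMean hc hlam hlam0 hψ k (ha.trans hx.1)).mono
      Ioi_subset_Ici_self) (hi s hs.le)]
  ring

end Kinetic
-- Iterated and directional derivatives.
section Calculus

open Filter Topology

/-- Lets an explicit chain of successive derivatives on an open set stand for `iteratedDeriv`;
openness allows rewriting near the point before differentiating again. -/
lemma iteratedDeriv_eq_of_hasDerivAt {U : Set ℝ} (hU : IsOpen U) {f : ℕ → ℝ → ℝ} {n : ℕ}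
    (h : ∀ j < n, ∀ t ∈ U, HasDerivAt (f j) (f (j + 1) t) t) :
    ∀ j ≤ n, ∀ t ∈ U, iteratedDeriv j (f 0) t = f j t := by
  intro j
  induction j with
  | zero => intro _ t _; simp
  | succ j ih =>
    intro hj t ht
    have h1 : iteratedDeriv j (f 0) =ᶠ[𝓝 t] f j := by
      filter_upwards [hU.mem_nhds ht] with s hs using ih (by omega) s hs
    rw [iteratedDeriv_succ, h1.deriv_eq]
    exact (h j (by omega) t ht).deriv

lemma contDiffOn_of_hasDerivAt {U : Set ℝ} (hU : IsOpen U) {n : ℕ} : ∀ {f : ℕ → ℝ → ℝ},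
    (∀ j < n, ∀ t ∈ U, HasDerivAt (f j) (f (j + 1) t) t) → ContinuousOn (f n) U →
    ContDiffOn ℝ n (f 0) U := by
  induction n with
  | zero => intro f _ hc; exact contDiffOn_zero.2 hc
  | succ n ih =>
    intro f h hc
    have h1 : ContDiffOn ℝ n (f 1) U := ih (f := fun j => f (j + 1))
      (fun j hj t ht => h (j + 1) (by omega) t ht) hc
    rw [show ((n + 1 : ℕ) : WithTop ℕ∞) = (n : WithTop ℕ∞) + 1 by push_cast; rfl,
      contDiffOn_succ_iff_deriv_of_isOpen hU]
    refine ⟨fun t ht => (h 0 (by omega) t ht).differentiableAt.differentiableWithinAt, by simp, ?_⟩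
    exact h1.congr fun t ht => (h 0 (by omega) t ht).deriv

lemma hasDerivAt_of_contDiffOn {U : Set ℝ} (hU : IsOpen U) {f : ℝ → ℝ} {n : ℕ}
    (h : ContDiffOn ℝ n f U) : ∀ j < n, ∀ t ∈ U,
      HasDerivAt (iteratedDeriv j f) (iteratedDeriv (j + 1) f t) t := by
  intro j hj t ht
  have h1 : DifferentiableOn ℝ (iteratedDerivWithin j f U) U :=
    h.differentiableOn_iteratedDerivWithin (by exact_mod_cast hj) hU.uniqueDiffOn
  have h2 : iteratedDerivWithin j f U =ᶠ[𝓝 t] iteratedDeriv j f := by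
    filter_upwards [hU.mem_nhds ht] with s hs using iteratedDerivWithin_of_isOpen hU hs
  rw [iteratedDeriv_succ]
  exact ((h1.differentiableAt (hU.mem_nhds ht)).congr_of_eventuallyEq h2.symm).hasDerivAt

lemma continuousOn_iteratedDeriv_of_contDiffOn {U : Set ℝ} (hU : IsOpen U) {f : ℝ → ℝ} {n : ℕ}
    (h : ContDiffOn ℝ n f U) : ContinuousOn (iteratedDeriv n f) U := by
  have h1 := h.continuousOn_iteratedDerivWithin (m := n) le_rfl hU.uniqueDiffOn
  exact h1.congr fun t ht => (iteratedDerivWithin_of_isOpen hU ht).symm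

variable {E : Type*} [NormedAddCommGroup E] [NormedSpace ℝ E]

lemma contDiffAt_dirDeriv {F : E → ℝ} {z : E} {n m : ℕ} (h : ContDiffAt ℝ n F z) (hm : m + 1 ≤ n)
    (v : E) : ContDiffAt ℝ m (dirDeriv v F) z :=
  (h.fderiv_right (m := m) (by exact_mod_cast hm)).clm_apply contDiffAt_const

/-- Second derivatives along an affine curve. -/
lemma iteratedDeriv_two_comp {F : E → ℝ} {γ : ℝ → E} {v : E} (hγ : ∀ s, HasDerivAt γ v s) {s : ℝ}
    (h : ContDiffAt ℝ 2 F (γ s)) :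
    iteratedDeriv 2 (fun r => F (γ r)) s = dirDeriv v (dirDeriv v F) (γ s) := by
  have hd : ∀ {G : E → ℝ} {r : ℝ}, DifferentiableAt ℝ G (γ r) →
      HasDerivAt (fun r => G (γ r)) (dirDeriv v G (γ r)) r := fun hG =>
    hG.hasFDerivAt.comp_hasDerivAt _ (hγ _)
  have h1 : ∀ᶠ z in 𝓝 (γ s), ContDiffAt ℝ 2 F z := h.eventually (by simp)
  have h2 : ∀ᶠ r in 𝓝 s, ContDiffAt ℝ 2 F (γ r) := (hγ s).continuousAt.eventually h1
  rw [iteratedDeriv_succ, iteratedDeriv_one]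
  have h3 : deriv (fun r => F (γ r)) =ᶠ[𝓝 s] fun r => dirDeriv v F (γ r) := by
    filter_upwards [h2] with r hr
    exact (hd (hr.differentiableAt (by simp))).deriv
  rw [h3.deriv_eq]
  exact (hd ((contDiffAt_dirDeriv (n := 2) (m := 1) h (by norm_num) v).differentiableAt
    (by simp))).deriv

lemma hasDerivAt_line_fst (y s : ℝ) : HasDerivAt (fun x : ℝ => (x, y)) ((1, 0) : ℝ × ℝ) s :=
  (hasDerivAt_id s).prodMk (hasDerivAt_const s y)

lemma hasDerivAt_line_snd (x s : ℝ) : HasDerivAt (fun y : ℝ => (x, y)) ((0, 1) : ℝ × ℝ) s :=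
  (hasDerivAt_const s x).prodMk (hasDerivAt_id s)

lemma laplacian_eq_dirDeriv {f : ℝ → ℝ → ℝ} {x y : ℝ}
    (h : ContDiffAt ℝ 2 (fun z : ℝ × ℝ => f z.1 z.2) (x, y)) :
    laplacian f x y = dirDeriv (1, 0) (dirDeriv (1, 0) fun z : ℝ × ℝ => f z.1 z.2) (x, y) +
      dirDeriv (0, 1) (dirDeriv (0, 1) fun z : ℝ × ℝ => f z.1 z.2) (x, y) := by
  rw [laplacian, ← iteratedDeriv_two_comp (fun s => hasDerivAt_line_fst y s) h,
    ← iteratedDeriv_two_comp (fun s => hasDerivAt_line_snd x s) h]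

lemma dxxyy_eq_dirDeriv {f : ℝ → ℝ → ℝ} {x y : ℝ}
    (h : ContDiffAt ℝ 4 (fun z : ℝ × ℝ => f z.1 z.2) (x, y)) :
    dxxyy f x y = dirDeriv (1, 0) (dirDeriv (1, 0) (dirDeriv (0, 1) (dirDeriv (0, 1)
      fun z : ℝ × ℝ => f z.1 z.2))) (x, y) := by
  have h1 : ∀ᶠ z in 𝓝 (x, y), ContDiffAt ℝ 4 (fun z : ℝ × ℝ => f z.1 z.2) z :=
    h.eventually (by simp)
  have h2 : ∀ᶠ r in 𝓝 x, ContDiffAt ℝ 4 (fun z : ℝ × ℝ => f z.1 z.2) (r, y) :=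
    (hasDerivAt_line_fst y x).continuousAt.eventually h1
  have h3 : (fun x' => iteratedDeriv 2 (fun y' => f x' y') y) =ᶠ[𝓝 x]
      fun r => dirDeriv (0, 1) (dirDeriv (0, 1) fun z : ℝ × ℝ => f z.1 z.2) (r, y) := by
    filter_upwards [h2] with r hr
    exact iteratedDeriv_two_comp (F := fun z : ℝ × ℝ => f z.1 z.2)
      (fun s => hasDerivAt_line_snd r s) (hr.of_le (by norm_num))
  rw [dxxyy, h3.iteratedDeriv_eq 2]
  refine iteratedDeriv_two_comp (fun s => hasDerivAt_line_fst y s)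
    (F := dirDeriv (0, 1) (dirDeriv (0, 1) fun z : ℝ × ℝ => f z.1 z.2)) ?_
  exact contDiffAt_dirDeriv (n := 3) (m := 2) (contDiffAt_dirDeriv (n := 4) (m := 3) h (by norm_num) _)
    (by norm_num) _

lemma dirDeriv_comm {F : E → ℝ} {z : E} (h : ContDiffAt ℝ 2 F z) (v w : E) :
    dirDeriv v (dirDeriv w F) z = dirDeriv w (dirDeriv v F) z := by
  have h1 : DifferentiableAt ℝ (fderiv ℝ F) z :=
    (h.fderiv_right (m := 1) (by norm_num)).differentiableAt (by simp)
  have h2 : ∀ u : E, HasFDerivAt (dirDeriv u F)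
      ((ContinuousLinearMap.apply ℝ ℝ u).comp (fderiv ℝ (fderiv ℝ F) z)) z := fun u =>
    (ContinuousLinearMap.apply ℝ ℝ u).hasFDerivAt.comp z h1.hasFDerivAt
  have h3 := (h.isSymmSndFDerivAt (by simp)).eq v w
  rw [dirDeriv, dirDeriv, (h2 w).fderiv, (h2 v).fderiv]
  simpa using h3

end Calculus

/-! ### Elimination in the kinetic system. -/

section Equation

open Filter Topology

variable {Ω : Type*} {mΩ : MeasurableSpace Ω} {P : Measure Ω}
variable {lam : ℝ → ℝ} {N : ℝ → Ω → ℤ} {K : ℤ → Ω → Fin 4} {c : ℝ} {X Y : ℝ → Ω → ℝ}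

/-- The gain term sees only the total and the value at `k`. Hence in a difference of opposite
directions the total cancels, leaving pure decay at rate `4λ/3`, while the sums `A`, `E` relax
towards each other at rate `2λ/3`. -/
lemma transition_sum (V : Fin 4 → ℝ) (k : Fin 4) :
    ∑ i, transition i k * V i = 1 / 3 * (V 0 + V 1 + V 2 + V 3 - V k) := by
  rw [Fin.sum_univ_four]
  fin_cases k <;> simp [transition] <;> ring

lemma dirDeriv_neg {E : Type*} [NormedAddCommGroup E] [NormedSpace ℝ E] (v : E) (ψ : E → ℝ) :
    dirDeriv (-v) ψ = fun z => -dirDeriv v ψ z := by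
  ext z; simp [dirDeriv]

lemma dir_zero : dir 0 = (1, 0) := by simp [dir, dirX_zero, dirY_zero]
lemma dir_one : dir 1 = (0, 1) := by simp [dir, dirX_one, dirY_one]
lemma dir_two : dir 2 = -(1, 0) := by simp [dir, dirX_two, dirY_two]
lemma dir_three : dir 3 = -(0, 1) := by simp [dir, dirX_three, dirY_three]

/-- The expectation of `ψ(X(t), Y(t))`. -/
noncomputable def positionMean (P : Measure Ω) (X Y : ℝ → Ω → ℝ) (ψ : ℝ × ℝ → ℝ) (t : ℝ) : ℝ :=
  ∫ ω, ψ (X t ω, Y t ω) ∂P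

lemma IsReflectingMotion.positionMean_eq_sum [IsProbabilityMeasure P]
    (h : IsReflectingMotion P c lam N K X Y) {ψ : ℝ × ℝ → ℝ} (hψ : IsTest ψ) {t : ℝ} (ht : 0 < t) :
    positionMean P X Y ψ t = dirMean P N K X Y 0 ψ t + dirMean P N K X Y 2 ψ t +
      (dirMean P N K X Y 1 ψ t + dirMean P N K X Y 3 ψ t) := by
  have h1 := h.integrable_comp hψ t 0
  simp only [add_zero] at h1
  have hU : (⋃ i, {ω | K (N t ω) ω = i}) = univ := by ext; simp
  rw [positionMean, ← setIntegral_univ, ← hU, integral_iUnion_fintype (h.measurableSet_dir ht) ?_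
    fun i => h1.integrableOn, Fin.sum_univ_four]
  · simp only [dirMean]; ring
  · intro i j hij
    exact Set.disjoint_left.2 fun ω h1 h2 => hij (h1.symm.trans h2)

/-- A kinetic system for the sums and differences of opposite directions, indexed by test
functions. -/
structure KineticSystem (c : ℝ) (lam : ℝ → ℝ) (A B E G : (ℝ × ℝ → ℝ) → ℝ → ℝ) : Prop where
  hasDerivAt_A : ∀ ψ, IsTest ψ → ∀ t, 0 < t → HasDerivAt (A ψ)
    (c * B (dirDeriv (1, 0) ψ) t - 2 / 3 * lam t * (A ψ t - E ψ t)) t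
  hasDerivAt_B : ∀ ψ, IsTest ψ → ∀ t, 0 < t → HasDerivAt (B ψ)
    (c * A (dirDeriv (1, 0) ψ) t - 4 / 3 * lam t * B ψ t) t
  hasDerivAt_E : ∀ ψ, IsTest ψ → ∀ t, 0 < t → HasDerivAt (E ψ)
    (c * G (dirDeriv (0, 1) ψ) t + 2 / 3 * lam t * (A ψ t - E ψ t)) t
  hasDerivAt_G : ∀ ψ, IsTest ψ → ∀ t, 0 < t → HasDerivAt (G ψ)
    (c * E (dirDeriv (0, 1) ψ) t - 4 / 3 * lam t * G ψ t) t

lemma IsReflectingMotion.kineticSystem [IsProbabilityMeasure P]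
    (h : IsReflectingMotion P c lam N K X Y) (hc : 0 < c) (hlam : ContinuousOn lam (Ioi 0))
    (hlam0 : ∀ t, 0 < t → 0 ≤ lam t) :
    KineticSystem c lam
      (fun ψ t => dirMean P N K X Y 0 ψ t + dirMean P N K X Y 2 ψ t)
      (fun ψ t => dirMean P N K X Y 0 ψ t - dirMean P N K X Y 2 ψ t)
      (fun ψ t => dirMean P N K X Y 1 ψ t + dirMean P N K X Y 3 ψ t)
      (fun ψ t => dirMean P N K X Y 1 ψ t - dirMean P N K X Y 3 ψ t) := by
  have hneg : ∀ (k : Fin 4) (v : ℝ × ℝ) (ψ : ℝ × ℝ → ℝ) t, dirMean P N K X Y k (dirDeriv (-v) ψ) t =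
      -dirMean P N K X Y k (dirDeriv v ψ) t := by
    intro k v ψ t
    rw [dirDeriv_neg]
    exact integral_neg _
  have hd := fun (ψ : ℝ × ℝ → ℝ) (hψ : IsTest ψ) (k : Fin 4) (t : ℝ) (ht : 0 < t) =>
    h.hasDerivAt_dirMean hc hlam hlam0 hψ k ht
  simp only [kineticRate, transition_sum] at hd
  refine ⟨fun ψ hψ t ht => ?_, fun ψ hψ t ht => ?_, fun ψ hψ t ht => ?_, fun ψ hψ t ht => ?_⟩
  · refine ((hd ψ hψ 0 t ht).add (hd ψ hψ 2 t ht)).congr_deriv ?_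
    rw [dir_zero, dir_two, hneg]; ring
  · refine ((hd ψ hψ 0 t ht).sub (hd ψ hψ 2 t ht)).congr_deriv ?_
    rw [dir_zero, dir_two, hneg]; ring
  · refine ((hd ψ hψ 1 t ht).add (hd ψ hψ 3 t ht)).congr_deriv ?_
    rw [dir_one, dir_three, hneg]; ring
  · refine ((hd ψ hψ 1 t ht).sub (hd ψ hψ 3 t ht)).congr_deriv ?_
    rw [dir_one, dir_three, hneg]; ring

lemma IsTest.contDiffAt_nat {ψ : ℝ × ℝ → ℝ} (h : IsTest ψ) (n : ℕ) (z : ℝ × ℝ) :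
    ContDiffAt ℝ n ψ z := (contDiff_infty.1 h.smooth n).contDiffAt

lemma timeOpFour_congr {u v : ℝ → ℝ} {t : ℝ} (h : u =ᶠ[𝓝 t] v) :
    timeOpFour lam u t = timeOpFour lam v t := by
  simp only [timeOpFour, h.iteratedDeriv_eq, h.deriv_eq]

lemma timeOpTwo_congr {u v : ℝ → ℝ} {t : ℝ} (h : u =ᶠ[𝓝 t] v) :
    timeOpTwo lam u t = timeOpTwo lam v t := by
  simp only [timeOpTwo, h.iteratedDeriv_eq, h.deriv_eq, h.eq_of_nhds]

lemma IsTest.dirDeriv_comm_two {ψ : ℝ × ℝ → ℝ} (h : IsTest ψ) (v w : ℝ × ℝ) :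
    OrthogonalMotion.dirDeriv w (OrthogonalMotion.dirDeriv w
      (OrthogonalMotion.dirDeriv v (OrthogonalMotion.dirDeriv v ψ))) =
    OrthogonalMotion.dirDeriv v (OrthogonalMotion.dirDeriv v
      (OrthogonalMotion.dirDeriv w (OrthogonalMotion.dirDeriv w ψ))) := by
  have hc : ∀ {χ : ℝ × ℝ → ℝ}, IsTest χ → OrthogonalMotion.dirDeriv w
      (OrthogonalMotion.dirDeriv v χ) = OrthogonalMotion.dirDeriv v
      (OrthogonalMotion.dirDeriv w χ) := fun hχ => by
    ext z
    exact OrthogonalMotion.dirDeriv_comm (hχ.contDiffAt_nat 2 z) _ _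
  rw [hc (h.dirDeriv v), hc h, hc ((h.dirDeriv w).dirDeriv v), hc (h.dirDeriv w)]

/-- Elimination in the kinetic system: the total mean satisfies the fourth-order equation. -/
theorem KineticSystem.equation {A B E G : (ℝ × ℝ → ℝ) → ℝ → ℝ} (S : KineticSystem c lam A B E G)
    (hlam : ContDiffOn ℝ 2 lam (Ioi 0)) {ψ : ℝ × ℝ → ℝ} (hψ : IsTest ψ) {t : ℝ} (ht : 0 < t) :
    ContDiffAt ℝ 4 (fun s => A ψ s + E ψ s) t ∧
    timeOpFour lam (fun s => A ψ s + E ψ s) t + c ^ 4 *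
      (A (dirDeriv (1, 0) (dirDeriv (1, 0) (dirDeriv (0, 1) (dirDeriv (0, 1) ψ)))) t +
        E (dirDeriv (1, 0) (dirDeriv (1, 0) (dirDeriv (0, 1) (dirDeriv (0, 1) ψ)))) t) =
    c ^ 2 * timeOpTwo lam (fun s => A (dirDeriv (1, 0) (dirDeriv (1, 0) ψ)) s +
      E (dirDeriv (1, 0) (dirDeriv (1, 0) ψ)) s + (A (dirDeriv (0, 1) (dirDeriv (0, 1) ψ)) s +
      E (dirDeriv (0, 1) (dirDeriv (0, 1) ψ)) s)) t := by
  set ψx := dirDeriv (1, 0) ψ with hψx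
  set ψy := dirDeriv (0, 1) ψ with hψy
  set ψxx := dirDeriv (1, 0) ψx with hψxx
  set ψyy := dirDeriv (0, 1) ψy with hψyy
  have tx : IsTest ψx := hψ.dirDeriv _
  have ty : IsTest ψy := hψ.dirDeriv _
  have txx : IsTest ψxx := tx.dirDeriv _
  have tyy : IsTest ψyy := ty.dirDeriv _
  set ψxxx := dirDeriv (1, 0) ψxx with hψxxx
  set ψyyy := dirDeriv (0, 1) ψyy with hψyyy
  set ψxyy := dirDeriv (1, 0) ψyy with hψxyy
  set ψyxx := dirDeriv (0, 1) ψxx with hψyxx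
  have txxx : IsTest ψxxx := txx.dirDeriv _
  have tyyy : IsTest ψyyy := tyy.dirDeriv _
  have txyy : IsTest ψxyy := tyy.dirDeriv _
  have tyxx : IsTest ψyxx := txx.dirDeriv _
  set ψ4x := dirDeriv (1, 0) ψxxx with hψ4x
  set ψ4y := dirDeriv (0, 1) ψyyy with hψ4y
  set ψxxyy := dirDeriv (1, 0) ψxyy with hψxxyy
  -- Identifies the two mixed fourth derivatives produced by the `x` and `y` branches, so that they
  -- meet in the term with `c ^ 4`.
  have hcomm : dirDeriv (0, 1) ψyxx = ψxxyy := hψ.dirDeriv_comm_two (1, 0) (0, 1)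
  have t4x : IsTest ψ4x := txxx.dirDeriv _
  have t4y : IsTest ψ4y := tyyy.dirDeriv _
  have txxyy : IsTest ψxxyy := txyy.dirDeriv _
  let l1 := iteratedDeriv 1 lam
  let l2 := iteratedDeriv 2 lam
  have hl0 : ∀ t, 0 < t → HasDerivAt lam (l1 t) t := fun t ht => by
    have := hasDerivAt_of_contDiffOn isOpen_Ioi hlam 0 (by norm_num) t ht
    rwa [iteratedDeriv_zero] at this
  have hl1 : ∀ t, 0 < t → HasDerivAt l1 (l2 t) t := fun t ht =>
    hasDerivAt_of_contDiffOn isOpen_Ioi hlam 1 (by norm_num) t ht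
  have hl2 : ContinuousOn l2 (Ioi 0) := continuousOn_iteratedDeriv_of_contDiffOn isOpen_Ioi hlam
  -- `f1`, …, `f4` are the successive derivatives of `A ψ + E ψ`. Switching conserves mass, so `lam`
  -- is absent from `f1`; it enters twice differentiated only in `f4`, whose continuity is where
  -- `C²` regularity of `lam` is used.
  let f1 : ℝ → ℝ := fun t => c * (B ψx t + G ψy t)
  let f2 : ℝ → ℝ := fun t => c ^ 2 * (A ψxx t + E ψyy t) - 4 / 3 * (lam t * f1 t)
  let f3 : ℝ → ℝ := fun t => c ^ 2 * (c * (B ψxxx t + G ψyyy t) +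
    2 / 3 * (lam t * (A ψyy t - E ψyy t - (A ψxx t - E ψxx t)))) -
    4 / 3 * (l1 t * f1 t + lam t * f2 t)
  let f4 : ℝ → ℝ := fun t => c ^ 2 * (c * ((c * A ψ4x t - 4 / 3 * lam t * B ψxxx t) +
      (c * E ψ4y t - 4 / 3 * lam t * G ψyyy t)) +
    2 / 3 * (l1 t * (A ψyy t - E ψyy t - (A ψxx t - E ψxx t)) +
      lam t * (c * B ψxyy t - c * G ψyyy t - 4 / 3 * lam t * (A ψyy t - E ψyy t) -
        (c * B ψxxx t - c * G ψyxx t - 4 / 3 * lam t * (A ψxx t - E ψxx t))))) -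
    4 / 3 * (l2 t * f1 t + l1 t * f2 t + (l1 t * f2 t + lam t * f3 t))
  have d0 : ∀ t, 0 < t → HasDerivAt (fun s => A ψ s + E ψ s) (f1 t) t := fun t ht =>
    ((S.hasDerivAt_A ψ hψ t ht).add (S.hasDerivAt_E ψ hψ t ht)).congr_deriv (by
      simp only [f1, ← hψx, ← hψy]; ring)
  have d1 : ∀ t, 0 < t → HasDerivAt f1 (f2 t) t := fun t ht =>
    (((S.hasDerivAt_B ψx tx t ht).add (S.hasDerivAt_G ψy ty t ht)).const_mul c).congr_deriv (by
      simp only [f2, f1, ← hψxx, ← hψyy]; ring)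
  have d2 : ∀ t, 0 < t → HasDerivAt f2 (f3 t) t := fun t ht =>
    ((((S.hasDerivAt_A ψxx txx t ht).add (S.hasDerivAt_E ψyy tyy t ht)).const_mul (c ^ 2)).sub
      (((hl0 t ht).mul (d1 t ht)).const_mul (4 / 3))).congr_deriv (by
      simp only [f3, ← hψxxx, ← hψyyy]; ring)
  have d3 : ∀ t, 0 < t → HasDerivAt f3 (f4 t) t := fun t ht =>
    ((((((S.hasDerivAt_B ψxxx txxx t ht).add (S.hasDerivAt_G ψyyy tyyy t ht)).const_mul c).add
      (((hl0 t ht).mul (((S.hasDerivAt_A ψyy tyy t ht).sub (S.hasDerivAt_E ψyy tyy t ht)).sub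
        ((S.hasDerivAt_A ψxx txx t ht).sub (S.hasDerivAt_E ψxx txx t ht)))).const_mul
          (2 / 3))).const_mul (c ^ 2)).sub
      ((((hl1 t ht).mul (d1 t ht)).add ((hl0 t ht).mul (d2 t ht))).const_mul (4 / 3))).congr_deriv
      (by
      simp only [f4, ← hψ4x, ← hψ4y, ← hψxxx, ← hψyyy, ← hψxyy, ← hψyxx]
      simp only [Pi.sub_apply]
      ring)
  have cA : ∀ χ, IsTest χ → ContinuousOn (A χ) (Ioi 0) := fun χ hχ t ht =>
    (S.hasDerivAt_A χ hχ t ht).continuousAt.continuousWithinAt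
  have cB : ∀ χ, IsTest χ → ContinuousOn (B χ) (Ioi 0) := fun χ hχ t ht =>
    (S.hasDerivAt_B χ hχ t ht).continuousAt.continuousWithinAt
  have cE : ∀ χ, IsTest χ → ContinuousOn (E χ) (Ioi 0) := fun χ hχ t ht =>
    (S.hasDerivAt_E χ hχ t ht).continuousAt.continuousWithinAt
  have cG : ∀ χ, IsTest χ → ContinuousOn (G χ) (Ioi 0) := fun χ hχ t ht =>
    (S.hasDerivAt_G χ hχ t ht).continuousAt.continuousWithinAt
  have cl0 : ContinuousOn lam (Ioi 0) := hlam.continuousOn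
  have cl1 : ContinuousOn l1 (Ioi 0) := fun t ht => (hl1 t ht).continuousAt.continuousWithinAt
  have c1 : ContinuousOn f1 (Ioi 0) := fun t ht => (d1 t ht).continuousAt.continuousWithinAt
  have c2 : ContinuousOn f2 (Ioi 0) := fun t ht => (d2 t ht).continuousAt.continuousWithinAt
  have c3 : ContinuousOn f3 (Ioi 0) := fun t ht => (d3 t ht).continuousAt.continuousWithinAt
  have c4 : ContinuousOn f4 (Ioi 0) := by
    have := cA _ t4x; have := cA _ txx; have := cA _ tyy
    have := cB _ txxx; have := cB _ txyy
    have := cE _ t4y; have := cE _ txx; have := cE _ tyy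
    have := cG _ tyyy; have := cG _ tyxx
    fun_prop
  -- The same chain for the Laplacian of `ψ`, needed up to order two on the right-hand side.
  let w1 : ℝ → ℝ := fun t => c * (B ψxxx t + G ψyxx t + (B ψxyy t + G ψyyy t))
  let w2 : ℝ → ℝ := fun t => c ^ 2 * (A ψ4x t + E ψxxyy t + (A ψxxyy t + E ψ4y t)) -
    4 / 3 * (lam t * w1 t)
  have e0 : ∀ t, 0 < t → HasDerivAt (fun s => A ψxx s + E ψxx s + (A ψyy s + E ψyy s)) (w1 t) t :=
    fun t ht => (((S.hasDerivAt_A ψxx txx t ht).add (S.hasDerivAt_E ψxx txx t ht)).add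
      ((S.hasDerivAt_A ψyy tyy t ht).add (S.hasDerivAt_E ψyy tyy t ht))).congr_deriv (by
        simp only [w1, ← hψxxx, ← hψyyy, ← hψxyy, ← hψyxx]; ring)
  have e1 : ∀ t, 0 < t → HasDerivAt w1 (w2 t) t := fun t ht =>
    ((((S.hasDerivAt_B ψxxx txxx t ht).add (S.hasDerivAt_G ψyxx tyxx t ht)).add
      ((S.hasDerivAt_B ψxyy txyy t ht).add (S.hasDerivAt_G ψyyy tyyy t ht))).const_mul
        c).congr_deriv (by
        simp only [w2, w1, ← hψ4x, ← hψ4y, ← hψxxyy, hcomm]; ring)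
  let f : ℕ → ℝ → ℝ := fun j => match j with
    | 0 => fun s => A ψ s + E ψ s
    | 1 => f1
    | 2 => f2
    | 3 => f3
    | _ => f4
  let w : ℕ → ℝ → ℝ := fun j => match j with
    | 0 => fun s => A ψxx s + E ψxx s + (A ψyy s + E ψyy s)
    | 1 => w1
    | _ => w2
  have hf : ∀ j < 4, ∀ t ∈ Ioi (0 : ℝ), HasDerivAt (f j) (f (j + 1) t) t := by
    intro j hj t ht
    match j, hj with
    | 0, _ => exact d0 t ht
    | 1, _ => exact d1 t ht
    | 2, _ => exact d2 t ht
    | 3, _ => exact d3 t ht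
  have hw : ∀ j < 2, ∀ t ∈ Ioi (0 : ℝ), HasDerivAt (w j) (w (j + 1) t) t := by
    intro j hj t ht
    match j, hj with
    | 0, _ => exact e0 t ht
    | 1, _ => exact e1 t ht
  have hf4 : ContDiffOn ℝ 4 (fun s => A ψ s + E ψ s) (Ioi 0) :=
    contDiffOn_of_hasDerivAt (n := 4) isOpen_Ioi hf c4
  refine ⟨hf4.contDiffAt (Ioi_mem_nhds ht), ?_⟩
  have i4 := iteratedDeriv_eq_of_hasDerivAt isOpen_Ioi hf 4 (by norm_num) t ht
  have i3 := iteratedDeriv_eq_of_hasDerivAt isOpen_Ioi hf 3 (by norm_num) t ht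
  have i2 := iteratedDeriv_eq_of_hasDerivAt isOpen_Ioi hf 2 (by norm_num) t ht
  have j2 := iteratedDeriv_eq_of_hasDerivAt isOpen_Ioi hw 2 (by norm_num) t ht
  simp only [f] at i4 i3 i2
  simp only [w] at j2
  rw [timeOpFour, timeOpTwo, i4, i3, i2, j2, (d0 t ht).deriv, (e0 t ht).deriv, (hl0 t ht).deriv,
    show iteratedDeriv 2 lam t = l2 t from rfl]
  -- What remains is a polynomial identity in `c`, `lam`, its derivatives and the values of `A`,
  -- `B`, `E`, `G`; the coefficients of the equation are exactly those that make it hold.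
  simp only [f4, f3, f2, f1, w2, w1]
  ring

/-- The expectations of test functions satisfy the fourth-order equation. -/
theorem IsReflectingMotion.equation [IsProbabilityMeasure P]
    (h : IsReflectingMotion P c lam N K X Y) (hc : 0 < c) (hlam : ContDiffOn ℝ 2 lam (Ioi 0))
    (hlam0 : ∀ t, 0 < t → 0 ≤ lam t) {φ : ℝ → ℝ → ℝ} (hφ : IsTest fun z => φ z.1 z.2) {t : ℝ}
    (ht : 0 < t) :
    ContDiffAt ℝ 4 (positionMean P X Y fun z => φ z.1 z.2) t ∧
    timeOpFour lam (positionMean P X Y fun z => φ z.1 z.2) t +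
      c ^ 4 * positionMean P X Y (fun z => dxxyy φ z.1 z.2) t =
    c ^ 2 * timeOpTwo lam (positionMean P X Y fun z => laplacian φ z.1 z.2) t := by
  have hS := (h.kineticSystem hc hlam.continuousOn hlam0).equation hlam hφ ht
  have hev : ∀ {ψ : ℝ × ℝ → ℝ}, IsTest ψ → positionMean P X Y ψ =ᶠ[𝓝 t] fun s =>
      dirMean P N K X Y 0 ψ s + dirMean P N K X Y 2 ψ s +
      (dirMean P N K X Y 1 ψ s + dirMean P N K X Y 3 ψ s) := fun hψ => by
    filter_upwards [Ioi_mem_nhds ht] with s hs using h.positionMean_eq_sum hψ hs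
  have hd : (fun z : ℝ × ℝ => dxxyy φ z.1 z.2) = dirDeriv (1, 0) (dirDeriv (1, 0) (dirDeriv (0, 1)
      (dirDeriv (0, 1) fun z : ℝ × ℝ => φ z.1 z.2))) := by
    ext z
    exact dxxyy_eq_dirDeriv (hφ.contDiffAt_nat 4 z)
  have hl : (fun z : ℝ × ℝ => laplacian φ z.1 z.2) = fun z =>
      dirDeriv (1, 0) (dirDeriv (1, 0) fun z : ℝ × ℝ => φ z.1 z.2) z +
      dirDeriv (0, 1) (dirDeriv (0, 1) fun z : ℝ × ℝ => φ z.1 z.2) z := by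
    ext z
    exact laplacian_eq_dirDeriv (hφ.contDiffAt_nat 2 z)
  have hxx : IsTest (dirDeriv (1, 0) (dirDeriv (1, 0) fun z : ℝ × ℝ => φ z.1 z.2)) :=
    (hφ.dirDeriv _).dirDeriv _
  have hyy : IsTest (dirDeriv (0, 1) (dirDeriv (0, 1) fun z : ℝ × ℝ => φ z.1 z.2)) :=
    (hφ.dirDeriv _).dirDeriv _
  have hsum : positionMean P X Y (fun z => laplacian φ z.1 z.2) = fun s =>
      positionMean P X Y (dirDeriv (1, 0) (dirDeriv (1, 0) fun z : ℝ × ℝ => φ z.1 z.2)) s +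
      positionMean P X Y (dirDeriv (0, 1) (dirDeriv (0, 1) fun z : ℝ × ℝ => φ z.1 z.2)) s := by
    rw [hl]
    ext s
    have h1 := h.integrable_comp hxx s 0
    have h2 := h.integrable_comp hyy s 0
    simp only [add_zero] at h1 h2
    exact integral_add h1 h2
  have hevl := (hev hxx).add (hev hyy)
  refine ⟨hS.1.congr_of_eventuallyEq (hev hφ), ?_⟩
  rw [hd, hsum]
  rw [timeOpFour_congr (hev hφ), (hev ((hyy.dirDeriv (1, 0)).dirDeriv (1, 0))).eq_of_nhds,
    hS.2]
  exact congrArg _ (timeOpTwo_congr hevl.symm)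

end Equation
-- Absolute continuity from two switching times.
section AbsoluteContinuity

open Filter Topology

variable {Ω : Type*} {mΩ : MeasurableSpace Ω} {P : Measure Ω}
variable {lam : ℝ → ℝ} {N : ℝ → Ω → ℤ} {K : ℤ → Ω → Fin 4} {c : ℝ} {X Y : ℝ → Ω → ℝ}

lemma map_prodMk_restrict_of_indep {Ω : Type*} {m₁ m₂ mΩ : MeasurableSpace Ω} {P : Measure Ω}
    [IsProbabilityMeasure P]
    (h₁ : m₁ ≤ mΩ) (h₂ : m₂ ≤ mΩ) (h : Indep m₁ m₂ P) {α β : Type*} [MeasurableSpace α]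
    [MeasurableSpace β] {U : Ω → α} {V : Ω → β} (hU : Measurable[m₁] U) (hV : Measurable[m₂] V)
    {A e : Set Ω} (hA : MeasurableSet[m₁] A) (he : MeasurableSet[m₂] e) :
    (P.restrict (A ∩ e)).map (fun ω => (U ω, V ω)) =
      ((P.restrict A).map U).prod ((P.restrict e).map V) := by
  have hU' : Measurable[mΩ] U := hU.mono h₁ le_rfl
  have hV' : Measurable[mΩ] V := hV.mono h₂ le_rfl
  refine (Measure.prod_eq fun s t hs ht => ?_).symm
  rw [Measure.map_apply (hU'.prodMk hV') (hs.prod ht), Measure.map_apply hU' hs,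
    Measure.map_apply hV' ht, Measure.restrict_apply (hU' hs), Measure.restrict_apply (hV' ht),
    Measure.restrict_apply ((hU'.prodMk hV') (hs.prod ht)), ← (Indep_iff _ _ _).1 h]
  · congr 1
    ext ω
    simp only [mem_inter_iff, mem_preimage, mem_prod]
    tauto
  · exact (hU hs).inter hA
  · exact (hV ht).inter he

/-- Time spent in `(a, b]` before the first event after `a`. -/
noncomputable def waitingTime (N : ℝ → Ω → ℤ) (a b : ℝ) (ω : Ω) : ℝ :=
  ∫ s in a..b, if N s ω - N a ω = 0 then 1 else 0

lemma intervalIntegrable_waiting (hN : IsPoissonCounting P lam N) (ω : Ω) (a : ℝ) {x y : ℝ}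
    (hx : 0 ≤ x) (hxy : x ≤ y) :
    IntervalIntegrable (fun s => if N s ω - N a ω = 0 then (1 : ℝ) else 0) volume x y :=
  intervalIntegrable_comp_counting hN ω hx hxy
    (F := fun n => if n - N a ω = 0 then (1 : ℝ) else 0) (C := 1) fun n => by
      split_ifs <;> simp

lemma measurable_waitingTime (hN : IsPoissonCounting P lam N) {a b : ℝ} (ha : 0 < a) (hab : a ≤ b) :
    Measurable[incrementAlgebra N (Icc a b)] (waitingTime N a b) := by
  refine measurable_intervalIntegral_of_rightContinuous _ hab (fun s hs => ?_) fun ω s hs =>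
    continuousWithinAt_comp_counting hN ω (ha.trans hs.1) (fun n => if n - N a ω = 0 then 1 else 0)
  exact (measurable_of_countable (fun n : ℤ => if n = 0 then (1 : ℝ) else 0)).comp
    (measurable_sub_incrementAlgebra N (T := Icc a b) ⟨hs.1.le, hs.2⟩ ⟨le_rfl, hab⟩)

lemma waitingTime_add (hN : IsPoissonCounting P lam N) {a b r : ℝ} (ha : 0 < a) (hr : 0 ≤ r)
    (hrb : a + r ≤ b) (ω : Ω) : waitingTime N a b ω = waitingTime N a (a + r) ω +
      ∫ s in (a + r)..b, if N s ω - N a ω = 0 then 1 else 0 :=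
  (intervalIntegral.integral_add_adjacent_intervals
    (intervalIntegrable_waiting hN ω a ha.le (by linarith))
    (intervalIntegrable_waiting hN ω a (by linarith) hrb)).symm

lemma waitingTime_nonneg {a b : ℝ} (hab : a ≤ b) (ω : Ω) : 0 ≤ waitingTime N a b ω :=
  intervalIntegral.integral_nonneg hab fun s _ => by split_ifs <;> simp

lemma waitingTime_le (hN : IsPoissonCounting P lam N) {a b : ℝ} (ha : 0 < a) (hab : a ≤ b) (ω : Ω) :
    waitingTime N a b ω ≤ b - a := by
  have := intervalIntegral.integral_mono_on hab
    (intervalIntegrable_waiting hN ω a ha.le hab) (intervalIntegrable_const (c := (1 : ℝ)))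
    fun s _ => by split_ifs <;> simp
  simpa [waitingTime] using this

lemma waitingTime_of_eq (hN : IsPoissonCounting P lam N) {a b : ℝ} (ha : 0 < a) (hab : a ≤ b)
    {ω : Ω} (h : N b ω = N a ω) : waitingTime N a b ω = b - a := by
  have : ∀ s ∈ uIcc a b, (if N s ω - N a ω = 0 then (1 : ℝ) else 0) = 1 := by
    intro s hs
    rw [uIcc_of_le hab] at hs
    have h1 := counting_mono hN ω ha hs.1
    have h2 := counting_mono hN ω (ha.trans_le hs.1) hs.2
    rw [if_pos (by omega)]
  rw [waitingTime, intervalIntegral.integral_congr this]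
  simp

/-- When `(a, b]` contains a single event, it happens at `a` plus the waiting time, so the bound by
`r` locates it in `(a, a + r]`. The endpoint `a + r = b` is separate because there is no room to its
right. -/
lemma waitingTime_le_iff (hN : IsPoissonCounting P lam N) {a b r : ℝ} (ha : 0 < a) (hr : 0 ≤ r)
    (hrb : a + r ≤ b) {ω : Ω} (h : N b ω - N a ω = 1) :
    waitingTime N a b ω ≤ r ↔ N (a + r) ω - N a ω = 1 ∧ N b ω - N (a + r) ω = 0 ∨ a + r = b := by
  have h1 := counting_mono hN ω ha (show a ≤ a + r by linarith)
  have h2 := counting_mono hN ω (show 0 < a + r by linarith) hrb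
  constructor
  · intro hle
    by_contra! hcon
    obtain ⟨hc1, hc2⟩ := hcon
    have h3 : N (a + r) ω = N a ω := by
      by_contra h4
      exact hc1 (by omega) (by omega)
    have hlt : a + r < b := lt_of_le_of_ne hrb hc2
    -- If nothing has happened by time `a + r`, right continuity leaves a further event-free
    -- stretch, so the waiting time strictly exceeds `r`.
    have h5 := eventually_eq_of_rightContinuous hN ω (show 0 < a + r by linarith)
    obtain ⟨u, hu, hu'⟩ := mem_nhdsGE_iff_exists_Icc_subset.1 h5
    have hv : a + r < min u b := lt_min hu hlt
    have h6 : N (min u b) ω = N a ω := (hu' ⟨hv.le, min_le_left _ _⟩ : _ = _).trans h3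
    have h7 : a + (min u b - a) ≤ b := by linarith [min_le_right u b]
    have h8 := waitingTime_add hN ha (show 0 ≤ min u b - a by linarith) h7 ω
    have h9 := waitingTime_of_eq hN ha (show a ≤ min u b by linarith) h6
    have h10 : 0 ≤ ∫ s in (a + (min u b - a))..b, if N s ω - N a ω = 0 then (1 : ℝ) else 0 :=
      intervalIntegral.integral_nonneg h7 fun s _ => by split_ifs <;> simp
    rw [show a + (min u b - a) = min u b by ring] at h8 h10
    linarith
  · rintro (⟨h3, h4⟩ | h3)
    · rw [waitingTime_add hN ha hr hrb]
      have h5 : ∀ s ∈ uIcc (a + r) b, (if N s ω - N a ω = 0 then (1 : ℝ) else 0) = 0 := by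
        intro s hs
        rw [uIcc_of_le hrb] at hs
        have h6 := counting_mono hN ω (show 0 < a + r by linarith) hs.1
        rw [if_neg (by omega)]
      rw [intervalIntegral.integral_congr h5, intervalIntegral.integral_zero, add_zero]
      have := waitingTime_le hN ha (show a ≤ a + r by linarith) ω
      linarith
    · have := waitingTime_le hN ha (show a ≤ b by linarith) ω
      linarith

/-- One event in `(a, a + r]` and none in `(a + r, b]` are independent; their exponential factors
combine into that of `(a, b]`. -/
lemma measureReal_waitingTime_le [IsProbabilityMeasure P] (hN : IsPoissonCounting P lam N)
    (hlam : ContinuousOn lam (Ioi 0)) (hlam0 : ∀ t, 0 < t → 0 ≤ lam t) {a b r : ℝ} (ha : 0 < a)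
    (hr : 0 ≤ r) (hrb : a + r ≤ b) :
    P.real ({ω | N b ω - N a ω = 1} ∩ {ω | waitingTime N a b ω ≤ r}) =
      Real.exp (-∫ u in a..b, lam u) * ∫ u in a..(a + r), lam u := by
  have har : 0 < a + r := by linarith
  have hset : {ω | N b ω - N a ω = 1} ∩ {ω | waitingTime N a b ω ≤ r} =
      {ω | N (a + r) ω - N a ω = 1} ∩ {ω | N b ω - N (a + r) ω = 0} := by
    ext ω
    simp only [mem_inter_iff, mem_ofPred_eq]
    constructor
    · rintro ⟨h1, h2⟩
      rcases (waitingTime_le_iff hN ha hr hrb h1).1 h2 with h3 | h3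
      · exact h3
      · rw [h3]; exact ⟨h1, sub_self _⟩
    · rintro ⟨h1, h2⟩
      have h3 : N b ω - N a ω = 1 := by omega
      exact ⟨h3, (waitingTime_le_iff hN ha hr hrb h3).2 (Or.inl ⟨h1, h2⟩)⟩
  have hind : IndepFun (fun ω => N (a + r) ω - N a ω) (fun ω => N b ω - N (a + r) ω) P :=
    hN.indep_increments.indepFun_sub_sub (r := ⟨a, ha⟩) (s := ⟨a + r, har⟩)
      (t := ⟨b, har.trans_le hrb⟩) (Subtype.mk_le_mk.2 (by linarith)) (Subtype.mk_le_mk.2 hrb)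
  have h1 := hind.measure_inter_preimage_eq_mul {1} {0} (measurableSet_singleton _)
    (measurableSet_singleton _)
  have h2 := congrArg ENNReal.toReal h1
  rw [ENNReal.toReal_mul] at h2
  rw [hset]
  refine h2.trans ?_
  have e1 := measureReal_increment_eq_one hN hlam0 ha (show a ≤ a + r by linarith)
  have e2 := measureReal_increment_eq_zero hN hlam0 har hrb
  have e3 := intervalIntegral.integral_add_adjacent_intervals
    (intervalIntegrable_rate hlam ha har) (intervalIntegrable_rate hlam har (har.trans_le hrb))
  refine (congrArg₂ (· * ·) e1 e2).trans ?_
  rw [← e3, neg_add, Real.exp_add]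
  ring

/-- On the event that there is exactly one event in `(a, b]`, the law of the waiting time is
absolutely continuous. -/
lemma map_waitingTime_absolutelyContinuous [IsProbabilityMeasure P] (hN : IsPoissonCounting P lam N)
    (hlam : ContinuousOn lam (Ioi 0)) (hlam0 : ∀ t, 0 < t → 0 ≤ lam t) {a b : ℝ} (ha : 0 < a)
    (hab : a ≤ b) :
    (P.restrict {ω | N b ω - N a ω = 1}).map (waitingTime N a b) ≪ volume := by
  let κ := Real.exp (-∫ u in a..b, lam u)
  -- The density is the derivative in `r` of the distribution function `e^{-∫_a^b λ} ∫_a^{a+r} λ`.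
  let ρ : Measure ℝ := (volume.restrict (Ioc 0 (b - a))).withDensity
    (fun u => ENNReal.ofReal (κ * lam (a + u)))
  have hW : Measurable (waitingTime N a b) := (measurable_waitingTime hN ha hab).mono
    ((incrementAlgebra_le_countingAlgebra N fun x hx => ha.trans_le hx.1).trans
      (countingAlgebra_le hN)) le_rfl
  have key : (P.restrict {ω | N b ω - N a ω = 1}).map (waitingTime N a b) = ρ := by
    refine Measure.ext_of_Iic _ _ fun r => ?_
    rw [Measure.map_apply hW measurableSet_Iic, Measure.restrict_apply (hW measurableSet_Iic),
      withDensity_apply _ measurableSet_Iic, Measure.restrict_restrict measurableSet_Iic]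
    have hI : Iic r ∩ Ioc 0 (b - a) = Ioc 0 (min r (b - a)) := by
      ext x; simp only [mem_inter_iff, mem_Iic, mem_Ioc, le_min_iff]; tauto
    rw [hI]
    rcases lt_or_ge r 0 with hr | hr
    · have h1 : waitingTime N a b ⁻¹' Iic r = ∅ := by
        ext ω
        have := waitingTime_nonneg (N := N) hab ω
        simp only [mem_preimage, mem_Iic, mem_empty_iff_false, iff_false]
        linarith
      rw [h1, Ioc_eq_empty (by simp only [lt_min_iff]; intro h; linarith [h.1])]
      simp
    · set m := min r (b - a) with hm
      have hm0 : 0 ≤ m := le_min hr (by linarith)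
      have hmb : a + m ≤ b := by have := min_le_right r (b - a); linarith
      have h1 : waitingTime N a b ⁻¹' Iic r ∩ {ω | N b ω - N a ω = 1} =
          {ω | N b ω - N a ω = 1} ∩ {ω | waitingTime N a b ω ≤ m} := by
        ext ω
        have := waitingTime_le hN ha hab ω
        simp only [mem_preimage, mem_Iic, mem_inter_iff, mem_ofPred_eq, hm, le_min_iff]
        tauto
      have hci : IntervalIntegrable (fun u => lam (a + u)) volume 0 m := by
        have := (intervalIntegrable_rate hlam ha (show 0 < a + m by linarith)).comp_add_left a
        simpa using this
      rw [h1, ← ofReal_measureReal, measureReal_waitingTime_le hN hlam hlam0 ha hm0 hmb,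
        ← ofReal_integral_eq_lintegral_ofReal, integral_const_mul,
        ← intervalIntegral.integral_of_le hm0, intervalIntegral.integral_comp_add_left, add_zero]
      · exact ((intervalIntegrable_iff_integrableOn_Ioc_of_le hm0).1 hci).const_mul κ
      · refine (ae_restrict_mem measurableSet_Ioc).mono fun u hu => ?_
        exact mul_nonneg (Real.exp_pos _).le (hlam0 _ (by linarith [hu.1]))
  rw [key]
  exact (withDensity_absolutelyContinuous _ _).trans
    (Measure.absolutelyContinuous_of_le Measure.restrict_le_self)

/-- The cross product of consecutive differences of three distinct directions does not vanish. -/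
lemma cross_ne_zero {i j l : Fin 4} (hij : i ≠ j) (hjl : j ≠ l) (hil : i ≠ l) :
    (dirX i - dirX j) * (dirY j - dirY l) - (dirX j - dirX l) * (dirY i - dirY j) ≠ 0 := by
  fin_cases i <;> fin_cases j <;> first | exact absurd rfl hij | skip
  all_goals fin_cases l <;> first | exact absurd rfl hjl | exact absurd rfl hil | skip
  all_goals simp [dirX_zero, dirX_one, dirX_two, dirX_three, dirY_zero, dirY_one, dirY_two,
    dirY_three]
  all_goals norm_num

/-- An invertible linear map pulls null sets back to null sets, and translation is harmless.
Injectivity is Cramer's rule. -/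
lemma volume_preimage_affine_eq_zero {v w : ℝ × ℝ} (h : v.1 * w.2 - w.1 * v.2 ≠ 0) (z : ℝ × ℝ)
    {B : Set (ℝ × ℝ)} (hB : volume B = 0) :
    volume {q : ℝ × ℝ | z + q.1 • w + q.2 • v ∈ B} = 0 := by
  let f : ℝ × ℝ →ₗ[ℝ] ℝ × ℝ :=
    (LinearMap.fst ℝ ℝ ℝ).smulRight w + (LinearMap.snd ℝ ℝ ℝ).smulRight v
  have hf : Function.Injective f := by
    rw [injective_iff_map_eq_zero]
    rintro ⟨x, y⟩ hxy
    have h1 : x * w.1 + y * v.1 = 0 := by simpa [f] using congrArg Prod.fst hxy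
    have h2 : x * w.2 + y * v.2 = 0 := by simpa [f] using congrArg Prod.snd hxy
    have hx : x * (v.1 * w.2 - w.1 * v.2) = 0 := by linear_combination v.1 * h2 - v.2 * h1
    have hy : y * (v.1 * w.2 - w.1 * v.2) = 0 := by linear_combination w.2 * h1 - w.1 * h2
    have hx' := (mul_eq_zero.1 hx).resolve_right h
    have hy' := (mul_eq_zero.1 hy).resolve_right h
    simp [hx', hy']
  have hdet : LinearMap.det f ≠ 0 :=
    (LinearEquiv.isUnit_det' (LinearEquiv.ofInjectiveEndo f hf)).ne_zero
  have hset : {q : ℝ × ℝ | z + q.1 • w + q.2 • v ∈ B} = f ⁻¹' ((fun u => z + u) ⁻¹' B) := by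
    ext q
    simp [f, add_assoc]
  rw [hset, Measure.addHaar_preimage_linearMap _ hdet, measure_preimage_add, hB, mul_zero]

/-- Two successive events, each alone in its interval, with three distinct directions. -/
def switchEvent (N : ℝ → Ω → ℤ) (K : ℤ → Ω → Fin 4) (a b e : ℝ) (i j l : Fin 4) : Set Ω :=
  {ω | (N b ω - N a ω = 1 ∧ N e ω - N b ω = 1) ∧
    K (N a ω) ω = i ∧ K (N a ω + 1) ω = j ∧ K (N a ω + 2) ω = l}

lemma displacement_of_one (hN : IsPoissonCounting P lam N) (d : Fin 4 → ℝ) {ω : Ω}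
    {a b : ℝ} (ha : 0 < a) (hab : a ≤ b) (h : N b ω - N a ω = 1) :
    displacement N K d a b ω = waitingTime N a b ω * (d (K (N a ω) ω) - d (K (N a ω + 1) ω)) +
      (b - a) * d (K (N a ω + 1) ω) := by
  have h1 : ∀ s ∈ uIcc a b, d (K (N s ω) ω) = (if N s ω - N a ω = 0 then (1 : ℝ) else 0) *
      (d (K (N a ω) ω) - d (K (N a ω + 1) ω)) + d (K (N a ω + 1) ω) := by
    intro s hs
    rw [uIcc_of_le hab] at hs
    have h1 := counting_mono hN ω ha hs.1
    have h2 := counting_mono hN ω (ha.trans_le hs.1) hs.2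
    rcases (show N s ω = N a ω ∨ N s ω = N a ω + 1 by omega) with h3 | h3 <;> simp [h3]
  rw [displacement, intervalIntegral.integral_congr h1, intervalIntegral.integral_add
    ((intervalIntegrable_waiting hN ω a ha.le hab).mul_const _) intervalIntegrable_const,
    intervalIntegral.integral_mul_const]
  simp [waitingTime]

/-- The velocity term after time `e`, when exactly two events occur in `(a, e]`. -/
noncomputable def displacementAfter (N : ℝ → Ω → ℤ) (K : ℤ → Ω → Fin 4) (d : Fin 4 → ℝ) (a e t : ℝ)
    (ω : Ω) : ℝ := ∫ s in e..t, d (shiftDir N K a (2 + (N s ω - N e ω)) ω)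

/-- On the switching event the position equals `Z + k + R₂ • w + R₁ • v`, where `Z`, `R₂`, `R₁` have
a product law on the event of one count in each interval and the waiting times have absolutely
continuous laws. Since `v` and `w` are linearly independent, for each fixed `Z` the pairs of waiting
times leading into `B` form a null set, and Fubini concludes. -/
lemma measure_switchEvent_inter_eq_zero [IsProbabilityMeasure P]
    (h : IsReflectingMotion P c lam N K X Y) (hc : 0 < c)
    (hlam : ContinuousOn lam (Ioi 0)) (hlam0 : ∀ t, 0 < t → 0 ≤ lam t) {a b e t : ℝ} (ha : 0 < a)
    (hab : a ≤ b) (hbe : b ≤ e) (het : e ≤ t) {i j l : Fin 4} (hij : i ≠ j) (hjl : j ≠ l)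
    (hil : i ≠ l) {B : Set (ℝ × ℝ)} (hBm : MeasurableSet B) (hB : volume B = 0) :
    P (switchEvent N K a b e i j l ∩ {ω | (X t ω, Y t ω) ∈ B}) = 0 := by
  have hN := h.poisson
  have hb : 0 < b := ha.trans_le hab
  have he : 0 < e := hb.trans_le hbe
  have ht : 0 < t := he.trans_le het
  set K' := shiftDir N K a with hK'def
  have hK' : IsReflectingDirectionSequence P K' :=
    isReflectingDirectionSequence_shiftDir hN h.directions h.indep ha
  have hind : Indep (dirAlgebra K') (countingAlgebra N) P :=
    indep_shiftDir hN h.directions h.indep ha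
  -- Displacement before `a` and after `e`. The later part numbers directions as if exactly two
  -- events fell in `(a, e]`; this agrees with the true one on the event considered and is
  -- independent of the counts inside.
  let Zd : (Fin 4 → ℝ) → Ω → ℝ := fun d ω =>
    displacement N K d 0 a ω + displacementAfter N K d a e t ω
  have hZd : ∀ d, Measurable[dirAlgebra K' ⊔ (incrementAlgebra N (Ioc 0 a) ⊔
      incrementAlgebra N (Ici e))] (Zd d) := by
    intro d
    refine Measurable.add ?_ ?_
    · refine (measurable_displacement_past hN d ha).mono (sup_le_sup ?_ le_sup_left) le_rfl
      exact measurable_iff_comap_le.1 (@measurable_pi_lambda _ _ _ (_) _ _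
        fun n => measurable_dirAlgebra K' _)
    · refine measurable_intervalIntegral_of_rightContinuous _ het (fun s hs => ?_) fun ω s hs => ?_
      · refine measurable_comp_index (L := fun n ω => d (K' n ω)) (M := fun ω =>
          2 + (N s ω - N e ω)) (fun n => ?_) ?_
        · exact (measurable_of_countable d).comp
            ((measurable_dirAlgebra K' n).mono le_sup_left le_rfl)
        · exact ((measurable_sub_incrementAlgebra N (T := Ici e) (mem_Ici.2 hs.1.le)
            (mem_Ici.2 le_rfl)).mono
            (le_sup_right.trans le_sup_right) le_rfl).const_add 2
      · exact continuousWithinAt_comp_counting hN ω (he.trans hs.1)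
          (fun n => d (K' (2 + (n - N e ω)) ω))
  let Z : Ω → ℝ × ℝ := fun ω => (c * Zd dirX ω, c * Zd dirY ω)
  have hZ : Measurable[dirAlgebra K' ⊔ (incrementAlgebra N (Ioc 0 a) ⊔
      incrementAlgebra N (Ici e))] Z := ((hZd dirX).const_mul c).prodMk ((hZd dirY).const_mul c)
  let R₁ := waitingTime N a b
  let R₂ := waitingTime N b e
  let e₁ := {ω | N b ω - N a ω = 1}
  let e₂ := {ω | N e ω - N b ω = 1}
  have hR₁ : Measurable[incrementAlgebra N (Icc a b)] R₁ := measurable_waitingTime hN ha hab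
  have hR₂ : Measurable[incrementAlgebra N (Icc b e)] R₂ := measurable_waitingTime hN hb hbe
  have he₁ : MeasurableSet[incrementAlgebra N (Icc a b)] e₁ :=
    measurable_sub_incrementAlgebra N (T := Icc a b) ⟨hab, le_rfl⟩ ⟨le_rfl, hab⟩
      (measurableSet_singleton 1)
  have he₂ : MeasurableSet[incrementAlgebra N (Icc b e)] e₂ :=
    measurable_sub_incrementAlgebra N (T := Icc b e) ⟨hbe, le_rfl⟩ ⟨le_rfl, hbe⟩
      (measurableSet_singleton 1)
  have hle : ∀ {T : Set ℝ}, T ⊆ Ioi 0 → incrementAlgebra N T ≤ mΩ := fun hT =>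
    (incrementAlgebra_le_countingAlgebra N hT).trans (countingAlgebra_le hN)
  have hle1 : incrementAlgebra N (Icc a b) ≤ mΩ := hle fun x hx => ha.trans_le hx.1
  have hle2 : incrementAlgebra N (Icc b e) ≤ mΩ := hle fun x hx => hb.trans_le hx.1
  have hpast : ∀ r, incrementAlgebra N (Ioc 0 r) ≤ mΩ := fun r => hle fun x hx => hx.1
  have hfut : ∀ r, 0 < r → incrementAlgebra N (Ici r) ≤ mΩ := fun r hr =>
    hle fun x hx => hr.trans_le hx
  have hZ1 := hZ.mono (sup_le_sup (le_refl (dirAlgebra K')) (sup_le_sup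
    (incrementAlgebra_mono N (Ioc_subset_Ioc_right hab)) (le_refl (incrementAlgebra N (Ici e)))))
      (le_refl _)
  have hZ2 := hZ.mono (sup_le_sup (le_refl (dirAlgebra K')) (sup_le_sup
    (le_refl (incrementAlgebra N (Ioc 0 a))) (incrementAlgebra_mono N (Ici_subset_Ici.2 hbe))))
      (le_refl _)
  have hIccIci : incrementAlgebra N (Icc b e) ≤
      dirAlgebra K' ⊔ (incrementAlgebra N (Ioc 0 a) ⊔ incrementAlgebra N (Ici b)) :=
    (incrementAlgebra_mono N Icc_subset_Ici_self).trans (le_sup_right.trans le_sup_right)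
  -- Independence is peeled off one interval at a time: first `R₂` from `Z`, then `R₁` from the pair
  -- `(Z, R₂)`.
  have law₁ : (P.restrict e₂).map (fun ω => (Z ω, R₂ ω)) =
      (P.map Z).prod ((P.restrict e₂).map R₂) := by
    have := map_prodMk_restrict_of_indep (sup_le (dirAlgebra_le hK') (sup_le (hpast b) (hfut e he)))
      hle2 (indep_dirAlgebra_sup_incrementAlgebra hN hK' hind hb hbe) hZ1 hR₂ MeasurableSet.univ he₂
    simpa using this
  have law₂ : (P.restrict (e₂ ∩ e₁)).map (fun ω => ((Z ω, R₂ ω), R₁ ω)) =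
      ((P.map Z).prod ((P.restrict e₂).map R₂)).prod ((P.restrict e₁).map R₁) := by
    rw [← law₁]
    exact map_prodMk_restrict_of_indep
      (sup_le (dirAlgebra_le hK') (sup_le (hpast a) (hfut b hb)))
      hle1 (indep_dirAlgebra_sup_incrementAlgebra hN hK' hind ha hab)
      (hZ2.prodMk (hR₂.mono hIccIci le_rfl)) hR₁ (hIccIci _ he₂) he₁
  have hac : (P.restrict (e₂ ∩ e₁)).map (fun ω => ((Z ω, R₂ ω), R₁ ω)) ≪
      ((P.map Z).prod (volume : Measure ℝ)).prod (volume : Measure ℝ) := by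
    rw [law₂]
    exact (Measure.AbsolutelyContinuous.rfl.prod
      (map_waitingTime_absolutelyContinuous hN hlam hlam0 hb hbe)).prod
      (map_waitingTime_absolutelyContinuous hN hlam hlam0 ha hab)
  let v : ℝ × ℝ := (c * (dirX i - dirX j), c * (dirY i - dirY j))
  let w : ℝ × ℝ := (c * (dirX j - dirX l), c * (dirY j - dirY l))
  let k : ℝ × ℝ := (c * ((b - a) * dirX j + (e - b) * dirX l),
    c * ((b - a) * dirY j + (e - b) * dirY l))
  have hvw : v.1 * w.2 - w.1 * v.2 ≠ 0 := by
    have := cross_ne_zero hij hjl hil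
    have h1 : v.1 * w.2 - w.1 * v.2 = c ^ 2 * ((dirX i - dirX j) * (dirY j - dirY l) -
        (dirX j - dirX l) * (dirY i - dirY j)) := by simp only [v, w]; ring
    rw [h1]
    positivity
  let T : Set (((ℝ × ℝ) × ℝ) × ℝ) := {q | q.1.1 + k + q.1.2 • w + q.2 • v ∈ B}
  have hT : MeasurableSet T := by
    have : Measurable fun q : ((ℝ × ℝ) × ℝ) × ℝ => q.1.1 + k + q.1.2 • w + q.2 • v := by fun_prop
    exact this hBm
  have hT0 : (((P.map Z).prod (volume : Measure ℝ)).prod (volume : Measure ℝ)) T = 0 := by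
    have h1 : T = MeasurableEquiv.prodAssoc ⁻¹'
        {q : (ℝ × ℝ) × ℝ × ℝ | q.1 + k + q.2.1 • w + q.2.2 • v ∈ B} := rfl
    have h2 : MeasurableSet {q : (ℝ × ℝ) × ℝ × ℝ | q.1 + k + q.2.1 • w + q.2.2 • v ∈ B} := by
      have : Measurable fun q : (ℝ × ℝ) × ℝ × ℝ => q.1 + k + q.2.1 • w + q.2.2 • v := by fun_prop
      exact this hBm
    rw [h1, ← Measure.map_apply MeasurableEquiv.prodAssoc.measurable h2, Measure.prodAssoc_prod,
      Measure.measure_prod_null h2]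
    refine Eventually.of_forall fun z => ?_
    exact volume_preimage_affine_eq_zero hvw (z + k) hB
  have hmeas : Measurable (fun ω => ((Z ω, R₂ ω), R₁ ω)) :=
    ((hZ.mono (sup_le (dirAlgebra_le hK') (sup_le (hpast a) (hfut e he))) le_rfl).prodMk
      (hR₂.mono hle2 le_rfl)).prodMk (hR₁.mono hle1 le_rfl)
  have h0 := hac hT0
  rw [Measure.map_apply hmeas hT, Measure.restrict_apply (hmeas hT)] at h0
  refine measure_mono_null ?_ h0
  rintro ω ⟨⟨⟨h1, h2⟩, hi, hj, hl⟩, hω⟩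
  refine ⟨?_, h2, h1⟩
  have hl' : K (N b ω + 1) ω = l := by rw [← hl]; congr 1; omega
  have hj' : K (N b ω) ω = j := by rw [← hj]; congr 1; omega
  have hdisp : ∀ d, displacement N K d 0 t ω = Zd d ω + (R₁ ω * (d i - d j) + (b - a) * d j) +
      (R₂ ω * (d j - d l) + (e - b) * d l) := by
    intro d
    have h3 : displacement N K d e t ω = displacementAfter N K d a e t ω := by
      refine intervalIntegral.integral_congr fun s hs => ?_
      simp only [shiftDir]
      congr 2
      omega
    rw [← displacement_add hN d ω le_rfl he.le het, ← displacement_add hN d ω le_rfl hb.le hbe,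
      ← displacement_add hN d ω le_rfl ha.le hab, displacement_of_one hN d ha hab h1,
      displacement_of_one hN d hb hbe h2, h3, hi, hj, hj', hl']
    simp only [Zd, R₁, R₂]
    ring
  have hpos : (X t ω, Y t ω) = Z ω + k + R₂ ω • w + R₁ ω • v := by
    rw [h.X_eq ht.le, h.Y_eq ht.le, hdisp, hdisp]
    ext
    · simp only [Z, k, w, v, Prod.fst_add, Prod.smul_fst, smul_eq_mul]; ring
    · simp only [Z, k, w, v, Prod.snd_add, Prod.smul_snd, smul_eq_mul]; ring
  have hω' : (X t ω, Y t ω) ∈ B := hω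
  rw [hpos] at hω'
  exact hω'

end AbsoluteContinuity
-- Paths with three directions, and paths with at most two.
section ThreeDirections

open Filter Topology

variable {Ω : Type*} {mΩ : MeasurableSpace Ω} {P : Measure Ω}
variable {lam : ℝ → ℝ} {N : ℝ → Ω → ℤ} {K : ℤ → Ω → Fin 4} {c : ℝ} {X Y : ℝ → Ω → ℝ}

/-- The point number `i` of the regular grid of `[s, t]` with `n + 1` steps. -/
noncomputable def gridPoint (s t : ℝ) (n i : ℕ) : ℝ := s + (t - s) * i / (n + 1)

lemma gridPoint_succ (s t : ℝ) (n i : ℕ) :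
    gridPoint s t n (i + 1) = gridPoint s t n i + (t - s) / (n + 1) := by
  simp only [gridPoint]; push_cast; ring

lemma le_gridPoint {s t : ℝ} (hst : s ≤ t) (n i : ℕ) : s ≤ gridPoint s t n i := by
  have : 0 ≤ (t - s) * i / (n + 1) := by have := sub_nonneg.2 hst; positivity
  simp only [gridPoint]; linarith

lemma gridPoint_zero (s t : ℝ) (n : ℕ) : gridPoint s t n 0 = s := by simp [gridPoint]

lemma gridPoint_last (s t : ℝ) (n : ℕ) : gridPoint s t n (n + 1) = t := by
  have : (n : ℝ) + 1 ≠ 0 := by positivity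
  simp only [gridPoint]
  push_cast
  rw [mul_div_cancel_right₀ _ this]
  ring

lemma gridPoint_le {s t : ℝ} (hst : s ≤ t) {n i : ℕ} (hi : i ≤ n + 1) : gridPoint s t n i ≤ t := by
  have h1 : (0 : ℝ) < n + 1 := by positivity
  have h2 : (i : ℝ) ≤ n + 1 := by exact_mod_cast hi
  have h3 : (t - s) * i / (n + 1) ≤ t - s := by
    rw [div_le_iff₀ h1]
    exact mul_le_mul_of_nonneg_left h2 (sub_nonneg.2 hst)
  simp only [gridPoint]; linarith

/-- Almost surely, events are separated by a fine enough grid. -/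
lemma ae_exists_grid [IsProbabilityMeasure P] (hN : IsPoissonCounting P lam N)
    (hlam : ContinuousOn lam (Ioi 0)) (hlam0 : ∀ t, 0 < t → 0 ≤ lam t) {s t : ℝ} (hs : 0 < s)
    (hst : s ≤ t) : ∀ᵐ ω ∂P, ∃ n : ℕ, ∀ i ≤ n,
      N (gridPoint s t n (i + 1)) ω - N (gridPoint s t n i) ω ≤ 1 := by
  obtain ⟨C, hC⟩ := isCompact_Icc.exists_bound_of_continuousOn
    (hlam.mono fun x (hx : x ∈ Icc s t) => hs.trans_le hx.1)
  have hC0 : 0 ≤ C := (norm_nonneg _).trans (hC s ⟨le_rfl, hst⟩)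
  have hts := sub_nonneg.2 hst
  rw [ae_iff, ← measureReal_eq_zero_iff]
  refine le_antisymm ?_ measureReal_nonneg
  -- Union bound: each of the `n + 1` cells contains two events with probability at most `(C (t - s)
  -- / (n + 1))²`, so the total is of order `1 / (n + 1)`.
  have hb : ∀ n : ℕ, P.real {ω | ¬∃ n : ℕ, ∀ i ≤ n,
      N (gridPoint s t n (i + 1)) ω - N (gridPoint s t n i) ω ≤ 1} ≤
      (C * (t - s)) ^ 2 * (1 / ((n : ℝ) + 1)) := by
    intro n
    have hn : (0 : ℝ) < n + 1 := by positivity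
    have hsub : {ω | ¬∃ n : ℕ, ∀ i ≤ n,
        N (gridPoint s t n (i + 1)) ω - N (gridPoint s t n i) ω ≤ 1} ⊆
        ⋃ i ∈ Finset.range (n + 1),
          {ω | 2 ≤ N (gridPoint s t n (i + 1)) ω - N (gridPoint s t n i) ω} := by
      intro ω hω
      simp only [mem_ofPred_eq, not_exists, not_forall] at hω
      obtain ⟨i, hi, hi'⟩ := hω n
      simp only [mem_iUnion, Finset.mem_range, mem_ofPred_eq]
      exact ⟨i, by omega, by omega⟩
    refine (measureReal_mono hsub (measure_ne_top _ _)).trans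
      ((measureReal_biUnion_finset_le _ _).trans ?_)
    have h1 : ∀ i ∈ Finset.range (n + 1),
        P.real {ω | 2 ≤ N (gridPoint s t n (i + 1)) ω - N (gridPoint s t n i) ω} ≤
        (C * ((t - s) / (n + 1))) ^ 2 := by
      intro i hi
      have hi : i < n + 1 := Finset.mem_range.1 hi
      have hg : gridPoint s t n i ≤ gridPoint s t n (i + 1) := by
        rw [gridPoint_succ]
        have : 0 ≤ (t - s) / (n + 1) := by positivity
        linarith
      have hp : 0 < gridPoint s t n i := hs.trans_le (le_gridPoint hst n i)
      refine (measureReal_two_le_increment_le hN hlam0 hp hg).trans ?_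
      refine pow_le_pow_left₀ (integral_rate_nonneg hlam0 hp hg) ?_ 2
      have h2 := intervalIntegral.norm_integral_le_of_norm_le_const (C := C) (f := lam)
        (a := gridPoint s t n i) (b := gridPoint s t n (i + 1)) fun x hx => by
          rw [uIoc_of_le hg] at hx
          exact hC x ⟨(le_gridPoint hst n i).trans hx.1.le,
            hx.2.trans (gridPoint_le hst (by omega))⟩
      have h3 : |gridPoint s t n (i + 1) - gridPoint s t n i| = (t - s) / (n + 1) := by
        rw [gridPoint_succ, add_sub_cancel_left, abs_of_nonneg (by positivity)]
      rw [h3] at h2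
      exact (le_abs_self _).trans h2
    refine (Finset.sum_le_sum h1).trans (le_of_eq ?_)
    rw [Finset.sum_const, Finset.card_range, nsmul_eq_mul]
    push_cast
    field_simp
  have hlim : Tendsto (fun n : ℕ => (C * (t - s)) ^ 2 * (1 / ((n : ℝ) + 1))) atTop
      (𝓝 ((C * (t - s)) ^ 2 * 0)) := tendsto_one_div_add_atTop_nhds_zero_nat.const_mul _
  rw [mul_zero] at hlim
  exact ge_of_tendsto' hlim hb

lemma ae_direction_succ_ne [IsProbabilityMeasure P] (hK : IsReflectingDirectionSequence P K) :
    ∀ᵐ ω ∂P, ∀ n : ℤ, K (n + 1) ω ≠ K n ω := by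
  rw [ae_all_iff]
  intro n
  have h1 : ∀ k : Fin 4, ∀ᵐ ω ∂P, ¬ (K n ω = k ∧ K (n + 1) ω = k) := by
    intro k
    rw [ae_iff, ← measureReal_eq_zero_iff]
    have h2 := hK.law n 1 (fun _ => k)
    simp only [not_not]
    simpa using h2
  filter_upwards [ae_all_iff.2 h1] with ω hω h2
  exact hω (K n ω) ⟨rfl, h2⟩

/-- A sequence whose successive terms differ and which takes three values on an interval has three
distinct successive terms there. -/
lemma exists_three_successive {κ : ℤ → Fin 4} (hκ : ∀ n, κ (n + 1) ≠ κ n) {p q : ℤ}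
    {x y z : ℤ} (hx : x ∈ Icc p q) (hy : y ∈ Icc p q) (hz : z ∈ Icc p q) (hxy : κ x ≠ κ y)
    (hyz : κ y ≠ κ z) (hxz : κ x ≠ κ z) :
    ∃ n, p ≤ n ∧ n + 2 ≤ q ∧ κ n ≠ κ (n + 1) ∧ κ (n + 1) ≠ κ (n + 2) ∧ κ n ≠ κ (n + 2) := by
  by_contra! hcon
  -- Neighbours already differ, so failure of the conclusion forces period two on the interval,
  -- hence only the values at `p` and `p + 1`.
  have h2 : ∀ n, p ≤ n → n + 2 ≤ q → κ n = κ (n + 2) := fun n hn hn' =>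
    hcon n hn hn' (hκ n).symm (by have := hκ (n + 1); rw [add_assoc] at this; exact this.symm)
  have key : ∀ j : ℕ, p + j ≤ q → κ (p + j) = κ p ∨ κ (p + j) = κ (p + 1) := by
    intro j
    induction j using Nat.strong_induction_on with
    | _ j ih =>
      intro hj
      match j with
      | 0 => left; simp
      | 1 => right; simp
      | j + 2 =>
        have h3 := h2 (p + j) (by omega) (by push_cast at hj; omega)
        have h4 := ih j (by omega) (by push_cast at hj; omega)
        have h5 : p + ((j + 2 : ℕ) : ℤ) = p + j + 2 := by push_cast; ring
        rw [h5, ← h3]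
        exact h4
  have key' : ∀ u ∈ Icc p q, κ u = κ p ∨ κ u = κ (p + 1) := by
    intro u hu
    have h6 := key (u - p).toNat (by have := hu.1; have := hu.2; omega)
    rwa [show p + ((u - p).toNat : ℤ) = u by have := hu.1; omega] at h6
  rcases key' x hx with h7 | h7 <;> rcases key' y hy with h8 | h8 <;>
    rcases key' z hz with h9 | h9 <;> simp_all

/-- A discrete intermediate value theorem: on a grid separating events, no label is skipped by the
counting process. -/
lemma exists_eq_of_steps_le_one {f : ℕ → ℤ} : ∀ {n : ℕ}, (∀ i < n, f (i + 1) - f i ≤ 1) →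
    ∀ v, f 0 ≤ v → v ≤ f n → ∃ i ≤ n, f i = v := by
  intro n
  induction n with
  | zero => intro _ v h1 h2; exact ⟨0, le_rfl, le_antisymm h1 h2⟩
  | succ n ih =>
    intro h v h1 h2
    by_cases h3 : v ≤ f n
    · obtain ⟨i, hi, hi'⟩ := ih (fun i hi => h i (by omega)) v h1 h3
      exact ⟨i, by omega, hi'⟩
    · exact ⟨n + 1, le_rfl, by have := h n (by omega); omega⟩

/-- At least three directions are used between the times `s` and `t`. -/
def visitsThree (N : ℝ → Ω → ℤ) (K : ℤ → Ω → Fin 4) (s t : ℝ) : Set Ω :=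
  {ω | ∃ x ∈ Icc (N s ω) (N t ω), ∃ y ∈ Icc (N s ω) (N t ω), ∃ z ∈ Icc (N s ω) (N t ω),
    K x ω ≠ K y ω ∧ K y ω ≠ K z ω ∧ K x ω ≠ K z ω}

/-- Almost surely three distinct consecutive directions occur, and a fine grid has points at which
the count takes the three corresponding labels. The path thus lies in one of countably many
switching events, each null on `B`. -/
lemma IsReflectingMotion.measure_visitsThree_inter_eq_zero [IsProbabilityMeasure P]
    (h : IsReflectingMotion P c lam N K X Y) (hc : 0 < c)
    (hlam : ContinuousOn lam (Ioi 0)) (hlam0 : ∀ t, 0 < t → 0 ≤ lam t) {s t : ℝ} (hs : 0 < s)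
    (hst : s ≤ t) {B : Set (ℝ × ℝ)} (hBm : MeasurableSet B) (hB : volume B = 0) :
    P (visitsThree N K s t ∩ {ω | (X t ω, Y t ω) ∈ B}) = 0 := by
  have hN := h.poisson
  have hnull : ∀ᵐ ω ∂P, ∀ (n : ℕ) (p q r : ℕ) (i j l : Fin 4), p ≤ n + 1 → q ≤ n + 1 →
      r ≤ n + 1 → p ≤ q → q ≤ r → i ≠ j → j ≠ l → i ≠ l →
      ω ∉ switchEvent N K (gridPoint s t n p) (gridPoint s t n q) (gridPoint s t n r) i j l ∩
        {ω | (X t ω, Y t ω) ∈ B} := by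
    simp only [ae_all_iff]
    intro n p q r i j l hp hq hr hpq hqr hij hjl hil
    rw [ae_iff]
    simp only [not_not]
    have hg : ∀ {u v : ℕ}, u ≤ v → gridPoint s t n u ≤ gridPoint s t n v := by
      intro u v huv
      have h1 : (u : ℝ) ≤ v := by exact_mod_cast huv
      have h2 := sub_nonneg.2 hst
      simp only [gridPoint]
      gcongr
    exact measure_switchEvent_inter_eq_zero h hc hlam hlam0
      (hs.trans_le (le_gridPoint hst n p)) (hg hpq) (hg hqr) (gridPoint_le hst hr) hij hjl hil hBm hB
  rw [← nonpos_iff_eq_zero, nonpos_iff_eq_zero]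
  refine measure_eq_zero_iff_ae_notMem.2 ?_
  filter_upwards [hnull, ae_exists_grid hN hlam hlam0 hs hst,
    ae_direction_succ_ne h.directions] with ω h1 h2 h3
  rintro ⟨⟨x, hx, y, hy, z, hz, hxy, hyz, hxz⟩, hω⟩
  obtain ⟨m, hm, hm', k1, k2, k3⟩ :=
    exists_three_successive (κ := fun n => K n ω) h3 hx hy hz hxy hyz hxz
  obtain ⟨n, hn⟩ := h2
  have hv : ∀ v, N s ω ≤ v → v ≤ N t ω → ∃ i ≤ n + 1, N (gridPoint s t n i) ω = v := by
    intro v hv1 hv2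
    refine exists_eq_of_steps_le_one (f := fun i => N (gridPoint s t n i) ω)
      (fun i hi => hn i (by omega)) v ?_ ?_
    · simpa [gridPoint_zero] using hv1
    · simpa only [gridPoint_last] using hv2
  obtain ⟨p, hp, hp'⟩ := hv m hm (by omega)
  obtain ⟨q, hq, hq'⟩ := hv (m + 1) (by omega) (by omega)
  obtain ⟨r, hr, hr'⟩ := hv (m + 2) (by omega) hm'
  have hlt : ∀ {u v : ℕ}, N (gridPoint s t n u) ω < N (gridPoint s t n v) ω → u ≤ v := by
    intro u v huv
    by_contra! hcon
    have h4 : (v : ℝ) ≤ u := by exact_mod_cast hcon.le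
    have h5 := sub_nonneg.2 hst
    have h6 : gridPoint s t n v ≤ gridPoint s t n u := by
      simp only [gridPoint]
      gcongr
    have := counting_mono hN ω (hs.trans_le (le_gridPoint hst n v)) h6
    omega
  refine h1 n p q r _ _ _ hp hq hr (hlt (by omega)) (hlt (by omega)) k1 k2 k3 ⟨⟨⟨?_, ?_⟩, ?_⟩, hω⟩
  · omega
  · omega
  · rw [hp']; exact ⟨rfl, rfl, rfl⟩

/-- The axes and the boundary of the square `|x| + |y| ≤ r`. -/
def singularSet (r : ℝ) : Set (ℝ × ℝ) := {z | z.1 = 0 ∨ z.2 = 0 ∨ |z.1| + |z.2| = r}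

/-- If at most two directions are used, the position is on an axis or on the boundary of the
square. -/
lemma IsReflectingMotion.mem_singularSet (h : IsReflectingMotion P c lam N K X Y) (hc : 0 < c)
    {t : ℝ} (ht : 0 < t) {ω : Ω} (hω : ∀ s, 0 < s → s ≤ t → ω ∉ visitsThree N K s t) :
    (X t ω, Y t ω) ∈ singularSet (c * t) := by
  have hN := h.poisson
  have h3 : ∀ s₁ ∈ Ioc 0 t, ∀ s₂ ∈ Ioc 0 t, ∀ s₃ ∈ Ioc 0 t, ¬ (K (N s₁ ω) ω ≠ K (N s₂ ω) ω ∧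
      K (N s₂ ω) ω ≠ K (N s₃ ω) ω ∧ K (N s₁ ω) ω ≠ K (N s₃ ω) ω) := by
    intro s₁ h1 s₂ h2 s₃ h3 hne
    have hm : 0 < min s₁ (min s₂ s₃) := lt_min h1.1 (lt_min h2.1 h3.1)
    refine hω _ hm ((min_le_left _ _).trans h1.2) ⟨N s₁ ω, ?_, N s₂ ω, ?_, N s₃ ω, ?_, hne⟩
    · exact ⟨counting_mono hN ω hm (min_le_left _ _), counting_mono hN ω h1.1 h1.2⟩
    · exact ⟨counting_mono hN ω hm ((min_le_right _ _).trans (min_le_left _ _)),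
        counting_mono hN ω h2.1 h2.2⟩
    · exact ⟨counting_mono hN ω hm ((min_le_right _ _).trans (min_le_right _ _)),
        counting_mono hN ω h3.1 h3.2⟩
  obtain ⟨i, j, hij⟩ : ∃ i j, ∀ s ∈ Ioc 0 t, K (N s ω) ω = i ∨ K (N s ω) ω = j := by
    by_cases hall : ∀ s ∈ Ioc 0 t, K (N s ω) ω = K (N t ω) ω
    · exact ⟨K (N t ω) ω, K (N t ω) ω, fun s hs => Or.inl (hall s hs)⟩
    · push Not at hall
      obtain ⟨u, hu, hut⟩ := hall
      refine ⟨K (N t ω) ω, K (N u ω) ω, fun s hs => ?_⟩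
      by_contra! hcon
      exact h3 s hs u hu t ⟨ht, le_rfl⟩ ⟨hcon.2, hut, hcon.1⟩
  -- Two vertical directions keep the particle on one axis, two horizontal ones on the other.
  -- Otherwise each coordinate of the velocity has a constant sign, so `|X| + |Y|` grows at full
  -- speed `c`.
  have hcase : (dirX i = 0 ∧ dirX j = 0) ∨ (dirY i = 0 ∧ dirY j = 0) ∨
      ∃ σ τ : ℝ, |σ| = 1 ∧ |τ| = 1 ∧ dirX i = σ * |dirX i| ∧ dirX j = σ * |dirX j| ∧
        dirY i = τ * |dirY i| ∧ dirY j = τ * |dirY j| := by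
    have hd : ∀ k : Fin 4, (dirX k = 1 ∧ dirY k = 0) ∨ (dirX k = 0 ∧ dirY k = 1) ∨
        (dirX k = -1 ∧ dirY k = 0) ∨ (dirX k = 0 ∧ dirY k = -1) := by
      intro k
      match k with
      | 0 => simp [dirX_zero, dirY_zero]
      | 1 => simp [dirX_one, dirY_one]
      | 2 => simp [dirX_two, dirY_two]
      | 3 => simp [dirX_three, dirY_three]
    rcases hd i with ⟨h1, h2⟩ | ⟨h1, h2⟩ | ⟨h1, h2⟩ | ⟨h1, h2⟩ <;>
      rcases hd j with ⟨h4, h5⟩ | ⟨h4, h5⟩ | ⟨h4, h5⟩ | ⟨h4, h5⟩ <;>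
      rw [h1, h2, h4, h5] <;>
      first
      | exact Or.inl ⟨rfl, rfl⟩
      | exact Or.inr (Or.inl ⟨rfl, rfl⟩)
      | (refine Or.inr (Or.inr ⟨1, 1, ?_⟩); norm_num; done)
      | (refine Or.inr (Or.inr ⟨1, -1, ?_⟩); norm_num; done)
      | (refine Or.inr (Or.inr ⟨-1, 1, ?_⟩); norm_num; done)
      | (refine Or.inr (Or.inr ⟨-1, -1, ?_⟩); norm_num)
  have hcongr : ∀ {d d' : Fin 4 → ℝ}, d i = d' i → d j = d' j →
      displacement N K d 0 t ω = ∫ s in (0 : ℝ)..t, d' (K (N s ω) ω) := by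
    intro d d' hi hj
    refine intervalIntegral.integral_congr_ae (Eventually.of_forall fun s hs => ?_)
    rw [uIoc_of_le ht.le] at hs
    rcases hij s hs with h4 | h4 <;> simp [h4, hi, hj]
  rw [h.X_eq ht.le, h.Y_eq ht.le]
  rcases hcase with ⟨hi, hj⟩ | ⟨hi, hj⟩ | ⟨σ, τ, hσ, hτ, hxi, hxj, hyi, hyj⟩
  · left
    rw [hcongr (d' := fun _ => 0) hi hj]
    simp
  · right; left
    rw [hcongr (d' := fun _ => 0) hi hj]
    simp
  · right; right
    have hi : ∀ d : Fin 4 → ℝ, IntervalIntegrable (fun s => d (K (N s ω) ω)) volume 0 t :=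
      fun d => intervalIntegrable_velocity hN d ω le_rfl ht.le
    have hpos : ∀ d : Fin 4 → ℝ, 0 ≤ ∫ s in (0 : ℝ)..t, |d (K (N s ω) ω)| := fun d =>
      intervalIntegral.integral_nonneg ht.le fun s _ => abs_nonneg _
    rw [hcongr (d' := fun k => σ * |dirX k|) hxi hxj, hcongr (d' := fun k => τ * |dirY k|) hyi hyj,
      intervalIntegral.integral_const_mul, intervalIntegral.integral_const_mul]
    simp only
    rw [abs_mul, abs_mul, abs_mul, abs_mul, hσ, hτ, one_mul, one_mul, abs_of_pos hc, ← mul_add,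
      abs_of_nonneg (hpos dirX), abs_of_nonneg (hpos dirY),
      ← intervalIntegral.integral_add (hi fun k => |dirX k|) (hi fun k => |dirY k|)]
    simp [abs_dirX_add_abs_dirY]

end ThreeDirections
-- The probability of having used three directions.
section Mass

open Filter Topology

variable {Ω : Type*} {mΩ : MeasurableSpace Ω} {P : Measure Ω}
variable {lam : ℝ → ℝ} {N : ℝ → Ω → ℤ} {K : ℤ → Ω → Fin 4} {c : ℝ} {X Y : ℝ → Ω → ℝ}

/-- The directions number `0, …, n` take at most two values. -/
def atMostTwo (K : ℤ → Ω → Fin 4) (n : ℕ) : Set Ω :=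
  {ω | ∀ x y z : ℤ, x ∈ Icc 0 (n : ℤ) → y ∈ Icc 0 (n : ℤ) → z ∈ Icc 0 (n : ℤ) →
    ¬(K x ω ≠ K y ω ∧ K y ω ≠ K z ω ∧ K x ω ≠ K z ω)}

lemma measurableSet_atMostTwo (K : ℤ → Ω → Fin 4) (n : ℕ) :
    MeasurableSet[dirAlgebra K] (atMostTwo K n) := by
  refine ⟨{κ : ℤ → Fin 4 | ∀ x y z : ℤ, x ∈ Icc 0 (n : ℤ) → y ∈ Icc 0 (n : ℤ) →
    z ∈ Icc 0 (n : ℤ) → ¬(κ x ≠ κ y ∧ κ y ≠ κ z ∧ κ x ≠ κ z)}, ?_, rfl⟩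
  have h : ∀ x y : ℤ, Measurable fun κ : ℤ → Fin 4 => κ x ≠ κ y := fun x y =>
    (measurableSet_setOfPred.1
      (measurableSet_eq_fun (measurable_pi_apply x) (measurable_pi_apply y))).not
  exact measurableSet_setOfPred.2 <| Measurable.forall fun x => Measurable.forall fun y =>
    Measurable.forall fun z => measurable_const.imp <| measurable_const.imp <|
      measurable_const.imp ((h x y).and ((h y z).and (h x z))).not

/-- The directions number `0, …, n` are alternately `i` and `j`. -/
def alternate (K : ℤ → Ω → Fin 4) (n : ℕ) (i j : Fin 4) : Set Ω :=
  {ω | ∀ m : Fin (n + 1), K (0 + ((m : ℕ) : ℤ)) ω = if Even (m : ℕ) then i else j}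

lemma measureReal_alternate (hK : IsReflectingDirectionSequence P K) (n : ℕ) {i j : Fin 4}
    (hij : i ≠ j) : P.real (alternate K n i j) = 1 / 4 * (1 / 3) ^ n := by
  have h := hK.law 0 n (fun m => if Even (m : ℕ) then i else j)
  refine h.trans ?_
  congr 1
  rw [Finset.prod_congr rfl (g := fun _ => (1 / 3 : ℝ)), Finset.prod_const, Finset.card_univ,
    Fintype.card_fin]
  intro m _
  by_cases hm : Even (m : ℕ)
  · simp [hm, Nat.even_add_one, hij.symm]
  · simp [hm, Nat.even_add_one, hij]

/-- For `n ≥ 1` the event says, almost surely, that the directions alternate between the first two: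
`12` ordered pairs, each of probability `1/4 · 3⁻ⁿ`. For `n = 0` the event is certain, and the
correction `2` brings `3` down to `1`. -/
lemma measureReal_atMostTwo [IsProbabilityMeasure P] (hK : IsReflectingDirectionSequence P K)
    (n : ℕ) : P.real (atMostTwo K n) = 3 * (1 / 3) ^ n - if n = 0 then 2 else 0 := by
  rcases Nat.eq_zero_or_pos n with rfl | hn
  · have : atMostTwo K 0 = (univ : Set Ω) := by
      refine eq_univ_of_forall fun ω x y z hx hy _ h => h.1 ?_
      rw [show x = y by have := hx.1; have := hx.2; have := hy.1; have := hy.2; push_cast at *; omega]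
    simp [this]
    norm_num
  have h1 : atMostTwo K n =ᵐ[P]
      ⋃ q ∈ Finset.univ.filter (fun q : Fin 4 × Fin 4 => q.1 ≠ q.2), alternate K n q.1 q.2 := by
    filter_upwards [ae_direction_succ_ne hK] with ω hω
    refine propext ⟨fun (h : ω ∈ atMostTwo K n) => ?_, fun h => ?_⟩
    · refine mem_iUnion₂.2 ⟨(K 0 ω, K 1 ω), by simpa using (hω 0).symm, fun m => ?_⟩
      have key : ∀ l : ℕ, l ≤ n → K (0 + (l : ℤ)) ω = if Even l then K 0 ω else K 1 ω := by
        intro l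
        induction l using Nat.strong_induction_on with
        | _ l ih =>
          intro hl
          match l with
          | 0 => simp
          | 1 => simp
          | l + 2 =>
            have h3 := ih l (by omega) (by omega)
            have h4 := h (0 + l) (0 + l + 1) (0 + l + 1 + 1) ⟨by omega, by omega⟩
              ⟨by omega, by omega⟩ ⟨by omega, by omega⟩
            have h5 : K (0 + (l : ℤ)) ω = K (0 + l + 1 + 1) ω := by
              by_contra hne
              exact h4 ⟨(hω _).symm, (hω _).symm, hne⟩
            have h6 : (0 : ℤ) + ((l + 2 : ℕ) : ℤ) = 0 + l + 1 + 1 := by push_cast; ring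
            rw [h6, ← h5, h3]
            simp [Nat.even_add]
      exact key m (by omega)
    · obtain ⟨q, -, hq⟩ := mem_iUnion₂.1 (show ω ∈ ⋃ q ∈ _, _ from h)
      have h2 : ∀ x ∈ Icc 0 (n : ℤ), K x ω = q.1 ∨ K x ω = q.2 := by
        intro x hx
        have h3 := hq ⟨x.toNat, by have := hx.1; have := hx.2; omega⟩
        rw [show (0 : ℤ) + ((x.toNat : ℕ) : ℤ) = x by have := hx.1; omega] at h3
        rw [h3]
        split_ifs <;> simp
      intro x y z hx hy hz hne
      rcases h2 x hx with h7 | h7 <;> rcases h2 y hy with h8 | h8 <;>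
        rcases h2 z hz with h9 | h9 <;> simp_all
  rw [measureReal_congr h1, measureReal_biUnion_finset]
  · rw [Finset.sum_congr rfl fun q hq =>
      measureReal_alternate hK n (Finset.mem_filter.1 hq).2, Finset.sum_const,
      show (Finset.univ.filter (fun q : Fin 4 × Fin 4 => q.1 ≠ q.2)).card = 12 by decide]
    simp [hn.ne']
    ring
  · intro q _ q' _ hqq
    refine Set.disjoint_left.2 fun ω h2 h3 => hqq ?_
    have h4 := (h2 ⟨0, by omega⟩).symm.trans (h3 ⟨0, by omega⟩)
    have h5 := (h2 ⟨1, by omega⟩).symm.trans (h3 ⟨1, by omega⟩)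
    exact Prod.ext (by simpa using h4) (by simpa using h5)
  · intro q _
    simp only [alternate, Set.ofPred_forall]
    exact MeasurableSet.iInter fun m => hK.measurable _ (measurableSet_singleton _)

lemma compl_visitsThree (hN : IsPoissonCounting P lam N) {s t : ℝ} (hs : 0 < s) (hst : s ≤ t) :
    (visitsThree N K s t)ᶜ =
      ⋃ n : ℕ, atMostTwo (shiftDir N K s) n ∩ {ω | N t ω - N s ω = n} := by
  ext ω
  have h0 := counting_mono hN ω hs hst
  constructor
  · intro h
    refine mem_iUnion.2 ⟨(N t ω - N s ω).toNat, fun x y z hx hy hz hne => h ?_, ?_⟩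
    · rw [Int.toNat_of_nonneg (by omega)] at hx hy hz
      exact ⟨N s ω + x, ⟨by have := hx.1; omega, by have := hx.2; omega⟩,
        N s ω + y, ⟨by have := hy.1; omega, by have := hy.2; omega⟩,
        N s ω + z, ⟨by have := hz.1; omega, by have := hz.2; omega⟩, hne⟩
    · exact (Int.toNat_of_nonneg (by omega)).symm
  · intro h
    obtain ⟨n, h1, h2⟩ := mem_iUnion.1 h
    have h2 : N t ω - N s ω = n := h2
    rintro ⟨x, hx, y, hy, z, hz, hne⟩
    refine h1 (x - N s ω) (y - N s ω) (z - N s ω) ⟨by have := hx.1; omega, by have := hx.2; omega⟩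
      ⟨by have := hy.1; omega, by have := hy.2; omega⟩
      ⟨by have := hz.1; omega, by have := hz.2; omega⟩ ?_
    simpa [shiftDir] using hne

lemma measurableSet_visitsThree (h : IsReflectingMotion P c lam N K X Y) [IsProbabilityMeasure P]
    {s t : ℝ} (hs : 0 < s) (hst : s ≤ t) : MeasurableSet (visitsThree N K s t) := by
  rw [← MeasurableSet.compl_iff, compl_visitsThree h.poisson hs hst]
  have hK' := isReflectingDirectionSequence_shiftDir h.poisson h.directions h.indep hs
  exact MeasurableSet.iUnion fun n => ((dirAlgebra_le hK') _ (measurableSet_atMostTwo _ n)).inter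
    (measurableSet_increment h.poisson hs hst n)

/-- Conditioning on the number of events in `(s, t]`: the terms `3 · 3⁻ⁿ` sum to `3 e^{-Λ} e^{Λ/3}`,
and the correction at `n = 0` contributes `-2 e^{-Λ}`. -/
lemma IsReflectingMotion.measureReal_compl_visitsThree [IsProbabilityMeasure P]
    (h : IsReflectingMotion P c lam N K X Y) (hlam0 : ∀ t, 0 < t → 0 ≤ lam t) {s t : ℝ}
    (hs : 0 < s) (hst : s ≤ t) : P.real (visitsThree N K s t)ᶜ =
      3 * Real.exp (-(2 / 3) * ∫ u in s..t, lam u) - 2 * Real.exp (-∫ u in s..t, lam u) := by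
  have hN := h.poisson
  have hK' := isReflectingDirectionSequence_shiftDir hN h.directions h.indep hs
  set Λ := ∫ u in s..t, lam u with hΛ
  have hterm : ∀ n : ℕ, P.real (atMostTwo (shiftDir N K s) n ∩ {ω | N t ω - N s ω = n}) =
      3 * Real.exp (-Λ) * ((Λ / 3) ^ n / n.factorial) -
        if n = 0 then 2 * Real.exp (-Λ) else 0 := by
    intro n
    have hm : MeasurableSet[countingAlgebra N] {ω | N t ω - N s ω = n} :=
      measurableSet_eq_fun (m := countingAlgebra N) ((measurable_countingAlgebra N (hs.trans_le hst)).sub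
        (measurable_countingAlgebra N hs)) measurable_const
    have h1 := (Indep_iff _ _ P).1 (indep_shiftDir hN h.directions h.indep hs) _ _
      (measurableSet_atMostTwo _ n) hm
    rw [measureReal_def, h1, ENNReal.toReal_mul, ← measureReal_def, ← measureReal_def,
      measureReal_atMostTwo hK', measureReal_increment_eq hN hlam0 hs hst, ← hΛ]
    split_ifs with hn
    · subst hn; simp; ring
    · rw [div_pow, div_pow, one_pow]; ring
  have hsum : HasSum (fun n : ℕ => 3 * Real.exp (-Λ) * ((Λ / 3) ^ n / n.factorial) -
      if n = 0 then 2 * Real.exp (-Λ) else 0)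
      (3 * Real.exp (-Λ) * Real.exp (Λ / 3) - 2 * Real.exp (-Λ)) := by
    refine HasSum.sub (HasSum.mul_left _ ?_) (hasSum_ite_eq 0 _)
    rw [Real.exp_eq_exp_ℝ]
    exact NormedSpace.expSeries_div_hasSum_exp (Λ / 3)
  rw [compl_visitsThree hN hs hst, measureReal_def, measure_iUnion,
    ENNReal.tsum_toReal_eq fun n => measure_ne_top _ _]
  · have h2 := hsum.tsum_eq
    simp only [← hterm] at h2
    refine h2.trans ?_
    rw [mul_assoc, ← Real.exp_add]
    ring_nf
  · intro n m hnm
    refine Set.disjoint_left.2 fun ω h2 h3 => hnm ?_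
    exact_mod_cast (show (n : ℤ) = m from h2.2.symm.trans h3.2)
  · exact fun n => ((dirAlgebra_le hK') _ (measurableSet_atMostTwo _ n)).inter
      (measurableSet_increment hN hs hst n)

lemma isClosed_singularSet (r : ℝ) : IsClosed (singularSet r) := by
  refine (isClosed_eq continuous_fst continuous_const).union
    ((isClosed_eq continuous_snd continuous_const).union
      (isClosed_eq (by fun_prop) continuous_const))

/-- By Fubini: the slice over any `x ≠ 0` has at most three points. -/
lemma volume_singularSet (r : ℝ) : volume (singularSet r) = 0 := by
  have hf : ∀ x : ℝ, x ≠ 0 → volume (Prod.mk x ⁻¹' singularSet r) = 0 := by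
    intro x hx
    refine measure_mono_null (t := {0, r - |x|, -(r - |x|)}) ?_ ((toFinite _).measure_zero _)
    rintro y (h | h | h)
    · exact absurd h hx
    · exact Or.inl h
    · have h : |x| + |y| = r := h
      have h2 : |y| = r - |x| := by linarith
      rcases abs_cases y with ⟨h3, -⟩ | ⟨h3, -⟩
      · exact Or.inr (Or.inl (by linarith))
      · exact Or.inr (Or.inr (show y = _ by linarith))
  rw [Measure.volume_eq_prod, Measure.measure_prod_null (isClosed_singularSet r).measurableSet]
  have h0 : ∀ᵐ x : ℝ, x ≠ 0 := by simp [ae_iff]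
  filter_upwards [h0] with x hx
  exact hf x hx

lemma visitsThree_subset (hN : IsPoissonCounting P lam N) {s s' t : ℝ} (hs : 0 < s)
    (hss : s ≤ s') : visitsThree N K s' t ⊆ visitsThree N K s t := by
  rintro ω ⟨x, hx, y, hy, z, hz, hne⟩
  have h := counting_mono hN ω hs hss
  exact ⟨x, ⟨h.trans hx.1, hx.2⟩, y, ⟨h.trans hy.1, hy.2⟩, z, ⟨h.trans hz.1, hz.2⟩, hne⟩

/-- Off the axes and the boundary of the square, the law of the position charges no null set. -/
lemma IsReflectingMotion.measure_notMem_singularSet_inter [IsProbabilityMeasure P]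
    (h : IsReflectingMotion P c lam N K X Y) (hc : 0 < c)
    (hlam : ContinuousOn lam (Ioi 0)) (hlam0 : ∀ t, 0 < t → 0 ≤ lam t) {t : ℝ} (ht : 0 < t)
    {B : Set (ℝ × ℝ)} (hBm : MeasurableSet B) (hB : volume B = 0) :
    P ({ω | (X t ω, Y t ω) ∉ singularSet (c * t)} ∩ {ω | (X t ω, Y t ω) ∈ B}) = 0 := by
  have hsub : {ω | (X t ω, Y t ω) ∉ singularSet (c * t)} ∩ {ω | (X t ω, Y t ω) ∈ B} ⊆
      ⋃ n : ℕ, visitsThree N K (t / (n + 1)) t ∩ {ω | (X t ω, Y t ω) ∈ B} := by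
    rintro ω ⟨h1, h2⟩
    by_contra hcon
    refine h1 (h.mem_singularSet hc ht fun s hs hst h3 => hcon ?_)
    obtain ⟨n, hn⟩ := exists_nat_gt (t / s)
    refine mem_iUnion.2 ⟨n, visitsThree_subset h.poisson (by positivity) ?_ h3, h2⟩
    rw [div_le_iff₀ (by positivity)]
    rw [div_lt_iff₀ hs] at hn
    nlinarith
  refine measure_mono_null hsub (measure_iUnion_null fun n => ?_)
  exact h.measure_visitsThree_inter_eq_zero hc hlam hlam0 (by positivity)
    (div_le_self ht.le (by linarith [(Nat.cast_nonneg n : (0 : ℝ) ≤ n)])) hBm hB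

/-- Up to a null event, the position avoids the singular set exactly when three directions are used
on some `[t / (n + 1), t]`: two directions force it in, and three leave no mass on a null set. These
events increase with `n`, so their probabilities converge; starting times stay positive because
events may accumulate at `0`. -/
lemma IsReflectingMotion.tendsto_measureReal_singularSet [IsProbabilityMeasure P]
    (h : IsReflectingMotion P c lam N K X Y) (hc : 0 < c)
    (hlam : ContinuousOn lam (Ioi 0)) (hlam0 : ∀ t, 0 < t → 0 ≤ lam t) {t : ℝ} (ht : 0 < t) :
    Tendsto (fun n : ℕ => 1 - (3 * Real.exp (-(2 / 3) * ∫ u in (t / (n + 1))..t, lam u) -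
        2 * Real.exp (-∫ u in (t / (n + 1))..t, lam u))) atTop
      (𝓝 (P.real {ω | (X t ω, Y t ω) ∉ singularSet (c * t)})) := by
  have hpos : ∀ n : ℕ, 0 < t / (n + 1) := fun n => by positivity
  have hle : ∀ n : ℕ, t / (n + 1) ≤ t := fun n =>
    div_le_self ht.le (by linarith [(Nat.cast_nonneg n : (0 : ℝ) ≤ n)])
  have hmono : Monotone fun n : ℕ => visitsThree N K (t / (n + 1)) t := fun n m hnm =>
    visitsThree_subset h.poisson (hpos m) (by gcongr)
  have hae : {ω | (X t ω, Y t ω) ∉ singularSet (c * t)} =ᵐ[P]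
      ⋃ n : ℕ, visitsThree N K (t / (n + 1)) t := by
    have h1 : ∀ᵐ ω ∂P, ∀ n : ℕ, ω ∉ visitsThree N K (t / (n + 1)) t ∩
        {ω | (X t ω, Y t ω) ∈ singularSet (c * t)} := ae_all_iff.2 fun n =>
      measure_eq_zero_iff_ae_notMem.1 (h.measure_visitsThree_inter_eq_zero hc hlam hlam0 (hpos n)
        (hle n) (isClosed_singularSet _).measurableSet (volume_singularSet _))
    filter_upwards [h1] with ω hω
    refine propext ⟨fun (h2 : _ ∉ singularSet _) => ?_, fun h2 h3 => ?_⟩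
    · by_contra hcon
      refine h2 (h.mem_singularSet hc ht fun s hs hst h3 => hcon ?_)
      obtain ⟨n, hn⟩ := exists_nat_gt (t / s)
      refine mem_iUnion.2 ⟨n, visitsThree_subset h.poisson (hpos n) ?_ h3⟩
      rw [div_le_iff₀ (by positivity)]
      rw [div_lt_iff₀ hs] at hn
      nlinarith
    · obtain ⟨n, hn⟩ := mem_iUnion.1 (show ω ∈ ⋃ n : ℕ, visitsThree N K (t / (n + 1)) t from h2)
      exact hω n ⟨hn, h3⟩
  rw [measureReal_congr hae]
  have h2 := (ENNReal.tendsto_toReal (measure_ne_top P _)).comp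
    (tendsto_measure_iUnion_atTop (μ := P) hmono)
  refine h2.congr fun n => ?_
  rw [← h.measureReal_compl_visitsThree hlam0 (hpos n) (hle n),
    probReal_compl_eq_one_sub (measurableSet_visitsThree h (hpos n) (hle n))]
  simp [measureReal_def]

lemma tendsto_div_add_one (t : ℝ) : Tendsto (fun n : ℕ => t / ((n : ℝ) + 1)) atTop (𝓝 0) := by
  have := (tendsto_one_div_add_atTop_nhds_zero_nat (𝕜 := ℝ)).const_mul t
  simpa [div_eq_mul_inv] using this

lemma IsReflectingMotion.measureReal_notMem_singularSet [IsProbabilityMeasure P]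
    (h : IsReflectingMotion P c lam N K X Y) (hc : 0 < c)
    (hlam : ContinuousOn lam (Ioi 0)) (hlam0 : ∀ t, 0 < t → 0 ≤ lam t) {t : ℝ} (ht : 0 < t)
    (hint : IntegrableOn lam (Ioc 0 t)) :
    P.real {ω | (X t ω, Y t ω) ∉ singularSet (c * t)} =
      1 - 3 * Real.exp (-(2 / 3) * ∫ s in (0 : ℝ)..t, lam s)
        + 2 * Real.exp (-∫ s in (0 : ℝ)..t, lam s) := by
  have hcont := intervalIntegral.continuousOn_primitive_interval_left (f := lam) (a := 0) (b := t)
    (μ := volume) (by rw [uIcc_of_le ht.le]; exact (integrableOn_Icc_iff_integrableOn_Ioc).2 hint)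
  have hle : ∀ n : ℕ, t / ((n : ℝ) + 1) ∈ uIcc 0 t := fun n => by
    rw [uIcc_of_le ht.le]
    exact ⟨by positivity, div_le_self ht.le (by linarith [(Nat.cast_nonneg n : (0 : ℝ) ≤ n)])⟩
  have hlim : Tendsto (fun n : ℕ => ∫ u in (t / ((n : ℝ) + 1))..t, lam u) atTop
      (𝓝 (∫ u in (0 : ℝ)..t, lam u)) :=
    (hcont 0 left_mem_uIcc).tendsto.comp
      (tendsto_nhdsWithin_iff.2 ⟨tendsto_div_add_one t, Eventually.of_forall hle⟩)
  refine tendsto_nhds_unique (h.tendsto_measureReal_singularSet hc hlam hlam0 ht) ?_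
  have h1 := ((Real.continuous_exp.tendsto _).comp (hlim.const_mul (-(2 / 3)))).const_mul 3
  have h2 := ((Real.continuous_exp.tendsto _).comp hlim.neg).const_mul 2
  have h3 := (h1.sub h2).const_sub 1
  refine (h3.congr fun n => rfl).trans (le_of_eq ?_)
  congr 1
  ring

/-- Monotone integrals of a nonnegative rate either diverge or are bounded, and boundedness would
make the rate integrable at `0`. Hence both exponentials tend to `0`. -/
lemma IsReflectingMotion.measureReal_notMem_singularSet_eq_one [IsProbabilityMeasure P]
    (h : IsReflectingMotion P c lam N K X Y) (hc : 0 < c)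
    (hlam : ContinuousOn lam (Ioi 0)) (hlam0 : ∀ t, 0 < t → 0 ≤ lam t) {t : ℝ} (ht : 0 < t)
    (hint : ¬ IntegrableOn lam (Ioc 0 t)) :
    P.real {ω | (X t ω, Y t ω) ∉ singularSet (c * t)} = 1 := by
  have hpos : ∀ n : ℕ, 0 < t / ((n : ℝ) + 1) := fun n => by positivity
  have hle : ∀ n : ℕ, t / ((n : ℝ) + 1) ≤ t := fun n =>
    div_le_self ht.le (by linarith [(Nat.cast_nonneg n : (0 : ℝ) ≤ n)])
  have hmono : Monotone fun n : ℕ => ∫ u in (t / ((n : ℝ) + 1))..t, lam u := by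
    intro n m hnm
    have h1 : t / ((m : ℝ) + 1) ≤ t / ((n : ℝ) + 1) := by gcongr
    have h2 := intervalIntegral.integral_add_adjacent_intervals
      (intervalIntegrable_rate hlam (hpos m) (hpos n)) (intervalIntegrable_rate hlam (hpos n) ht)
    have h3 := integral_rate_nonneg hlam0 (hpos m) h1
    simp only
    linarith
  have hlim : Tendsto (fun n : ℕ => ∫ u in (t / ((n : ℝ) + 1))..t, lam u) atTop atTop := by
    refine (tendsto_atTop_of_monotone hmono).resolve_right ?_
    rintro ⟨l, hl⟩
    refine hint (integrableOn_Ioc_of_intervalIntegral_norm_bounded_left (I := l)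
      (l := atTop) (a := fun n : ℕ => t / ((n : ℝ) + 1)) (fun n => ?_) (tendsto_div_add_one t) ?_)
    · exact (intervalIntegrable_rate hlam (hpos n) ht).1
    · refine Eventually.of_forall fun n => ?_
      refine le_trans (le_of_eq ?_) (hmono.ge_of_tendsto hl n)
      rw [intervalIntegral.integral_of_le (hle n)]
      refine setIntegral_congr_fun measurableSet_Ioc fun u hu => ?_
      exact Real.norm_of_nonneg (hlam0 u ((hpos n).trans hu.1))
  refine tendsto_nhds_unique (h.tendsto_measureReal_singularSet hc hlam hlam0 ht) ?_
  have h1 := (Real.tendsto_exp_neg_atTop_nhds_zero.comp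
    (hlim.const_mul_atTop (by norm_num : (0 : ℝ) < 2 / 3))).const_mul 3
  have h2 := (Real.tendsto_exp_neg_atTop_nhds_zero.comp hlim).const_mul 2
  have h3 := (h1.sub h2).const_sub 1
  refine (h3.congr fun n => ?_).trans (le_of_eq ?_)
  · simp
  · norm_num

end Mass
-- Lebesgue decomposition with singular part carried by a known null set.
section LebesgueDecomposition

variable {α : Type*} {mα : MeasurableSpace α} {μ ν : Measure α}

/-- The restrictions of `μ` to `S` and to its complement are singular and absolutely continuous;
uniqueness of the Lebesgue decomposition identifies them. -/
lemma withDensity_rnDeriv_eq_restrict_compl [IsFiniteMeasure μ] [SigmaFinite ν] {S : Set α}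
    (hS : MeasurableSet S) (hν : ν S = 0) (hμ : μ.restrict Sᶜ ≪ ν) :
    ν.withDensity (μ.rnDeriv ν) = μ.restrict Sᶜ := by
  have h1 := Measure.withDensity_rnDeriv_eq _ _ hμ
  have hs : μ.restrict S ⟂ₘ ν := by
    refine ⟨Sᶜ, hS.compl, ?_, by simpa using hν⟩
    rw [Measure.restrict_apply hS.compl]
    simp
  have h2 := Measure.eq_rnDeriv (Measure.measurable_rnDeriv (μ.restrict Sᶜ) ν) hs
    (by rw [h1, Measure.restrict_add_restrict_compl hS])
  rw [← withDensity_congr_ae h2, h1]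

lemma integral_rnDeriv_mul [IsFiniteMeasure μ] [SigmaFinite ν] {S : Set α}
    (hS : MeasurableSet S) (hν : ν S = 0) (hμ : μ.restrict Sᶜ ≪ ν) {g : α → ℝ}
    (hg : ∀ x ∈ S, g x = 0) : ∫ x, (μ.rnDeriv ν x).toReal * g x ∂ν = ∫ x, g x ∂μ := by
  have h := integral_withDensity_eq_integral_toReal_smul (Measure.measurable_rnDeriv μ ν)
    (Measure.rnDeriv_lt_top μ ν) g
  rw [withDensity_rnDeriv_eq_restrict_compl hS hν hμ] at h
  simp only [smul_eq_mul] at h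
  rw [← h]
  exact setIntegral_eq_integral_of_forall_compl_eq_zero fun x hx => hg x (by simpa using hx)

end LebesgueDecomposition

/-! ### From expectations to pairings with the density. -/

section Density

open Filter Topology

variable {Ω : Type*} {mΩ : MeasurableSpace Ω} {P : Measure Ω}
variable {lam : ℝ → ℝ} {N : ℝ → Ω → ℤ} {K : ℤ → Ω → Fin 4} {c : ℝ} {X Y : ℝ → Ω → ℝ}

lemma IsAbsContDensity.ae_nonneg {μ : Measure (ℝ × ℝ)} {f : ℝ → ℝ → ℝ} (h : IsAbsContDensity μ f) :
    ∀ᵐ z : ℝ × ℝ, 0 ≤ f z.1 z.2 := by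
  filter_upwards [h] with z hz
  rw [hz]
  exact ENNReal.toReal_nonneg

lemma IsAbsContDensity.integrable {μ : Measure (ℝ × ℝ)} [IsFiniteMeasure μ] {f : ℝ → ℝ → ℝ}
    (h : IsAbsContDensity μ f) : Integrable fun z : ℝ × ℝ => f z.1 z.2 :=
  (integrable_congr h).2 Measure.integrable_toReal_rnDeriv

lemma IsReflectingMotion.restrict_law_absolutelyContinuous [IsProbabilityMeasure P]
    (h : IsReflectingMotion P c lam N K X Y) (hc : 0 < c)
    (hlam : ContinuousOn lam (Ioi 0)) (hlam0 : ∀ t, 0 < t → 0 ≤ lam t) {t : ℝ} (ht : 0 < t) :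
    (P.map fun ω => (X t ω, Y t ω)).restrict (singularSet (c * t))ᶜ ≪ volume := by
  refine Measure.AbsolutelyContinuous.mk fun B hB hB0 => ?_
  rw [Measure.restrict_apply hB, Measure.map_apply (h.measurable_position t)
    (hB.inter (isClosed_singularSet _).measurableSet.compl), preimage_inter, inter_comm]
  exact h.measure_notMem_singularSet_inter hc hlam hlam0 ht hB hB0

lemma IsReflectingMotion.integral_density_mul [IsProbabilityMeasure P]
    (h : IsReflectingMotion P c lam N K X Y) (hc : 0 < c)
    (hlam : ContinuousOn lam (Ioi 0)) (hlam0 : ∀ t, 0 < t → 0 ≤ lam t) {t : ℝ} (ht : 0 < t)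
    {f : ℝ → ℝ → ℝ} (hf : IsAbsContDensity (P.map fun ω => (X t ω, Y t ω)) f)
    {ψ : ℝ × ℝ → ℝ} (hψ : Measurable ψ) (hψ0 : ∀ z ∈ singularSet (c * t), ψ z = 0) :
    ∫ z : ℝ × ℝ, f z.1 z.2 * ψ z = positionMean P X Y ψ t := by
  have := Measure.isProbabilityMeasure_map (μ := P) (h.measurable_position t).aemeasurable
  rw [positionMean, ← integral_map (h.measurable_position t).aemeasurable hψ.aestronglyMeasurable,
    ← integral_rnDeriv_mul (isClosed_singularSet (c * t)).measurableSet (volume_singularSet _)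
      (h.restrict_law_absolutelyContinuous hc hlam hlam0 ht) hψ0]
  refine integral_congr_ae ?_
  filter_upwards [hf] with z hz
  rw [hz]

lemma measurableSet_square (r : ℝ) : MeasurableSet (square r) :=
  measurableSet_le (by fun_prop) measurable_const

/-- Tested against the indicator of the square minus the singular set: the removed set is Lebesgue
null, and the motion never leaves the square. -/
lemma IsReflectingMotion.integral_density [IsProbabilityMeasure P]
    (h : IsReflectingMotion P c lam N K X Y) (hc : 0 < c)
    (hlam : ContinuousOn lam (Ioi 0)) (hlam0 : ∀ t, 0 < t → 0 ≤ lam t) {t : ℝ} (ht : 0 < t)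
    {f : ℝ → ℝ → ℝ} (hf : IsAbsContDensity (P.map fun ω => (X t ω, Y t ω)) f) :
    ∫ z in square (c * t), f z.1 z.2 = P.real {ω | (X t ω, Y t ω) ∉ singularSet (c * t)} := by
  have hSm := (isClosed_singularSet (c * t)).measurableSet
  have h1 := h.integral_density_mul hc hlam hlam0 ht hf
    (ψ := (square (c * t) \ singularSet (c * t)).indicator 1)
    (measurable_one.indicator ((measurableSet_square _).diff hSm))
    fun z hz => indicator_of_notMem (fun h => h.2 hz) _
  have h2 : ∫ z : ℝ × ℝ, f z.1 z.2 * (square (c * t) \ singularSet (c * t)).indicator 1 z =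
      ∫ z in square (c * t), f z.1 z.2 := by
    rw [← integral_indicator (measurableSet_square _)]
    refine integral_congr_ae ?_
    filter_upwards [measure_eq_zero_iff_ae_notMem.1 (volume_singularSet (c * t))] with z hz
    by_cases hz' : z ∈ square (c * t) <;> simp [indicator, hz, hz']
  rw [← h2, h1, positionMean,
    ← integral_indicator_one (s := {ω | (X t ω, Y t ω) ∉ singularSet (c * t)})
      (measurableSet_preimage (h.measurable_position t) hSm.compl)]
  refine integral_congr_ae (Eventually.of_forall fun ω => ?_)
  have h3 : (X t ω, Y t ω) ∈ square (c * t) := h.abs_add_abs_le hc ht.le ω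
  by_cases h4 : (X t ω, Y t ω) ∈ singularSet (c * t) <;> simp [indicator, h3, h4]

/-- Supports away from the singular set stay away from it for a short time. -/
lemma eventually_disjoint_singularSet {T : Set (ℝ × ℝ)} (hT : IsCompact T) {t : ℝ}
    (h : Disjoint T (singularSet (c * t))) : ∀ᶠ s in 𝓝 t, Disjoint T (singularSet (c * s)) := by
  have hcl : IsClosed {q : ℝ × (ℝ × ℝ) | q.2 ∈ singularSet (c * q.1)} :=
    (isClosed_eq (f := fun q : ℝ × (ℝ × ℝ) => q.2.1) (by fun_prop) continuous_const).union
      ((isClosed_eq (f := fun q : ℝ × (ℝ × ℝ) => q.2.2) (by fun_prop) continuous_const).union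
        (isClosed_eq (by fun_prop) (by fun_prop)))
  have h1 : ({t} : Set ℝ) ×ˢ T ⊆ {q : ℝ × (ℝ × ℝ) | q.2 ∈ singularSet (c * q.1)}ᶜ := by
    rintro ⟨s, z⟩ ⟨hs, hz⟩ hq
    rw [mem_singleton_iff] at hs
    subst hs
    exact Set.disjoint_left.1 h hz hq
  obtain ⟨U, V, hU, -, htU, hTV, hUV⟩ := generalized_tube_lemma isCompact_singleton hT
    hcl.isOpen_compl h1
  filter_upwards [hU.mem_nhds (htU rfl)] with s hs
  exact Set.disjoint_left.2 fun z hz hq => hUV (show (s, z) ∈ U ×ˢ V from ⟨hs, hTV hz⟩) hq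

lemma disjoint_openSquareOffDiagonals_singularSet (r : ℝ) :
    Disjoint (openSquareOffDiagonals r) (singularSet r) := by
  refine Set.disjoint_left.2 fun z hz hz' => ?_
  rcases hz' with h | h | h
  · exact hz.2.1 h
  · exact hz.2.2 h
  · exact hz.1.ne h

/-- The singular set moves with time, but a compact support disjoint from it at `t` stays disjoint
for nearby times. Equality on a neighbourhood, not just at `t`, is what permits time derivatives. -/
lemma IsReflectingMotion.pairing_eventuallyEq [IsProbabilityMeasure P]
    (h : IsReflectingMotion P c lam N K X Y) (hc : 0 < c)
    (hlam : ContinuousOn lam (Ioi 0)) (hlam0 : ∀ t, 0 < t → 0 ≤ lam t) {p : ℝ → ℝ → ℝ → ℝ}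
    (hp : ∀ t, 0 < t → IsAbsContDensity (P.map fun ω => (X t ω, Y t ω)) fun x y => p x y t)
    {φ : ℝ → ℝ → ℝ} (hφ : Measurable fun z : ℝ × ℝ => φ z.1 z.2) {T : Set (ℝ × ℝ)}
    (hT : IsCompact T) (hφT : ∀ z ∉ T, φ z.1 z.2 = 0) {t : ℝ} (ht : 0 < t)
    (hd : Disjoint T (singularSet (c * t))) :
    pairing p φ =ᶠ[𝓝 t] positionMean P X Y fun z => φ z.1 z.2 := by
  filter_upwards [eventually_disjoint_singularSet hT hd, lt_mem_nhds ht] with s hs hs0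
  exact h.integral_density_mul hc hlam hlam0 hs0 (hp s hs0) hφ
    fun z hz => hφT z (Set.disjoint_right.1 hs hz)

lemma laplacian_eq_dirDeriv_of_isTest {φ : ℝ → ℝ → ℝ} (hφ : IsTest fun z : ℝ × ℝ => φ z.1 z.2) :
    (fun z : ℝ × ℝ => laplacian φ z.1 z.2) =
      fun z => dirDeriv (1, 0) (dirDeriv (1, 0) fun z : ℝ × ℝ => φ z.1 z.2) z +
        dirDeriv (0, 1) (dirDeriv (0, 1) fun z : ℝ × ℝ => φ z.1 z.2) z :=
  funext fun z => laplacian_eq_dirDeriv (hφ.contDiffAt_nat 2 z)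

lemma dxxyy_eq_dirDeriv_of_isTest {φ : ℝ → ℝ → ℝ} (hφ : IsTest fun z : ℝ × ℝ => φ z.1 z.2) :
    (fun z : ℝ × ℝ => dxxyy φ z.1 z.2) =
      dirDeriv (1, 0) (dirDeriv (1, 0) (dirDeriv (0, 1) (dirDeriv (0, 1)
        fun z : ℝ × ℝ => φ z.1 z.2))) :=
  funext fun z => dxxyy_eq_dirDeriv (hφ.contDiffAt_nat 4 z)

lemma dirDeriv_eq_zero_of_notMem_tsupport {E : Type*} [NormedAddCommGroup E] [NormedSpace ℝ E]
    {ψ : E → ℝ} {v z : E} (hz : z ∉ tsupport ψ) : dirDeriv v ψ z = 0 := by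
  have h : fderiv ℝ ψ z = 0 := by
    by_contra hne
    exact hz (support_fderiv_subset ℝ (Function.mem_support.2 hne))
  simp [dirDeriv, h]

lemma tsupport_dirDeriv_subset {E : Type*} [NormedAddCommGroup E] [NormedSpace ℝ E]
    (v : E) (ψ : E → ℝ) : tsupport (dirDeriv v ψ) ⊆ tsupport ψ :=
  closure_minimal (fun _ hz => by_contra fun h => hz (dirDeriv_eq_zero_of_notMem_tsupport h))
    (isClosed_tsupport _)

/-- The equation tested in space, for supports away from the singular set. -/
theorem IsReflectingMotion.tested_equation [IsProbabilityMeasure P]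
    (h : IsReflectingMotion P c lam N K X Y) (hc : 0 < c)
    (hlam : ContDiffOn ℝ 2 lam (Ioi 0)) (hlam0 : ∀ t, 0 < t → 0 ≤ lam t) {p : ℝ → ℝ → ℝ → ℝ}
    (hp : ∀ t, 0 < t → IsAbsContDensity (P.map fun ω => (X t ω, Y t ω)) fun x y => p x y t)
    {φ : ℝ → ℝ → ℝ} (hφ : IsTest fun z : ℝ × ℝ => φ z.1 z.2) {t : ℝ} (ht : 0 < t)
    (hd : Disjoint (tsupport fun z : ℝ × ℝ => φ z.1 z.2) (singularSet (c * t))) :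
    ContDiffAt ℝ 4 (pairing p φ) t ∧ SatisfiesTestedEquationAt c lam p φ t := by
  obtain ⟨h1, h2⟩ := h.equation hc hlam hlam0 hφ ht
  have hT : IsCompact (tsupport fun z : ℝ × ℝ => φ z.1 z.2) := hφ.compact
  have hl := laplacian_eq_dirDeriv_of_isTest hφ
  have hx := dxxyy_eq_dirDeriv_of_isTest hφ
  have hts : ∀ v w z, z ∉ (tsupport fun z : ℝ × ℝ => φ z.1 z.2) →
      dirDeriv v (dirDeriv w fun z : ℝ × ℝ => φ z.1 z.2) z = 0 := fun v w z hz =>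
    dirDeriv_eq_zero_of_notMem_tsupport fun hz' => hz (tsupport_dirDeriv_subset _ _ hz')
  have e1 := h.pairing_eventuallyEq hc hlam.continuousOn hlam0 hp hφ.smooth.continuous.measurable hT
    (fun z hz => image_eq_zero_of_notMem_tsupport (f := fun z : ℝ × ℝ => φ z.1 z.2) hz) ht hd
  have e2 := h.pairing_eventuallyEq hc hlam.continuousOn hlam0 hp (φ := laplacian φ)
    (by
      rw [hl]
      exact (((hφ.dirDeriv _).dirDeriv _).smooth.continuous.add
        ((hφ.dirDeriv _).dirDeriv _).smooth.continuous).measurable) hT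
    (fun z hz => by rw [congrFun hl z, hts _ _ z hz, hts _ _ z hz, add_zero]) ht hd
  have e3 := h.pairing_eventuallyEq hc hlam.continuousOn hlam0 hp (φ := dxxyy φ)
    (by
      rw [hx]
      exact ((((hφ.dirDeriv _).dirDeriv _).dirDeriv _).dirDeriv _).smooth.continuous.measurable) hT
    (fun z hz => by
      rw [congrFun hx z]
      exact dirDeriv_eq_zero_of_notMem_tsupport fun hz' => hz ((tsupport_dirDeriv_subset _ _).trans
        ((tsupport_dirDeriv_subset _ _).trans (tsupport_dirDeriv_subset _ _)) hz')) ht hd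
  refine ⟨h1.congr_of_eventuallyEq e1, ?_⟩
  rw [SatisfiesTestedEquationAt, timeOpFour_congr e1, timeOpTwo_congr e2, e3.eq_of_nhds]
  exact h2

end Density
-- Integration by parts and differentiation under the integral.
section IntegrationByParts

open Filter Topology

lemma continuous_mul_of_tsupport_subset {α : Type*} [TopologicalSpace α] {g φ : α → ℝ} {W : Set α}
    (hW : IsOpen W) (hg : ContinuousOn g W) (hφ : Continuous φ) (h : tsupport φ ⊆ W) :
    Continuous fun z => g z * φ z := by
  refine continuous_of_tsupport fun z hz => ?_
  have hz' : z ∈ W := h (tsupport_mul_subset_right hz)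
  exact (hg.continuousAt (hW.mem_nhds hz')).mul hφ.continuousAt

lemma integrable_mul_of_tsupport_subset {g φ : ℝ × ℝ → ℝ} {W : Set (ℝ × ℝ)}
    (hW : IsOpen W) (hg : ContinuousOn g W) (hφ : Continuous φ) (hφ' : HasCompactSupport φ)
    (h : tsupport φ ⊆ W) : Integrable fun z => g z * φ z :=
  (continuous_mul_of_tsupport_subset hW hg hφ h).integrable_of_hasCompactSupport hφ'.mul_left

lemma contDiffOn_dirDeriv {E : Type*} [NormedAddCommGroup E] [NormedSpace ℝ E] {F : E → ℝ}
    {W : Set E} (hW : IsOpen W) {n m : ℕ} (h : ContDiffOn ℝ n F W) (hm : m + 1 ≤ n) (v : E) :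
    ContDiffOn ℝ m (dirDeriv v F) W := fun _ hz =>
  (contDiffAt_dirDeriv (h.contDiffAt (hW.mem_nhds hz)) hm v).contDiffWithinAt

lemma contDiffOn_dirDeriv_iterate {E : Type*} [NormedAddCommGroup E] [NormedSpace ℝ E] {F : E → ℝ}
    {W : Set E} (hW : IsOpen W) {n : ℕ} (h : ContDiffOn ℝ n F W) (v : E) :
    ∀ {k m : ℕ}, m + k ≤ n → ContDiffOn ℝ m ((dirDeriv v)^[k] F) W := by
  intro k
  induction k with
  | zero => intro m hm; exact h.of_le (by exact_mod_cast hm)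
  | succ k ih =>
    intro m hm
    rw [Function.iterate_succ_apply']
    exact contDiffOn_dirDeriv hW (ih (m := m + 1) (by omega)) le_rfl v

lemma integral_mul_dirDeriv {g φ : ℝ × ℝ → ℝ} {W : Set (ℝ × ℝ)} (hW : IsOpen W)
    (hg : ContDiffOn ℝ 1 g W) (hφ : IsTest φ) (h : tsupport φ ⊆ W) (v : ℝ × ℝ) :
    ∫ z, g z * dirDeriv v φ z = -∫ z, dirDeriv v g z * φ z := by
  have hφ' := hφ.dirDeriv v
  refine integral_mul_fderiv_eq_neg_fderiv_mul_of_integrable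
    (integrable_mul_of_tsupport_subset (g := dirDeriv v g) hW
      (contDiffOn_dirDeriv (n := 1) (m := 0) hW hg le_rfl v).continuousOn
      hφ.smooth.continuous hφ.compact h)
    (integrable_mul_of_tsupport_subset hW hg.continuousOn hφ'.smooth.continuous hφ'.compact
      ((tsupport_dirDeriv_subset v φ).trans h))
    (integrable_mul_of_tsupport_subset hW hg.continuousOn hφ.smooth.continuous hφ.compact h)
    (fun z hz => (hg.contDiffAt (hW.mem_nhds (h hz))).differentiableAt (by simp))
    fun z _ => (hφ.contDiffAt_nat 1 z).differentiableAt (by simp)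

lemma integral_mul_dirDeriv_dirDeriv {g φ : ℝ × ℝ → ℝ} {W : Set (ℝ × ℝ)} (hW : IsOpen W)
    (hg : ContDiffOn ℝ 2 g W) (hφ : IsTest φ) (h : tsupport φ ⊆ W) (v : ℝ × ℝ) :
    ∫ z, g z * dirDeriv v (dirDeriv v φ) z = ∫ z, dirDeriv v (dirDeriv v g) z * φ z := by
  rw [integral_mul_dirDeriv hW (hg.of_le (by norm_num)) (hφ.dirDeriv v)
    ((tsupport_dirDeriv_subset v φ).trans h), integral_mul_dirDeriv hW
    (contDiffOn_dirDeriv (n := 2) (m := 1) hW hg le_rfl v) hφ h, neg_neg]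

/-- Differentiation in time of `∫ H(x, y, t) φ(x, y) dx dy`. -/
lemma hasDerivAt_integral_mul {O : Set (ℝ × ℝ × ℝ)} (hO : IsOpen O) {H : ℝ × ℝ × ℝ → ℝ}
    (hH : ContDiffOn ℝ 1 H O) {φ : ℝ × ℝ → ℝ} (hφ : Continuous φ) (hφ' : HasCompactSupport φ)
    {U : Set ℝ} (hU : IsOpen U) (h : ∀ z ∈ tsupport φ, ∀ s ∈ U, (z.1, z.2, s) ∈ O) {t : ℝ}
    (ht : t ∈ U) : HasDerivAt (fun s => ∫ z : ℝ × ℝ, H (z.1, z.2, s) * φ z)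
      (∫ z : ℝ × ℝ, dirDeriv (0, 0, 1) H (z.1, z.2, t) * φ z) t := by
  have hslice : ∀ s : ℝ, Continuous fun z : ℝ × ℝ => (z.1, z.2, s) := fun s => by fun_prop
  have hD : ContinuousOn (dirDeriv (0, 0, 1) H) O :=
    (contDiffOn_dirDeriv (n := 1) (m := 0) hO hH le_rfl _).continuousOn
  have hcont : ∀ {G : ℝ × ℝ × ℝ → ℝ}, ContinuousOn G O → ∀ s ∈ U,
      Continuous fun z : ℝ × ℝ => G (z.1, z.2, s) * φ z := fun hG s hs =>
    continuous_mul_of_tsupport_subset (hO.preimage (hslice s))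
      (hG.comp (hslice s).continuousOn fun z hz => hz) hφ fun z hz => h z hz s hs
  obtain ⟨ε, hε, hεU⟩ := Metric.nhds_basis_closedBall.mem_iff.1 (hU.mem_nhds ht)
  have hK : IsCompact ((fun q : (ℝ × ℝ) × ℝ => (q.1.1, q.1.2, q.2)) ''
      (tsupport φ ×ˢ Metric.closedBall t ε)) :=
    (IsCompact.prod hφ' (isCompact_closedBall t ε)).image (by fun_prop)
  -- The dominating function is `C * |φ|`, with `C` a bound for the time derivative on the support
  -- of `φ` times a short closed time interval.
  obtain ⟨C, hC⟩ := hK.exists_bound_of_continuousOn (hD.mono (by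
    rintro _ ⟨⟨z, s⟩, ⟨hz, hs⟩, rfl⟩
    exact h z hz s (hεU hs)))
  refine (hasDerivAt_integral_of_dominated_loc_of_deriv_le (bound := fun z => C * |φ z|)
    (F := fun s (z : ℝ × ℝ) => H (z.1, z.2, s) * φ z)
    (F' := fun s (z : ℝ × ℝ) => dirDeriv (0, 0, 1) H (z.1, z.2, s) * φ z)
    (Metric.closedBall_mem_nhds t hε) ?_ ?_ ?_ ?_ ?_ ?_).2
  · filter_upwards [hU.mem_nhds ht] with s hs
    exact (hcont hH.continuousOn s hs).aestronglyMeasurable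
  · exact (hcont hH.continuousOn t ht).integrable_of_hasCompactSupport hφ'.mul_left
  · exact (hcont hD t ht).aestronglyMeasurable
  · refine Eventually.of_forall fun z s hs => ?_
    by_cases hz : z ∈ tsupport φ
    · rw [norm_mul, Real.norm_eq_abs (φ z)]
      exact mul_le_mul_of_nonneg_right (hC _ ⟨(z, s), ⟨hz, hs⟩, rfl⟩) (abs_nonneg _)
    · simp [image_eq_zero_of_notMem_tsupport hz]
  · exact (continuous_const.mul hφ.abs).integrable_of_hasCompactSupport hφ'.abs.mul_left
  · refine Eventually.of_forall fun z s hs => ?_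
    by_cases hz : z ∈ tsupport φ
    · have h1 := (hH.contDiffAt (hO.mem_nhds (h z hz s (hεU hs)))).differentiableAt
        (by simp)
      have h2 : HasDerivAt (fun s : ℝ => (z.1, z.2, s)) (0, 0, 1) s :=
        (hasDerivAt_const s z.1).prodMk ((hasDerivAt_const s z.2).prodMk (hasDerivAt_id s))
      exact (h1.hasFDerivAt.comp_hasDerivAt s h2).mul_const _
    · simp only [image_eq_zero_of_notMem_tsupport hz, mul_zero]
      exact hasDerivAt_const _ _

/-- Pure time derivatives of `H`. -/
lemma iteratedDeriv_slice {O : Set (ℝ × ℝ × ℝ)} (hO : IsOpen O) {H : ℝ × ℝ × ℝ → ℝ} {n : ℕ}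
    (hH : ContDiffOn ℝ n H O) {x y t : ℝ} (ht : (x, y, t) ∈ O) {k : ℕ} (hk : k ≤ n) :
    iteratedDeriv k (fun s => H (x, y, s)) t = (dirDeriv (0, 0, 1))^[k] H (x, y, t) := by
  have hU : IsOpen {s : ℝ | (x, y, s) ∈ O} := hO.preimage (by fun_prop)
  refine iteratedDeriv_eq_of_hasDerivAt hU
    (f := fun k s => (dirDeriv (0, 0, 1))^[k] H (x, y, s)) (n := n) (fun j hj s hs => ?_) k hk t ht
  have h1 := ((contDiffOn_dirDeriv_iterate hO hH (0, 0, 1) (k := j) (m := 1)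
    (by omega)).contDiffAt (hO.mem_nhds hs)).differentiableAt (by simp)
  have h2 : HasDerivAt (fun s : ℝ => (x, y, s)) (0, 0, 1) s :=
    (hasDerivAt_const s x).prodMk ((hasDerivAt_const s y).prodMk (hasDerivAt_id s))
  simp only [Function.iterate_succ_apply']
  exact h1.hasFDerivAt.comp_hasDerivAt s h2

lemma iteratedDeriv_integral_mul {O : Set (ℝ × ℝ × ℝ)} (hO : IsOpen O) {H : ℝ × ℝ × ℝ → ℝ} {n : ℕ}
    (hH : ContDiffOn ℝ n H O) {φ : ℝ × ℝ → ℝ} (hφ : Continuous φ) (hφ' : HasCompactSupport φ)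
    {t : ℝ} (h : ∀ z ∈ tsupport φ, (z.1, z.2, t) ∈ O) {k : ℕ} (hk : k ≤ n) :
    iteratedDeriv k (fun s => ∫ z : ℝ × ℝ, H (z.1, z.2, s) * φ z) t =
      ∫ z : ℝ × ℝ, (dirDeriv (0, 0, 1))^[k] H (z.1, z.2, t) * φ z := by
  have hO' : IsOpen {q : (ℝ × ℝ) × ℝ | (q.1.1, q.1.2, q.2) ∈ O} := hO.preimage (by fun_prop)
  -- Compactness of the support gives one time neighbourhood valid for all of its points, so the
  -- derivatives can be iterated on an open set of times.
  obtain ⟨V, U, -, hU, hV, htU, hVU⟩ := generalized_tube_lemma (s := tsupport φ) (t := {t}) hφ'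
    isCompact_singleton hO' (by
      rintro ⟨z, s⟩ ⟨hz, hs⟩
      rw [mem_singleton_iff] at hs
      subst hs
      exact h z hz)
  refine iteratedDeriv_eq_of_hasDerivAt hU
    (f := fun k s => ∫ z : ℝ × ℝ, (dirDeriv (0, 0, 1))^[k] H (z.1, z.2, s) * φ z) (n := n)
    (fun j hj s hs => ?_) k hk t (htU rfl)
  simp only [Function.iterate_succ_apply']
  exact hasDerivAt_integral_mul hO (contDiffOn_dirDeriv_iterate hO hH _ (by omega)) hφ hφ' hU
    (fun z hz s hs => hVU (show (z, s) ∈ V ×ˢ U from ⟨hV hz, hs⟩)) hs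

end IntegrationByParts

/-! ### From the tested equation to the classical one. -/

section Classical

open Filter Topology

variable {Ω : Type*} {mΩ : MeasurableSpace Ω} {P : Measure Ω}
variable {lam : ℝ → ℝ} {N : ℝ → Ω → ℤ} {K : ℤ → Ω → Fin 4} {c : ℝ} {X Y : ℝ → Ω → ℝ}

/-- The equation holds at every point of a slice if it holds in the sense of distributions off a
closed null set. -/
theorem satisfiesEquationAt_of_tested {p : ℝ → ℝ → ℝ → ℝ} {O : Set (ℝ × ℝ × ℝ)} (hO : IsOpen O)
    (hp : ContDiffOn ℝ 4 (fun q : ℝ × ℝ × ℝ => p q.1 q.2.1 q.2.2) O) {t : ℝ} {S : Set (ℝ × ℝ)}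
    (hS : IsClosed S) (hS0 : volume S = 0)
    (htest : ∀ φ : ℝ → ℝ → ℝ, (IsTest fun z : ℝ × ℝ => φ z.1 z.2) →
      Disjoint (tsupport fun z : ℝ × ℝ => φ z.1 z.2) S → SatisfiesTestedEquationAt c lam p φ t)
    {x y : ℝ} (hxy : (x, y, t) ∈ O) : SatisfiesEquationAt c lam p x y t := by
  set F : ℝ × ℝ × ℝ → ℝ := fun q => p q.1 q.2.1 q.2.2 with hF
  set W : Set (ℝ × ℝ) := {z | (z.1, z.2, t) ∈ O} with hW
  have hWo : IsOpen W := hO.preimage (by fun_prop)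
  set D : ℕ → ℝ × ℝ → ℝ := fun k z => (dirDeriv (0, 0, 1))^[k] F (z.1, z.2, t) with hD
  have hDc : ∀ {k m : ℕ}, m + k ≤ 4 → ContDiffOn ℝ m (D k) W := fun {k m} hk =>
    (contDiffOn_dirDeriv_iterate (n := 4) hO hp (0, 0, 1) hk).comp
      (f := fun z : ℝ × ℝ => (z.1, z.2, t))
      (contDiff_fst.prodMk (contDiff_snd.prodMk contDiff_const)).contDiffOn fun _ hz => hz
  set a : ℝ := 16 / 3 * lam t ^ 2 + 4 * deriv lam t with ha
  set b : ℝ := 64 / 27 * lam t ^ 3 + 16 / 3 * lam t * deriv lam t + 4 / 3 * iteratedDeriv 2 lam t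
    with hb
  set κ : ℝ := 8 / 9 * lam t ^ 2 + 2 / 3 * deriv lam t with hκ
  set G : ℝ × ℝ → ℝ := fun z => D 2 z + 2 * lam t * D 1 z + κ * D 0 z with hG
  have hGc : ContDiffOn ℝ 2 G W :=
    ((hDc (k := 2) (m := 2) le_rfl).add (contDiffOn_const.mul (hDc (k := 1) (m := 2) (by norm_num)))).add
      (contDiffOn_const.mul (hDc (k := 0) (m := 2) (by norm_num)))
  set A : ℝ × ℝ → ℝ := fun z => D 4 z + 4 * lam t * D 3 z + a * D 2 z + b * D 1 z with hA
  set M : ℝ × ℝ → ℝ :=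
    dirDeriv (1, 0) (dirDeriv (1, 0) (dirDeriv (0, 1) (dirDeriv (0, 1) (D 0)))) with hM
  set L : ℝ × ℝ → ℝ := fun z =>
    dirDeriv (1, 0) (dirDeriv (1, 0) G) z + dirDeriv (0, 1) (dirDeriv (0, 1) G) z with hL
  have hAc : ContinuousOn A W :=
    (((hDc (k := 4) (m := 0) le_rfl).continuousOn.add (continuousOn_const.mul
      (hDc (k := 3) (m := 0) (by norm_num)).continuousOn)).add (continuousOn_const.mul
      (hDc (k := 2) (m := 0) (by norm_num)).continuousOn)).add (continuousOn_const.mul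
      (hDc (k := 1) (m := 0) (by norm_num)).continuousOn)
  have hD3 : ContDiffOn ℝ 2 (dirDeriv (0, 1) (dirDeriv (0, 1) (D 0))) W :=
    contDiffOn_dirDeriv (n := 3) (m := 2) hWo (contDiffOn_dirDeriv (n := 4) (m := 3) hWo
      (hDc (k := 0) (m := 4) le_rfl) le_rfl _) le_rfl _
  have hsecond : ∀ {g : ℝ × ℝ → ℝ} (v : ℝ × ℝ), ContDiffOn ℝ 2 g W →
      ContinuousOn (dirDeriv v (dirDeriv v g)) W := fun v hg =>
    (contDiffOn_dirDeriv (n := 1) (m := 0) hWo (contDiffOn_dirDeriv (n := 2) (m := 1) hWo hg le_rfl v)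
      le_rfl v).continuousOn
  have hMc : ContinuousOn M W := hsecond _ hD3
  have hLc : ContinuousOn L W := (hsecond _ hGc).add (hsecond _ hGc)
  -- the classical equation in terms of `A`, `M`, `L`
  have htime : ∀ z ∈ W, ∀ k ≤ 4, iteratedDeriv k (fun s => p z.1 z.2 s) t = D k z :=
    fun z hz k hk => iteratedDeriv_slice (n := 4) hO hp hz hk
  have hclass : ∀ z ∈ W, timeOpFour lam (fun s => p z.1 z.2 s) t = A z ∧
      dxxyy (fun x' y' => p x' y' t) z.1 z.2 = M z ∧
      laplacian (fun x' y' => timeOpTwo lam (fun s => p x' y' s) t) z.1 z.2 = L z := by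
    intro z hz
    have h1 := fun k hk => htime z hz k hk
    refine ⟨?_, ?_, ?_⟩
    · rw [timeOpFour, h1 4 le_rfl, h1 3 (by norm_num), h1 2 (by norm_num),
        ← iteratedDeriv_one (f := fun s => p z.1 z.2 s), h1 1 (by norm_num)]
    · exact dxxyy_eq_dirDeriv (f := fun x' y' => p x' y' t)
        ((hDc (k := 0) (m := 4) le_rfl).contDiffAt (hWo.mem_nhds hz))
    · have h2 : (fun w : ℝ × ℝ => timeOpTwo lam (fun s => p w.1 w.2 s) t) =ᶠ[𝓝 z] G := by
        filter_upwards [hWo.mem_nhds hz] with w hw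
        rw [timeOpTwo, ← iteratedDeriv_one (f := fun s => p w.1 w.2 s), htime w hw 2 (by norm_num),
          htime w hw 1 (by norm_num)]
        rfl
      have h3 : ∀ v, dirDeriv v (dirDeriv v
          fun w : ℝ × ℝ => timeOpTwo lam (fun s => p w.1 w.2 s) t) z = dirDeriv v (dirDeriv v G) z := by
        intro v
        have h4 : dirDeriv v (fun w : ℝ × ℝ => timeOpTwo lam (fun s => p w.1 w.2 s) t) =ᶠ[𝓝 z]
            dirDeriv v G := h2.fderiv.mono fun w hw => by rw [dirDeriv, hw, dirDeriv]
        rw [dirDeriv, h4.fderiv_eq, dirDeriv]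
      rw [laplacian_eq_dirDeriv (f := fun x' y' => timeOpTwo lam (fun s => p x' y' s) t)
        ((hGc.contDiffAt (hWo.mem_nhds hz)).congr_of_eventuallyEq h2)]
      exact congrArg₂ _ (h3 _) (h3 _)
  -- the tested equation in terms of `A`, `M`, `L`
  have hweak : ∀ φ : ℝ × ℝ → ℝ, IsTest φ → tsupport φ ⊆ W \ S →
      ∫ z, φ z • (A z + c ^ 4 * M z - c ^ 2 * L z) = 0 := by
    intro φ hφ hφW
    have hsub : tsupport φ ⊆ W := hφW.trans sdiff_subset
    have hφx := (hφ.dirDeriv (1, 0)).dirDeriv (1, 0)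
    have hφy := (hφ.dirDeriv (0, 1)).dirDeriv (0, 1)
    have hsx : tsupport (dirDeriv (1, 0) (dirDeriv (1, 0) φ)) ⊆ W :=
      (tsupport_dirDeriv_subset _ _).trans ((tsupport_dirDeriv_subset _ _).trans hsub)
    have hsy : tsupport (dirDeriv (0, 1) (dirDeriv (0, 1) φ)) ⊆ W :=
      (tsupport_dirDeriv_subset _ _).trans ((tsupport_dirDeriv_subset _ _).trans hsub)
    have hint : ∀ {g ψ : ℝ × ℝ → ℝ}, ContinuousOn g W → IsTest ψ → tsupport ψ ⊆ W →
        Integrable fun z => g z * ψ z := fun hg hψ h =>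
      integrable_mul_of_tsupport_subset hWo hg hψ.smooth.continuous hψ.compact h
    have hDi : ∀ {ψ : ℝ × ℝ → ℝ}, IsTest ψ → tsupport ψ ⊆ W → ∀ k ≤ 4,
        Integrable fun z => D k z * ψ z := fun hψ h k hk =>
      hint (hDc (k := k) (m := 0) (by omega)).continuousOn hψ h
    have hpair : ∀ {ψ : ℝ × ℝ → ℝ}, IsTest ψ → tsupport ψ ⊆ W → ∀ k ≤ 4,
        iteratedDeriv k (pairing p fun x y => ψ (x, y)) t = ∫ z, D k z * ψ z := fun hψ h k hk =>
      iteratedDeriv_integral_mul (n := 4) hO hp hψ.smooth.continuous hψ.compact h hk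
    have e0 := htest (fun x y => φ (x, y)) hφ (Set.disjoint_left.2 fun z hz => (hφW hz).2)
    have el := laplacian_eq_dirDeriv_of_isTest (φ := fun x y => φ (x, y)) hφ
    have ex := dxxyy_eq_dirDeriv_of_isTest (φ := fun x y => φ (x, y)) hφ
    have e1 : timeOpFour lam (pairing p fun x y => φ (x, y)) t = ∫ z, A z * φ z := by
      have hp' := hpair hφ hsub
      have hi := hDi hφ hsub
      have i3 := (hi 3 (by norm_num)).const_mul (4 * lam t)
      have i2 := (hi 2 (by norm_num)).const_mul a
      have i1 := (hi 1 (by norm_num)).const_mul b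
      have i43 : Integrable fun z => D 4 z * φ z + 4 * lam t * (D 3 z * φ z) := (hi 4 le_rfl).add i3
      have i432 : Integrable fun z => D 4 z * φ z + 4 * lam t * (D 3 z * φ z) + a * (D 2 z * φ z) :=
        i43.add i2
      rw [timeOpFour, hp' 4 le_rfl, hp' 3 (by norm_num), hp' 2 (by norm_num),
        ← iteratedDeriv_one (f := pairing p fun x y => φ (x, y)), hp' 1 (by norm_num), ← ha, ← hb,
        ← integral_const_mul, ← integral_const_mul, ← integral_const_mul,
        ← integral_add (hi 4 le_rfl) i3, ← integral_add i43 i2, ← integral_add i432 i1]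
      refine integral_congr_ae (Eventually.of_forall fun z => ?_)
      simp only [hA]
      ring
    have e2 : pairing p (dxxyy fun x y => φ (x, y)) t = ∫ z, M z * φ z := by
      -- The derivatives of `φ` are reordered so that moving `∂y²` first and `∂x²` second produces
      -- `M` in its stated order.
      have h1 : pairing p (dxxyy fun x y => φ (x, y)) t =
          ∫ z, D 0 z * dirDeriv (0, 1) (dirDeriv (0, 1) (dirDeriv (1, 0) (dirDeriv (1, 0) φ))) z := by
        rw [hφ.dirDeriv_comm_two (1, 0) (0, 1)]
        exact integral_congr_ae (Eventually.of_forall fun z => congrArg (p z.1 z.2 t * ·) (congrFun ex z))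
      rw [h1, integral_mul_dirDeriv_dirDeriv hWo (hDc (k := 0) (m := 2) (by norm_num)) hφx hsx,
        integral_mul_dirDeriv_dirDeriv hWo hD3 hφ hsub]
    have e3 : timeOpTwo lam (pairing p (laplacian fun x y => φ (x, y))) t = ∫ z, L z * φ z := by
      have hΔ : IsTest fun z => dirDeriv (1, 0) (dirDeriv (1, 0) φ) z +
          dirDeriv (0, 1) (dirDeriv (0, 1) φ) z :=
        ⟨hφx.smooth.add hφy.smooth, hφx.compact.add hφy.compact⟩
      have hsΔ : (tsupport fun z => dirDeriv (1, 0) (dirDeriv (1, 0) φ) z +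
          dirDeriv (0, 1) (dirDeriv (0, 1) φ) z) ⊆ W :=
        (tsupport_add _ _).trans (union_subset hsx hsy)
      have hp' := hpair hΔ hsΔ
      have hi := hDi hΔ hsΔ
      have h1 : pairing p (laplacian fun x y => φ (x, y)) = pairing p fun x y =>
          dirDeriv (1, 0) (dirDeriv (1, 0) φ) (x, y) + dirDeriv (0, 1) (dirDeriv (0, 1) φ) (x, y) :=
        funext fun s => integral_congr_ae
          (Eventually.of_forall fun z => congrArg (p z.1 z.2 s * ·) (congrFun el z))
      have h2 : pairing p (fun x y => dirDeriv (1, 0) (dirDeriv (1, 0) φ) (x, y) +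
          dirDeriv (0, 1) (dirDeriv (0, 1) φ) (x, y)) t = ∫ z, D 0 z *
          (dirDeriv (1, 0) (dirDeriv (1, 0) φ) z + dirDeriv (0, 1) (dirDeriv (0, 1) φ) z) := rfl
      have h3 : ∫ z, G z * (dirDeriv (1, 0) (dirDeriv (1, 0) φ) z +
          dirDeriv (0, 1) (dirDeriv (0, 1) φ) z) = ∫ z, L z * φ z := by
        simp only [mul_add]
        rw [integral_add (hint hGc.continuousOn hφx hsx) (hint hGc.continuousOn hφy hsy),
          integral_mul_dirDeriv_dirDeriv hWo hGc hφ hsub,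
          integral_mul_dirDeriv_dirDeriv hWo hGc hφ hsub,
          ← integral_add (hint (hsecond _ hGc) hφ hsub) (hint (hsecond _ hGc) hφ hsub)]
        exact integral_congr_ae (Eventually.of_forall fun z => (add_mul _ _ _).symm)
      have i1 := (hi 1 (by norm_num)).const_mul (2 * lam t)
      have i0 := (hi 0 (by norm_num)).const_mul κ
      have i21 : Integrable fun z => D 2 z * (dirDeriv (1, 0) (dirDeriv (1, 0) φ) z +
          dirDeriv (0, 1) (dirDeriv (0, 1) φ) z) + 2 * lam t * (D 1 z *
          (dirDeriv (1, 0) (dirDeriv (1, 0) φ) z + dirDeriv (0, 1) (dirDeriv (0, 1) φ) z)) :=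
        (hi 2 (by norm_num)).add i1
      rw [← h3, h1, timeOpTwo, hp' 2 (by norm_num), ← iteratedDeriv_one (f := pairing p _),
        hp' 1 (by norm_num), h2, ← hκ, ← integral_const_mul, ← integral_const_mul,
        ← integral_add (hi 2 (by norm_num)) i1, ← integral_add i21 i0]
      refine integral_congr_ae (Eventually.of_forall fun z => ?_)
      simp only [hG]
      ring
    rw [SatisfiesTestedEquationAt, e1, e2, e3] at e0
    have iA := hint hAc hφ hsub
    have iM := (hint hMc hφ hsub).const_mul (c ^ 4)
    have iL := (hint hLc hφ hsub).const_mul (c ^ 2)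
    have iAM : Integrable fun z => A z * φ z + c ^ 4 * (M z * φ z) := iA.add iM
    rw [← integral_const_mul, ← integral_const_mul, ← integral_add iA iM, ← sub_eq_zero,
      ← integral_sub iAM iL] at e0
    rw [← e0]
    refine integral_congr_ae (Eventually.of_forall fun z => ?_)
    simp only [smul_eq_mul]
    ring
  have hEc : ContinuousOn (fun z => A z + c ^ 4 * M z - c ^ 2 * L z) W :=
    (hAc.add (continuousOn_const.mul hMc)).sub (continuousOn_const.mul hLc)
  -- The fundamental lemma gives the equation almost everywhere on `W \ S`, hence on `W` since `S`
  -- is null. Continuity of both sides on the open set `W` then gives it at every point, including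
  -- those of `S`.
  have hae := (hWo.sdiff hS).ae_eq_zero_of_integral_contDiff_smul_eq_zero (μ := volume)
    ((hEc.mono sdiff_subset).locallyIntegrableOn (hWo.sdiff hS).measurableSet)
    fun φ h1 h2 h3 => hweak φ ⟨h1, h2⟩ h3
  have hae' : (fun z => A z + c ^ 4 * M z - c ^ 2 * L z) =ᵐ[volume.restrict W] 0 := by
    refine (ae_restrict_iff' hWo.measurableSet).2 ?_
    filter_upwards [hae, measure_eq_zero_iff_ae_notMem.1 hS0] with z h1 h2 h3
    exact h1 ⟨h3, h2⟩
  have hE := Measure.eqOn_open_of_ae_eq hae' hWo hEc continuousOn_const (show (x, y) ∈ W from hxy)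
  obtain ⟨h1, h2, h3⟩ := hclass (x, y) hxy
  simp only at h1 h2 h3
  rw [SatisfiesEquationAt, h1, h2, h3]
  have hE : A (x, y) + c ^ 4 * M (x, y) - c ^ 2 * L (x, y) = 0 := hE
  linarith

/-- On an open set, two continuous functions equal almost everywhere, here `g` and `|g|`, are equal.
-/
lemma nonneg_of_ae_nonneg {g : ℝ × ℝ → ℝ} {W : Set (ℝ × ℝ)} (hW : IsOpen W)
    (hg : ContinuousOn g W) (h : ∀ᵐ z : ℝ × ℝ, 0 ≤ g z) {z : ℝ × ℝ} (hz : z ∈ W) : 0 ≤ g z := by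
  have h1 : g =ᵐ[volume.restrict W] fun z => |g z| :=
    ae_restrict_of_ae (h.mono fun z hz => (abs_of_nonneg hz).symm)
  rw [Measure.eqOn_open_of_ae_eq h1 hW hg hg.abs hz]
  exact abs_nonneg _

end Classical
end OrthogonalMotion

/-! ### Assembly of the three assertions. -/

theorem mainTheorem7 {Ω : Type*} [MeasurableSpace Ω] (P : Measure Ω) [IsProbabilityMeasure P]
    (c : ℝ) (hc : 0 < c) (lam : ℝ → ℝ) (hlam : ContDiffOn ℝ 2 lam (Ioi 0))
    (hlam0 : ∀ t, 0 < t → 0 ≤ lam t)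
    (N : ℝ → Ω → ℤ) (K : ℤ → Ω → Fin 4) (X Y : ℝ → Ω → ℝ)
    (hXY : OrthogonalMotion.IsReflectingMotion P c lam N K X Y)
    (p : ℝ → ℝ → ℝ → ℝ)
    (hp : ∀ t, 0 < t → OrthogonalMotion.IsAbsContDensity (P.map (fun ω => (X t ω, Y t ω)))
      (fun x y => p x y t)) :
    -- classical form, wherever `p` is of class `C⁴`, together with pointwise nonnegativity
    (∀ O : Set (ℝ × ℝ × ℝ), IsOpen O → (∀ q ∈ O, 0 < q.2.2) →
      ContDiffOn ℝ 4 (fun q : ℝ × ℝ × ℝ => p q.1 q.2.1 q.2.2) O →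
      ∀ x y t, (x, y, t) ∈ O →
        OrthogonalMotion.SatisfiesEquationAt c lam p x y t ∧ 0 ≤ p x y t) ∧
    -- form tested in space, without any regularity assumption on `p`
    (∀ φ : ℝ → ℝ → ℝ, ContDiff ℝ (⊤ : ℕ∞) (fun z : ℝ × ℝ => φ z.1 z.2) →
      HasCompactSupport (fun z : ℝ × ℝ => φ z.1 z.2) →
      ∀ t, 0 < t →
        tsupport (fun z : ℝ × ℝ => φ z.1 z.2) ⊆ OrthogonalMotion.openSquareOffDiagonals (c * t) →
        ContDiffAt ℝ 4 (OrthogonalMotion.pairing p φ) t ∧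
        OrthogonalMotion.SatisfiesTestedEquationAt c lam p φ t) ∧
    -- nonnegativity and total mass
    (∀ t, 0 < t →
      (∀ᵐ z : ℝ × ℝ, 0 ≤ p z.1 z.2 t) ∧
      IntegrableOn (fun z : ℝ × ℝ => p z.1 z.2 t) (OrthogonalMotion.square (c * t)) ∧
      (IntegrableOn lam (Ioc 0 t) →
        ∫ z in OrthogonalMotion.square (c * t), p z.1 z.2 t =
          1 - 3 * Real.exp (-(2 / 3) * ∫ s in (0 : ℝ)..t, lam s)
            + 2 * Real.exp (-∫ s in (0 : ℝ)..t, lam s)) ∧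
      (¬ IntegrableOn lam (Ioc 0 t) →
        ∫ z in OrthogonalMotion.square (c * t), p z.1 z.2 t = 1)) := by
  have hlc := hlam.continuousOn
  refine ⟨fun O hO hO0 hpO x y t hq => ⟨?_, ?_⟩, fun φ hφ hφc t ht hsub => ?_, fun t ht => ?_⟩
  · exact OrthogonalMotion.satisfiesEquationAt_of_tested hO hpO
      (OrthogonalMotion.isClosed_singularSet (c * t)) (OrthogonalMotion.volume_singularSet (c * t))
      (fun φ hφ hd => (hXY.tested_equation hc hlam hlam0 hp hφ (hO0 _ hq) hd).2) hq
  · have hs : Continuous fun z : ℝ × ℝ => (z.1, z.2, t) := by fun_prop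
    exact OrthogonalMotion.nonneg_of_ae_nonneg (g := fun z : ℝ × ℝ => p z.1 z.2 t)
      (hO.preimage hs) (hpO.continuousOn.comp hs.continuousOn fun z hz => hz)
      (hp t (hO0 _ hq)).ae_nonneg (z := (x, y)) hq
  · exact hXY.tested_equation hc hlam hlam0 hp ⟨hφ, hφc⟩ ht
      ((OrthogonalMotion.disjoint_openSquareOffDiagonals_singularSet (c * t)).mono_left hsub)
  · have := Measure.isProbabilityMeasure_map (μ := P) (hXY.measurable_position t).aemeasurable
    refine ⟨(hp t ht).ae_nonneg, (hp t ht).integrable.integrableOn, fun hint => ?_, fun hint => ?_⟩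
    · rw [hXY.integral_density hc hlc hlam0 ht (hp t ht),
        hXY.measureReal_notMem_singularSet hc hlc hlam0 ht hint]
    · rw [hXY.integral_density hc hlc hlam0 ht (hp t ht),
        hXY.measureReal_notMem_singularSet_eq_one hc hlc hlam0 ht hint]
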